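/- Let $d\ge 2$ and let $\Omega\subset\mathbb{R}^d$ be a non-empty, bounded, open, convex set, with surface measure $\sigma$ on $\partial\Omega$. Let $\Gamma,\Gamma'\subset\partial\Omega$ be disjoint, relatively open, non-empty sets with $\overline{\Gamma}\cup\overline{\Gamma'}=\partial\Omega$ and $\sigma(\overline{\Gamma}\setminus\Gamma)=0$, and suppose that $\Gamma'$ is contained in a hyperplane $\{x\in\mathbb{R}^d : x_1=c\}$ perpendicular to the first coordinate axis. Let $U^2(\Omega)$ be the set of all real-valued $w\in H^2(\Omega)$ such that the trace of $w$ vanishes $\sigma$-almost everywhere on $\Gamma$ and $\partial_\nu w|_{\Gamma'}=0$, where the latter means $$\int_\Omega \nabla w\cdot\nabla v+\int_\Omega(\Delta w)\,v=0$$ for every real-valued $v\in H^1(\Omega)$ whose trace vanishes $\sigma$-almost everywhere on $\partial\Omega\setminus\overline{\Gamma'}$. Then for every $j\in\{1,\dots,d\}$ and every $u\in U^2(\Omega)$, $$\int_\Omega(\partial_1\partial_j u)^2\le\int_\Omega(\partial_1^2u)(\partial_j^2u).$$ -/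

import Mathlib

open MeasureTheory Filter Topology
open scoped ContDiff

noncomputable section

namespace MixedBVP

variable {d : ℕ}

/-- The classical partial derivative in the direction of the `i`-th coordinate axis. -/
def partialDeriv (i : Fin d) (φ : EuclideanSpace ℝ (Fin d) → ℝ) :
    EuclideanSpace ℝ (Fin d) → ℝ :=
  fun x => fderiv ℝ φ x (EuclideanSpace.single i 1)

/-- `g` is the weak partial derivative `∂ᵢ f` on the open set `Ω`:
`∫_Ω f ∂ᵢφ = - ∫_Ω g φ` for all test functions `φ ∈ C_c^∞(Ω)`. -/
def HasWeakPartial (Ω : Set (EuclideanSpace ℝ (Fin d))) (i : Fin d)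
    (f g : EuclideanSpace ℝ (Fin d) → ℝ) : Prop :=
  LocallyIntegrableOn f Ω ∧ LocallyIntegrableOn g Ω ∧
    ∀ φ : EuclideanSpace ℝ (Fin d) → ℝ, ContDiff ℝ ∞ φ → HasCompactSupport φ → tsupport φ ⊆ Ω →
      ∫ x in Ω, f x * partialDeriv i φ x = - ∫ x in Ω, g x * φ x

open Classical in
/-- A representative of the weak partial derivative `∂ᵢ f` on `Ω` (unique up to null sets in `Ω`);
zero if there is none. -/
def weakPartial (Ω : Set (EuclideanSpace ℝ (Fin d))) (i : Fin d)
    (f : EuclideanSpace ℝ (Fin d) → ℝ) : EuclideanSpace ℝ (Fin d) → ℝ :=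
  if h : ∃ g, HasWeakPartial Ω i f g then h.choose else 0

/-- Any weak partial derivative agrees almost everywhere on `Ω` with the chosen representative. -/
theorem HasWeakPartial.ae_eq_weakPartial {Ω : Set (EuclideanSpace ℝ (Fin d))} (hΩ : IsOpen Ω)
    {i : Fin d} {f g : EuclideanSpace ℝ (Fin d) → ℝ} (h : HasWeakPartial Ω i f g) :
    g =ᵐ[volume.restrict Ω] weakPartial Ω i f := by
  have hex : ∃ g, HasWeakPartial Ω i f g := ⟨g, h⟩
  have hw : HasWeakPartial Ω i f (weakPartial Ω i f) := by
    unfold weakPartial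
    rw [dif_pos hex]
    exact hex.choose_spec
  set w := weakPartial Ω i f
  have key : ∀ᵐ x ∂(volume : Measure (EuclideanSpace ℝ (Fin d))), x ∈ Ω → (g - w) x = 0 := by
    refine hΩ.ae_eq_zero_of_integral_contDiff_smul_eq_zero (h.2.1.sub hw.2.1) ?_
    intro φ hφ hc hs
    have h1 := h.2.2 φ hφ hc hs
    have h2 := hw.2.2 φ hφ hc hs
    have aux : ∀ k : EuclideanSpace ℝ (Fin d) → ℝ, LocallyIntegrableOn k Ω →
        Integrable (fun x => φ x * k x) (volume.restrict Ω) := by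
      intro k hk
      have hK : IsCompact (tsupport φ) := hc
      have hkK : IntegrableOn k (tsupport φ) := hk.integrableOn_compact_subset hs hK
      have h3 : IntegrableOn (fun x => φ x * k x) (tsupport φ) :=
        hkK.continuousOn_mul hφ.continuous.continuousOn hK
      have h4 : Integrable (fun x => φ x * k x) := by
        refine (integrableOn_iff_integrable_of_support_subset ?_).1 h3
        intro x hx
        exact subset_tsupport φ (left_ne_zero_of_mul hx)
      exact h4.integrableOn
    have hsub : ∫ x, φ x • (g - w) x = ∫ x in Ω, φ x • (g - w) x := by
      symm
      refine setIntegral_eq_integral_of_forall_compl_eq_zero ?_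
      intro x hx
      have : φ x = 0 := by
        by_contra hne
        exact hx (hs (subset_tsupport φ hne))
      simp [this]
    rw [hsub]
    have hfun : (fun x => φ x • (g - w) x) = fun x => φ x * g x - φ x * w x := by
      funext x
      simp [mul_sub]
    rw [hfun, integral_sub (aux g h.2.1) (aux w hw.2.1)]
    have e1 : ∫ x in Ω, φ x * g x = ∫ x in Ω, g x * φ x := by simp only [mul_comm]
    have e2 : ∫ x in Ω, φ x * w x = ∫ x in Ω, w x * φ x := by simp only [mul_comm]
    rw [e1, e2]
    linarith
  rw [Filter.EventuallyEq, ae_restrict_iff' hΩ.measurableSet]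
  filter_upwards [key] with x hx hxΩ
  have := hx hxΩ
  simp only [Pi.sub_apply] at this
  linarith

/-- The real Sobolev space `H¹(Ω)`. -/
def MemH1 (Ω : Set (EuclideanSpace ℝ (Fin d))) (f : EuclideanSpace ℝ (Fin d) → ℝ) : Prop :=
  MemLp f 2 (volume.restrict Ω) ∧
    ∀ i : Fin d, ∃ g, HasWeakPartial Ω i f g ∧ MemLp g 2 (volume.restrict Ω)

/-- The real Sobolev space `H²(Ω)`. -/
def MemH2 (Ω : Set (EuclideanSpace ℝ (Fin d))) (f : EuclideanSpace ℝ (Fin d) → ℝ) : Prop :=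
  MemH1 Ω f ∧ ∀ i : Fin d, MemH1 Ω (weakPartial Ω i f)

/-- The surface measure of `∂Ω`: the `(d-1)`-dimensional Hausdorff measure on `∂Ω`
(its normalization plays no role for vanishing traces). -/
def surfaceMeasure (Ω : Set (EuclideanSpace ℝ (Fin d))) : Measure (EuclideanSpace ℝ (Fin d)) :=
  (Measure.hausdorffMeasure ((d : ℝ) - 1)).restrict (frontier Ω)

/-- `g` is the trace `f|_{∂Ω}` of `f ∈ H¹(Ω)`. The trace is the continuous extension to `H¹(Ω)`
of the restriction map `C^∞(closure Ω) ∋ φ ↦ φ|_{∂Ω}`, so `g` is the limit in `L²(∂Ω)` of the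
boundary values of smooth functions that converge to `f` in `H¹(Ω)`. -/
def HasTrace (Ω : Set (EuclideanSpace ℝ (Fin d))) (f g : EuclideanSpace ℝ (Fin d) → ℝ) : Prop :=
  MemH1 Ω f ∧ MemLp g 2 (surfaceMeasure Ω) ∧
    ∃ φ : ℕ → EuclideanSpace ℝ (Fin d) → ℝ, (∀ n, ContDiff ℝ ∞ (φ n)) ∧
      Tendsto (fun n => eLpNorm (f - φ n) 2 (volume.restrict Ω)) atTop (𝓝 0) ∧
      (∀ i : Fin d, Tendsto
        (fun n => eLpNorm (weakPartial Ω i f - partialDeriv i (φ n)) 2 (volume.restrict Ω))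
        atTop (𝓝 0)) ∧
      Tendsto (fun n => eLpNorm (g - φ n) 2 (surfaceMeasure Ω)) atTop (𝓝 0)

/-- The Dirichlet condition `f|_S = 0` on a part `S` of `∂Ω`. -/
def TraceVanishesOn (Ω S : Set (EuclideanSpace ℝ (Fin d)))
    (f : EuclideanSpace ℝ (Fin d) → ℝ) : Prop :=
  ∃ g, HasTrace Ω f g ∧ ∀ᵐ x ∂(surfaceMeasure Ω), x ∈ S → g x = 0

/-- The weak Laplacian `Δf = ∑ᵢ ∂ᵢ∂ᵢ f` on `Ω`. -/
def weakLaplacian (Ω : Set (EuclideanSpace ℝ (Fin d))) (f : EuclideanSpace ℝ (Fin d) → ℝ) :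
    EuclideanSpace ℝ (Fin d) → ℝ :=
  fun x => ∑ i : Fin d, weakPartial Ω i (weakPartial Ω i f) x

/-- The Neumann condition `∂_ν f|_S = 0` for `f ∈ H²(Ω)` on a relatively open part `S` of `∂Ω`.
The normal derivative is the functional `v|_{∂Ω} ↦ ∫_Ω ∇f · ∇v + ∫_Ω (Δf) v` on traces of
functions `v ∈ H¹(Ω)` (first Green identity), and it vanishes on `S` if it is zero for all
`v ∈ H¹(Ω)` whose trace vanishes on `∂Ω \ closure S`. -/
def NormalDerivVanishesOn (Ω S : Set (EuclideanSpace ℝ (Fin d)))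
    (f : EuclideanSpace ℝ (Fin d) → ℝ) : Prop :=
  ∀ v : EuclideanSpace ℝ (Fin d) → ℝ, TraceVanishesOn Ω (frontier Ω \ closure S) v →
    (∫ x in Ω, ∑ i : Fin d, weakPartial Ω i f x * weakPartial Ω i v x) +
      ∫ x in Ω, weakLaplacian Ω f x * v x = 0

/-- The space `U²(Ω)` of real functions `w ∈ H²(Ω)` with `w|_Γ = 0` and `∂_ν w|_Γ' = 0`. -/
def U2 (Ω Γ Γ' : Set (EuclideanSpace ℝ (Fin d))) : Set (EuclideanSpace ℝ (Fin d) → ℝ) :=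
  {w | MemH2 Ω w ∧ TraceVanishesOn Ω Γ w ∧ NormalDerivVanishesOn Ω Γ' w}

/-- `S` is a relatively open subset of `∂Ω`. -/
def IsRelOpenInBoundary (Ω S : Set (EuclideanSpace ℝ (Fin d))) : Prop :=
  ∃ O : Set (EuclideanSpace ℝ (Fin d)), IsOpen O ∧ S = O ∩ frontier Ω

end MixedBVP

end

noncomputable section

namespace MixedBVP

-- Let `k` be the first coordinate and `j ≠ k` (for `j = k` both sides agree). Put `p = ∂ₖu` and `q
-- = ∂ⱼu`. Since `∂ⱼp = ∂ₖq`, the claim says that the bracket `{p, q} = ∂ₖp ∂ⱼq - ∂ⱼp ∂ₖq` has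
-- nonnegative integral. The bracket is a null Lagrangian, so its integral is a boundary term, and
-- three parts of the boundary behave differently.
--
-- On the flat face `{xₖ = c}`, almost every point is either a Neumann point, where `p = 0`, or a
-- Dirichlet point, where the tangential derivative `q` is zero. The boundary term is `p` times a
-- tangential derivative of `q`, so it vanishes formally even where the two conditions meet inside
-- the face. Since `p` and `q` are only in `H¹`, this is proved by testing with `χ T(p) m(q)`, where
-- `T` truncates and `m` cuts off near zero: derivatives of `m(q)` drop out by antisymmetry, and `∇q
-- = 0` a.e. on `{q = 0}` permits the limit (`face_integral_eq_zero`).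
--
-- Off the face, `u = 0` makes the gradient normal to the boundary, so `(q, -p)` is tangential as
-- far as these two coordinates are concerned. The boundary term is then a curvature term, with a
-- sign by convexity. No boundary regularity is needed: the weak normality condition is tested with
-- `χ (q ∂ₖΦ - p ∂ⱼΦ)` for smooth concave `Φ`, whose negative semidefinite Hessian gives the sign.
-- The gradients of `Φ` are traded for those of test functions with support in `Ω`
-- (`IsMixedField.bracket_nonneg_of_tsupport`).
--
-- The relative boundary of the face, the edge, has codimension two and is removed by cutoffs `χ` at
-- scale `r`. The error is an integral of `|∇χ| (|p| + |q|) (|∇p| + |∇q|)` over a shell of width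
-- about `r`. An `H¹` function has square integral at most `C r² (1 + log (1/r))` within distance
-- `r` of the edge (`IsFaceFrame.exists_integral_edge_le`), because plane sections through an
-- interior axis of the face reduce this to a corner of a planar convex domain. This alone does not
-- make the error small. Along `r = 16⁻ᵐ`, however, the shells are disjoint, so the gradient masses
-- on them are summable and infinitely often smaller than `ε²/(m+1)`. That is exactly what
-- compensates the logarithm (`IsMixedField.integral_bracket_nonneg`).

local notation "𝔼" d => EuclideanSpace ℝ (Fin d)

/-! ### Convergence in `L²`. -/

section

/-- Convergence in `L²(μ)` of a sequence of real functions. -/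
structure L2Lim {α : Type*} [MeasurableSpace α] (μ : Measure α) (φ : ℕ → α → ℝ) (f : α → ℝ) :
    Prop where
  memLp_seq : ∀ n, MemLp (φ n) 2 μ
  memLp : MemLp f 2 μ
  tendsto : Tendsto (fun n => eLpNorm (φ n - f) 2 μ) atTop (𝓝 0)

namespace L2Lim

variable {α : Type*} [MeasurableSpace α] {μ : Measure α} {φ ψ : ℕ → α → ℝ} {f g : α → ℝ}

theorem const (hf : MemLp f 2 μ) : L2Lim μ (fun _ => f) f :=
  ⟨fun _ => hf, hf, by simp⟩

theorem add (h₁ : L2Lim μ φ f) (h₂ : L2Lim μ ψ g) :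
    L2Lim μ (fun n x => φ n x + ψ n x) (fun x => f x + g x) := by
  refine ⟨fun n => (h₁.memLp_seq n).add (h₂.memLp_seq n), h₁.memLp.add h₂.memLp, ?_⟩
  have h := h₁.tendsto.add h₂.tendsto
  rw [add_zero] at h
  refine tendsto_of_tendsto_of_tendsto_of_le_of_le tendsto_const_nhds h (fun _ => zero_le) ?_
  intro n
  have : ((fun x => φ n x + ψ n x) - fun x => f x + g x) = (φ n - f) + (ψ n - g) := by
    ext x; simp; ring
  show eLpNorm ((fun x => φ n x + ψ n x) - fun x => f x + g x) 2 μ ≤ _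
  rw [this]
  exact eLpNorm_add_le ((h₁.memLp_seq n).sub h₁.memLp).1 ((h₂.memLp_seq n).sub h₂.memLp).1
    (by norm_num)

theorem neg (h₁ : L2Lim μ φ f) : L2Lim μ (fun n x => -φ n x) (fun x => -f x) := by
  refine ⟨fun n => (h₁.memLp_seq n).neg, h₁.memLp.neg, ?_⟩
  refine h₁.tendsto.congr fun n => ?_
  rw [← eLpNorm_neg]
  congr 1
  ext x; simp; ring

theorem sub (h₁ : L2Lim μ φ f) (h₂ : L2Lim μ ψ g) :
    L2Lim μ (fun n x => φ n x - ψ n x) (fun x => f x - g x) := by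
  simpa only [sub_eq_add_neg] using h₁.add h₂.neg

theorem mono_measure {ν : Measure α} (h₁ : L2Lim μ φ f) (h : ν ≤ μ) : L2Lim ν φ f :=
  ⟨fun n => (h₁.memLp_seq n).mono_measure h, h₁.memLp.mono_measure h,
    tendsto_of_tendsto_of_tendsto_of_le_of_le tendsto_const_nhds h₁.tendsto (fun _ => zero_le)
      fun _ => eLpNorm_mono_measure _ h⟩

theorem subseq (h₁ : L2Lim μ φ f) {k : ℕ → ℕ} (hk : Tendsto k atTop atTop) :
    L2Lim μ (fun n => φ (k n)) f :=
  ⟨fun _ => h₁.memLp_seq _, h₁.memLp, h₁.tendsto.comp hk⟩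

theorem exists_subseq_ae (h₁ : L2Lim μ φ f) :
    ∃ k : ℕ → ℕ, StrictMono k ∧ ∀ᵐ x ∂μ, Tendsto (fun n => φ (k n) x) atTop (𝓝 (f x)) :=
  (tendstoInMeasure_of_tendsto_eLpNorm (by norm_num) (fun n => (h₁.memLp_seq n).1) h₁.memLp.1
    h₁.tendsto).exists_seq_tendsto_ae

theorem memLp_bdd_mul {c : α → ℝ} {C : ℝ} (hf : MemLp f 2 μ) (hc : AEStronglyMeasurable c μ)
    (hC : ∀ᵐ x ∂μ, |c x| ≤ C) : MemLp (fun x => c x * f x) 2 μ :=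
  MemLp.of_le_mul (c := C) hf (hc.mul hf.1) (by
    filter_upwards [hC] with x hx
    rw [norm_mul]
    exact mul_le_mul_of_nonneg_right hx (norm_nonneg _))

theorem bdd_mul {c : α → ℝ} {C : ℝ} (h₁ : L2Lim μ φ f) (hc : AEStronglyMeasurable c μ)
    (hC : ∀ᵐ x ∂μ, |c x| ≤ C) : L2Lim μ (fun n x => c x * φ n x) (fun x => c x * f x) := by
  refine ⟨fun n => memLp_bdd_mul (h₁.memLp_seq n) hc hC, memLp_bdd_mul h₁.memLp hc hC, ?_⟩
  have h := ENNReal.Tendsto.const_mul (a := ENNReal.ofReal C) h₁.tendsto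
    (Or.inr ENNReal.ofReal_ne_top)
  rw [mul_zero] at h
  refine tendsto_of_tendsto_of_tendsto_of_le_of_le tendsto_const_nhds h (fun _ => zero_le) ?_
  intro n
  refine eLpNorm_le_mul_eLpNorm_of_ae_le_mul ?_ 2
  filter_upwards [hC] with x hx
  simp only [Pi.sub_apply, ← mul_sub, norm_mul]
  exact mul_le_mul_of_nonneg_right hx (norm_nonneg _)

/-- Write `φψ - fg = φ(ψ - g) + (φ - f)g` and apply Hölder to each term; this gives convergence in
`L¹`. -/
theorem integral_mul (h₁ : L2Lim μ φ f) (h₂ : L2Lim μ ψ g) :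
    Tendsto (fun n => ∫ x, φ n x * ψ n x ∂μ) atTop (𝓝 (∫ x, f x * g x ∂μ)) := by
  have hmul : ∀ {u v : α → ℝ}, AEStronglyMeasurable u μ → AEStronglyMeasurable v μ →
      eLpNorm (fun x => u x * v x) 1 μ ≤ eLpNorm u 2 μ * eLpNorm v 2 μ := fun {u v} hu hv => by
    have h := eLpNorm_smul_le_mul_eLpNorm (p := 2) (q := 2) (r := 1) hv hu
    have e : (fun x => u x * v x) = u • v := rfl
    rw [e]
    exact h
  refine tendsto_integral_of_L1' (fun x => f x * g x) ?_
    (Eventually.of_forall fun n => (h₁.memLp_seq n).integrable_mul (h₂.memLp_seq n)) ?_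
  · exact (h₁.memLp.integrable_mul h₂.memLp).1
  have hb := h₁.tendsto.const_add (eLpNorm f 2 μ)
  rw [add_zero] at hb
  have hlim : Tendsto (fun n => (eLpNorm f 2 μ + eLpNorm (φ n - f) 2 μ) * eLpNorm (ψ n - g) 2 μ
      + eLpNorm (φ n - f) 2 μ * eLpNorm g 2 μ) atTop (𝓝 0) := by
    have e1 := ENNReal.Tendsto.mul hb (Or.inr ENNReal.zero_ne_top) h₂.tendsto
      (Or.inr h₁.memLp.2.ne)
    have e2 := ENNReal.Tendsto.mul_const (b := eLpNorm g 2 μ) h₁.tendsto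
      (Or.inr h₂.memLp.2.ne)
    simpa using e1.add e2
  refine tendsto_of_tendsto_of_tendsto_of_le_of_le tendsto_const_nhds hlim (fun _ => zero_le) ?_
  intro n
  have hφ := h₁.memLp_seq n
  have hψ := h₂.memLp_seq n
  have hs : ((fun x => φ n x * ψ n x) - fun x => f x * g x) =
      (fun x => φ n x * (ψ n - g) x) + fun x => (φ n - f) x * g x := by
    ext x; simp; ring
  have h0 : eLpNorm (φ n) 2 μ ≤ eLpNorm f 2 μ + eLpNorm (φ n - f) 2 μ := by
    have := eLpNorm_add_le (p := 2) h₁.memLp.1 (hφ.sub h₁.memLp).1 (by norm_num)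
    simpa using this
  show eLpNorm ((fun x => φ n x * ψ n x) - fun x => f x * g x) 1 μ ≤ _
  rw [hs]
  calc _ ≤ _ := eLpNorm_add_le (hφ.1.mul (hψ.sub h₂.memLp).1)
        ((hφ.sub h₁.memLp).1.mul h₂.memLp.1) le_rfl
    _ ≤ _ := add_le_add
        ((hmul hφ.1 (hψ.sub h₂.memLp).1).trans (mul_le_mul_left h0 _))
        (hmul (hφ.sub h₁.memLp).1 h₂.memLp.1)

/-- Dominated convergence for `|Fₙ - G|²` with majorant `(2|H|)²`. -/
theorem of_dominated {F : ℕ → α → ℝ} {G H : α → ℝ} (hF : ∀ n, AEStronglyMeasurable (F n) μ)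
    (hH : MemLp H 2 μ) (hb : ∀ n, ∀ᵐ x ∂μ, |F n x| ≤ |H x|)
    (hl : ∀ᵐ x ∂μ, Tendsto (fun n => F n x) atTop (𝓝 (G x))) : L2Lim μ F G := by
  have hFm : ∀ n, MemLp (F n) 2 μ := fun n => hH.mono (hF n) (hb n)
  have hGa : AEStronglyMeasurable G μ := aestronglyMeasurable_of_tendsto_ae atTop hF hl
  have hGm : MemLp G 2 μ := by
    refine hH.mono hGa ?_
    filter_upwards [hl, ae_all_iff.2 hb] with x hx hbx
    exact le_of_tendsto hx.norm (Eventually.of_forall hbx)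
  refine ⟨hFm, hGm, ?_⟩
  have hsq : Tendsto (fun n => ∫⁻ x, ‖(F n - G) x‖ₑ ^ (2:ℝ) ∂μ) atTop (𝓝 0) := by
    have hbd : ∫⁻ x, (2 * ‖H x‖ₑ) ^ (2:ℝ) ∂μ ≠ ⊤ := by
      have h2 := (hH.const_mul 2).2
      have := lintegral_rpow_enorm_lt_top_of_eLpNorm_lt_top (by norm_num) (by norm_num) h2
      refine (lt_of_le_of_lt (le_of_eq ?_) this).ne
      refine lintegral_congr fun x => ?_
      simp [enorm_mul, Real.enorm_eq_ofReal]
    have := tendsto_lintegral_of_dominated_convergence' (μ := μ)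
      (F := fun n x => ‖(F n - G) x‖ₑ ^ (2:ℝ)) (f := fun _ => 0)
      (fun x => (2 * ‖H x‖ₑ) ^ (2:ℝ)) (fun n => (((hFm n).sub hGm).1.enorm).pow_const _)
      ?_ hbd ?_
    · simpa using this
    · intro n
      filter_upwards [hl, ae_all_iff.2 hb] with x hx hbx
      refine ENNReal.rpow_le_rpow ?_ (by norm_num)
      have hG : |G x| ≤ |H x| := le_of_tendsto hx.abs (Eventually.of_forall hbx)
      have : ‖(F n - G) x‖ ≤ ‖2 * H x‖ := by
        simp only [Pi.sub_apply, Real.norm_eq_abs, abs_mul, abs_two]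
        calc _ ≤ |F n x| + |G x| := abs_sub _ _
          _ ≤ _ := by linarith [hbx n]
      have h3 := enorm_le_iff_norm_le.2 this
      simpa [enorm_mul, Real.enorm_eq_ofReal] using h3
    · filter_upwards [hl] with x hx
      have : Tendsto (fun n => (F n - G) x) atTop (𝓝 0) := by
        simpa using hx.sub_const (G x)
      have h3 := this.enorm
      have h4 := h3.ennrpow_const 2
      simpa using h4
  have h2 : ∀ n, eLpNorm (F n - G) 2 μ = (∫⁻ x, ‖(F n - G) x‖ₑ ^ (2:ℝ) ∂μ) ^ (1/2 : ℝ) := by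
    intro n
    rw [eLpNorm_eq_lintegral_rpow_enorm_toReal (by norm_num) (by norm_num)]
    norm_num
  simp only [h2]
  have := hsq.ennrpow_const (1/2)
  simpa using this

/-- In `cₙφₙ - c₀f = cₙ(φₙ - f) + (cₙ - c₀)f` the first term is controlled by boundedness of `cₙ`,
the second by domination. This is what allows nonlinear functions of `H¹` limits, with `cₙ` only
converging pointwise. -/
theorem bdd_seq_mul {c : ℕ → α → ℝ} {c₀ : α → ℝ} {C : ℝ} (h₁ : L2Lim μ φ f)
    (hc : ∀ n, AEStronglyMeasurable (c n) μ) (hC : ∀ n, ∀ᵐ x ∂μ, |c n x| ≤ C)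
    (hl : ∀ᵐ x ∂μ, Tendsto (fun n => c n x) atTop (𝓝 (c₀ x))) :
    L2Lim μ (fun n x => c n x * φ n x) (fun x => c₀ x * f x) := by
  have hA : L2Lim μ (fun n x => c n x * f x) (fun x => c₀ x * f x) := by
    refine of_dominated (H := fun x => C * f x) (fun n => (hc n).mul h₁.memLp.1)
      (h₁.memLp.const_mul C) (fun n => ?_) ?_
    · filter_upwards [hC n] with x hx
      rw [abs_mul, abs_mul]
      exact mul_le_mul_of_nonneg_right (hx.trans (le_abs_self C)) (abs_nonneg _)
    · filter_upwards [hl] with x hx using hx.mul_const _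
  refine ⟨fun n => memLp_bdd_mul (h₁.memLp_seq n) (hc n) (hC n), hA.memLp, ?_⟩
  have h := ENNReal.Tendsto.const_mul (a := ENNReal.ofReal C) h₁.tendsto
    (Or.inr ENNReal.ofReal_ne_top)
  have h' := h.add hA.tendsto
  rw [mul_zero, add_zero] at h'
  refine tendsto_of_tendsto_of_tendsto_of_le_of_le tendsto_const_nhds h' (fun _ => zero_le) ?_
  intro n
  have hs : ((fun x => c n x * φ n x) - fun x => c₀ x * f x) =
      (fun x => c n x * (φ n - f) x) + ((fun x => c n x * f x) - fun x => c₀ x * f x) := by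
    ext x; simp; ring
  show eLpNorm ((fun x => c n x * φ n x) - fun x => c₀ x * f x) 2 μ ≤ _
  rw [hs]
  refine (eLpNorm_add_le ((hc n).mul ((h₁.memLp_seq n).sub h₁.memLp).1)
    ((hA.memLp_seq n).sub hA.memLp).1 (by norm_num)).trans (add_le_add ?_ le_rfl)
  refine eLpNorm_le_mul_eLpNorm_of_ae_le_mul ?_ 2
  filter_upwards [hC n] with x hx
  show ‖c n x * (φ n - f) x‖ ≤ _
  rw [norm_mul]
  exact mul_le_mul_of_nonneg_right hx (norm_nonneg _)

end L2Lim

end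

/-! ### Smooth partial derivatives and smooth approximation in `H¹`. -/

section

variable {d : ℕ}


section PartialDeriv

variable {f g : (𝔼 d) → ℝ} {i k : Fin d}

theorem contDiff_partialDeriv (hf : ContDiff ℝ ∞ f) (i : Fin d) :
    ContDiff ℝ ∞ (partialDeriv i f) :=
  (hf.fderiv_right (m := ∞) (by simp)).clm_apply contDiff_const

theorem continuous_partialDeriv (hf : ContDiff ℝ ∞ f) (i : Fin d) :
    Continuous (partialDeriv i f) :=
  (contDiff_partialDeriv hf i).continuous

theorem partialDeriv_mul (hf : ContDiff ℝ ∞ f) (hg : ContDiff ℝ ∞ g) (i : Fin d) :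
    partialDeriv i (fun x => f x * g x) =
      fun x => partialDeriv i f x * g x + f x * partialDeriv i g x := by
  ext x
  have := fderiv_fun_mul (hf.differentiable (by simp) x) (hg.differentiable (by simp) x)
  simp only [partialDeriv, this, add_apply, smul_apply,
    smul_eq_mul]
  ring

theorem partialDeriv_add (hf : ContDiff ℝ ∞ f) (hg : ContDiff ℝ ∞ g) (i : Fin d) :
    partialDeriv i (fun x => f x + g x) = fun x => partialDeriv i f x + partialDeriv i g x := by
  ext x
  have := fderiv_fun_add (hf.differentiable (by simp) x) (hg.differentiable (by simp) x)
  simp only [partialDeriv, this, add_apply]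

theorem partialDeriv_sub (hf : ContDiff ℝ ∞ f) (hg : ContDiff ℝ ∞ g) (i : Fin d) :
    partialDeriv i (fun x => f x - g x) = fun x => partialDeriv i f x - partialDeriv i g x := by
  ext x
  have := fderiv_fun_sub (hf.differentiable (by simp) x) (hg.differentiable (by simp) x)
  simp only [partialDeriv, this, sub_apply]

theorem partialDeriv_comp {T : ℝ → ℝ} (hT : ContDiff ℝ ∞ T) (hf : ContDiff ℝ ∞ f) (i : Fin d) :
    partialDeriv i (fun x => T (f x)) = fun x => deriv T (f x) * partialDeriv i f x := by
  ext x
  have h1 := ((hT.differentiable (by simp)) (f x)).hasDerivAt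
  have h2 := (hf.differentiable (by simp) x).hasFDerivAt
  have := (h1.comp_hasFDerivAt x h2).fderiv
  simp only [partialDeriv]
  erw [this]
  simp

theorem partialDeriv_comm (hf : ContDiff ℝ ∞ f) (i k : Fin d) :
    partialDeriv i (partialDeriv k f) = partialDeriv k (partialDeriv i f) := by
  ext x
  have hd : DifferentiableAt ℝ (fderiv ℝ f) x :=
    (hf.fderiv_right (m := ∞) (by simp)).differentiable (by simp) x
  have hsym : IsSymmSndFDerivAt ℝ f x :=
    (hf.contDiffAt (x := x)).isSymmSndFDerivAt (by
      rw [minSmoothness_of_isRCLikeNormedField]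
      exact WithTop.coe_le_coe.2 (le_top : (2 : ℕ∞) ≤ ⊤))
  have key : ∀ v w : 𝔼 d, fderiv ℝ (fun y => fderiv ℝ f y v) x w =
      fderiv ℝ (fderiv ℝ f) x w v := by
    intro v w
    have := fderiv_clm_apply hd (differentiableAt_const v (x := x))
    rw [this]
    simp
  show fderiv ℝ (fun y => fderiv ℝ f y _) x _ = fderiv ℝ (fun y => fderiv ℝ f y _) x _
  rw [key, key]
  exact hsym _ _

theorem tsupport_partialDeriv_subset (i : Fin d) : tsupport (partialDeriv i f) ⊆ tsupport f :=
  tsupport_fderiv_apply_subset ℝ _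

theorem partialDeriv_eq_zero {x : 𝔼 d} (hx : x ∉ tsupport f) (i : Fin d) :
    partialDeriv i f x = 0 :=
  image_eq_zero_of_notMem_tsupport fun h => hx (tsupport_partialDeriv_subset i h)

end PartialDeriv

theorem exists_bound_of_continuous {Ω : Set (𝔼 d)} (hΩ : Bornology.IsBounded Ω)
    {c : (𝔼 d) → ℝ} (hc : Continuous c) : ∃ C, ∀ x ∈ Ω, |c x| ≤ C := by
  obtain ⟨C, hC⟩ := hΩ.isCompact_closure.exists_bound_of_continuousOn hc.continuousOn
  exact ⟨C, fun x hx => hC x (subset_closure hx)⟩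

theorem memLp_of_continuous {Ω : Set (𝔼 d)} (hΩo : IsOpen Ω) (hΩ : Bornology.IsBounded Ω)
    {c : (𝔼 d) → ℝ} (hc : Continuous c) (p : ENNReal) : MemLp c p (volume.restrict Ω) := by
  obtain ⟨C, hC⟩ := exists_bound_of_continuous hΩ hc
  have : IsFiniteMeasure (volume.restrict Ω) := ⟨by
    simpa using hΩ.measure_lt_top⟩
  refine MemLp.of_bound hc.aestronglyMeasurable C ?_
  filter_upwards [ae_restrict_mem hΩo.measurableSet] with x hx using hC x hx

theorem integrable_of_continuous {Ω : Set (𝔼 d)} (hΩo : IsOpen Ω) (hΩ : Bornology.IsBounded Ω)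
    {c : (𝔼 d) → ℝ} (hc : Continuous c) : Integrable c (volume.restrict Ω) :=
  memLp_one_iff_integrable.1 (memLp_of_continuous hΩo hΩ hc 1)

/-- Multiplication by a continuous function on a bounded open set. -/
theorem L2Lim.continuous_mul {Ω : Set (𝔼 d)} (hΩo : IsOpen Ω) (hΩ : Bornology.IsBounded Ω)
    {φ : ℕ → (𝔼 d) → ℝ} {f c : (𝔼 d) → ℝ} (h : L2Lim (volume.restrict Ω) φ f)
    (hc : Continuous c) :
    L2Lim (volume.restrict Ω) (fun n x => c x * φ n x) (fun x => c x * f x) := by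
  obtain ⟨C, hC⟩ := exists_bound_of_continuous hΩ hc
  refine h.bdd_mul hc.aestronglyMeasurable (C := C) ?_
  filter_upwards [ae_restrict_mem hΩo.measurableSet] with x hx using hC x hx

theorem memLp_continuous_mul {Ω : Set (𝔼 d)} (hΩo : IsOpen Ω) (hΩ : Bornology.IsBounded Ω)
    {f c : (𝔼 d) → ℝ} (h : MemLp f 2 (volume.restrict Ω)) (hc : Continuous c) :
    MemLp (fun x => c x * f x) 2 (volume.restrict Ω) :=
  ((L2Lim.const h).continuous_mul hΩo hΩ hc).memLp

/-- The smooth functions `φ n` on the whole space converge in `H¹(Ω)` to `f`, whose gradient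
is `f'`. -/
structure H1Lim (Ω : Set (𝔼 d)) (φ : ℕ → (𝔼 d) → ℝ) (f : (𝔼 d) → ℝ) (f' : Fin d → (𝔼 d) → ℝ) :
    Prop where
  contDiff : ∀ n, ContDiff ℝ ∞ (φ n)
  lim : L2Lim (volume.restrict Ω) φ f
  lim' : ∀ i, L2Lim (volume.restrict Ω) (fun n => partialDeriv i (φ n)) (f' i)

namespace H1Lim

variable {Ω : Set (𝔼 d)} {φ ψ : ℕ → (𝔼 d) → ℝ} {f g : (𝔼 d) → ℝ} {f' g' : Fin d → (𝔼 d) → ℝ}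

theorem const (hΩo : IsOpen Ω) (hΩ : Bornology.IsBounded Ω) (hf : ContDiff ℝ ∞ f) :
    H1Lim Ω (fun _ => f) f (fun i => partialDeriv i f) :=
  ⟨fun _ => hf, .const (memLp_of_continuous hΩo hΩ hf.continuous 2),
    fun i => .const (memLp_of_continuous hΩo hΩ (continuous_partialDeriv hf i) 2)⟩

theorem sub (h₁ : H1Lim Ω φ f f') (h₂ : H1Lim Ω ψ g g') :
    H1Lim Ω (fun n x => φ n x - ψ n x) (fun x => f x - g x) (fun i x => f' i x - g' i x) := by
  refine ⟨fun n => (h₁.contDiff n).sub (h₂.contDiff n), h₁.lim.sub h₂.lim, fun i => ?_⟩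
  simp only [partialDeriv_sub (h₁.contDiff _) (h₂.contDiff _)]
  exact (h₁.lim' i).sub (h₂.lim' i)

theorem smooth_mul (hΩo : IsOpen Ω) (hΩ : Bornology.IsBounded Ω) (h : H1Lim Ω φ f f')
    {c : (𝔼 d) → ℝ} (hc : ContDiff ℝ ∞ c) :
    H1Lim Ω (fun n x => c x * φ n x) (fun x => c x * f x)
      (fun i x => partialDeriv i c x * f x + c x * f' i x) := by
  refine ⟨fun n => hc.mul (h.contDiff n), h.lim.continuous_mul hΩo hΩ hc.continuous, fun i => ?_⟩
  simp only [partialDeriv_mul hc (h.contDiff _)]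
  exact (h.lim.continuous_mul hΩo hΩ (continuous_partialDeriv hc i)).add
    ((h.lim' i).continuous_mul hΩo hΩ hc.continuous)

theorem subseq (h : H1Lim Ω φ f f') {k : ℕ → ℕ} (hk : Tendsto k atTop atTop) :
    H1Lim Ω (fun n => φ (k n)) f f' :=
  ⟨fun _ => h.contDiff _, h.lim.subseq hk, fun i => (h.lim' i).subseq hk⟩

end H1Lim

end

/-! ### Lines parallel to an axis and the Gauss–Green formula on a convex set. -/

section

section Lines

variable {n : ℕ}

/-- The point with `i`-th coordinate `s` and remaining coordinates `y`. -/
def linePoint (i : Fin (n + 1)) (s : ℝ) (y : Fin n → ℝ) : 𝔼 (n + 1) :=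
  WithLp.toLp 2 (i.insertNth (α := fun _ => ℝ) s y)

theorem linePoint_add (i : Fin (n + 1)) (s r : ℝ) (y : Fin n → ℝ) :
    linePoint i (s + r) y = linePoint i s y + r • EuclideanSpace.single i (1 : ℝ) := by
  ext k
  rcases Fin.eq_self_or_eq_succAbove i k with h | ⟨m, h⟩
  · subst h; simp [linePoint]
  · subst h; simp [linePoint, Fin.succAbove_ne]

theorem linePoint_combo (i : Fin (n + 1)) (s r a b : ℝ) (y y' : Fin n → ℝ) :
    a • linePoint i s y + b • linePoint i r y' = linePoint i (a * s + b * r) (a • y + b • y') := by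
  ext k
  rcases Fin.eq_self_or_eq_succAbove i k with h | ⟨m, h⟩
  · subst h; simp [linePoint]
  · subst h; simp [linePoint]

theorem continuous_linePoint (i : Fin (n + 1)) :
    Continuous fun p : ℝ × (Fin n → ℝ) => linePoint i p.1 p.2 := by
  refine (PiLp.continuous_toLp 2 _).comp ?_
  exact Continuous.finInsertNth i continuous_fst continuous_snd

theorem measurePreserving_linePoint (i : Fin (n + 1)) :
    MeasurePreserving (fun p : ℝ × (Fin n → ℝ) => linePoint i p.1 p.2) := by
  have h1 := (volume_preserving_piFinSuccAbove (fun _ : Fin (n + 1) => ℝ) i).symm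
  have h2 := PiLp.volume_preserving_toLp (Fin (n + 1))
  exact h2.comp h1

theorem measurableEmbedding_linePoint (i : Fin (n + 1)) :
    MeasurableEmbedding (fun p : ℝ × (Fin n → ℝ) => linePoint i p.1 p.2) :=
  ((MeasurableEquiv.piFinSuccAbove (fun _ : Fin (n + 1) => ℝ) i).symm.trans
    (MeasurableEquiv.toLp 2 (Fin (n + 1) → ℝ))).measurableEmbedding

theorem hasDerivAt_linePoint {φ : (𝔼 (n + 1)) → ℝ} (hφ : ContDiff ℝ ∞ φ) (i : Fin (n + 1))
    (y : Fin n → ℝ) (s : ℝ) :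
    HasDerivAt (fun s => φ (linePoint i s y)) (partialDeriv i φ (linePoint i s y)) s := by
  have h1 : HasDerivAt (fun s => linePoint i s y) (EuclideanSpace.single i (1 : ℝ)) s := by
    have e : (fun s => linePoint i s y) =
        fun s => linePoint i 0 y + s • EuclideanSpace.single i (1 : ℝ) := by
      ext1 s
      rw [← linePoint_add, zero_add]
    rw [e]
    simpa using ((hasDerivAt_id s).smul_const (EuclideanSpace.single i (1 : ℝ))).const_add
      (linePoint i 0 y)
  exact ((hφ.differentiable (by simp)) _).hasFDerivAt.comp_hasDerivAt s h1

/-- The coordinates other than the `i`-th one. -/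
def dropCoord (i : Fin (n + 1)) (x : 𝔼 (n + 1)) : Fin n → ℝ := fun k => x (i.succAbove k)

theorem dropCoord_linePoint (i : Fin (n + 1)) (s : ℝ) (y : Fin n → ℝ) :
    dropCoord i (linePoint i s y) = y := by
  ext k; simp [dropCoord, linePoint]

theorem linePoint_dropCoord (i : Fin (n + 1)) (x : 𝔼 (n + 1)) :
    linePoint i (x i) (dropCoord i x) = x := by
  ext k
  rcases Fin.eq_self_or_eq_succAbove i k with h | ⟨m, h⟩
  · subst h; simp [linePoint]
  · subst h; simp [linePoint, dropCoord]

/-- The target carries the sup norm, in which Hausdorff measure of full dimension is exactly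
Lebesgue measure; the constant `1` then gives a clean comparison of measures. -/
theorem lipschitz_dropCoord (i : Fin (n + 1)) : LipschitzWith 1 (dropCoord (n := n) i) := by
  refine LipschitzWith.of_dist_le_mul fun x y => ?_
  rw [NNReal.coe_one, one_mul, dist_pi_le_iff dist_nonneg]
  intro k
  rw [dist_eq_norm, dist_eq_norm]
  exact PiLp.norm_apply_le (x - y) _

/-- The section of `Ω` by the line in direction `i` through `y`. -/
def lineSection (Ω : Set (𝔼 (n + 1))) (i : Fin (n + 1)) (y : Fin n → ℝ) : Set ℝ :=
  {s | linePoint i s y ∈ Ω}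

variable {Ω : Set (𝔼 (n + 1))}

theorem isOpen_lineSection (hΩ : IsOpen Ω) (i : Fin (n + 1)) (y : Fin n → ℝ) :
    IsOpen (lineSection Ω i y) :=
  hΩ.preimage ((continuous_linePoint i).comp (continuous_id.prodMk continuous_const))

theorem ordConnected_lineSection (hc : Convex ℝ Ω) (i : Fin (n + 1)) (y : Fin n → ℝ) :
    (lineSection Ω i y).OrdConnected := by
  refine Convex.ordConnected (𝕜 := ℝ) ?_
  intro s hs r hr a b ha hb hab
  have := hc hs hr ha hb hab
  rw [linePoint_combo, ← add_smul, hab, one_smul] at this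
  exact this

theorem isBounded_lineSection (hb : Bornology.IsBounded Ω) (i : Fin (n + 1)) (y : Fin n → ℝ) :
    Bornology.IsBounded (lineSection Ω i y) := by
  obtain ⟨C, hC⟩ := hb.exists_norm_le
  refine isBounded_iff_forall_norm_le.2 ⟨C, fun s hs => ?_⟩
  have h := (PiLp.norm_apply_le (linePoint i s y) i).trans (hC _ hs)
  simpa [linePoint] using h

theorem eq_Ioo_of_isOpen {S : Set ℝ} (ho : IsOpen S) (hc : S.OrdConnected)
    (hb : Bornology.IsBounded S) (hne : S.Nonempty) : S = Set.Ioo (sInf S) (sSup S) := by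
  have hba := hb.bddAbove
  have hbb := hb.bddBelow
  ext s
  constructor
  · intro hs
    obtain ⟨ε, hε, hball⟩ := Metric.isOpen_iff.1 ho s hs
    have h1 : s + ε / 2 ∈ S := hball (by
      rw [Metric.mem_ball, Real.dist_eq, add_sub_cancel_left, abs_of_pos] <;> linarith)
    have h2 : s - ε / 2 ∈ S := hball (by
      rw [Metric.mem_ball, Real.dist_eq, sub_sub_cancel_left, abs_neg, abs_of_pos] <;> linarith)
    exact ⟨by linarith [csInf_le hbb h2], by linarith [le_csSup hba h1]⟩
  · rintro ⟨h1, h2⟩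
    obtain ⟨a, ha, has⟩ := exists_lt_of_csInf_lt hne h1
    obtain ⟨b, hb', hbs⟩ := exists_lt_of_lt_csSup hne h2
    exact hc.out ha hb' ⟨has.le, hbs.le⟩

theorem lineSection_eq_Ioo (hΩ : IsOpen Ω) (hc : Convex ℝ Ω) (hb : Bornology.IsBounded Ω)
    {i : Fin (n + 1)} {y : Fin n → ℝ} (hne : (lineSection Ω i y).Nonempty) :
    lineSection Ω i y = Set.Ioo (sInf (lineSection Ω i y)) (sSup (lineSection Ω i y)) :=
  eq_Ioo_of_isOpen (isOpen_lineSection hΩ i y) (ordConnected_lineSection hc i y)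
    (isBounded_lineSection hb i y) hne

/-- The projection of `Ω` along the `i`-th coordinate. -/
def shadow (Ω : Set (𝔼 (n + 1))) (i : Fin (n + 1)) : Set (Fin n → ℝ) :=
  {y | (lineSection Ω i y).Nonempty}

theorem isOpen_exists_linePoint (hΩ : IsOpen Ω) (i : Fin (n + 1)) {T : Set ℝ} (hT : IsOpen T) :
    IsOpen {y | ∃ s ∈ T, linePoint i s y ∈ Ω} := by
  have h : IsOpen {p : ℝ × (Fin n → ℝ) | p.1 ∈ T ∧ linePoint i p.1 p.2 ∈ Ω} :=
    (hT.preimage continuous_fst).inter (hΩ.preimage (continuous_linePoint i))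
  convert isOpenMap_snd _ h using 1
  ext y
  simp

theorem isOpen_shadow (hΩ : IsOpen Ω) (i : Fin (n + 1)) : IsOpen (shadow Ω i) := by
  convert isOpen_exists_linePoint hΩ i isOpen_univ using 1
  ext y
  simp [shadow, lineSection, Set.Nonempty]

theorem measurable_sSup_lineSection (hΩ : IsOpen Ω) (hb : Bornology.IsBounded Ω)
    (i : Fin (n + 1)) : Measurable fun y => sSup (lineSection Ω i y) := by
  refine measurable_of_Ioi fun c => ?_
  -- The first set is a projection of an open set; the second accounts for the value `sSup ∅ = 0`
  -- off the shadow.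
  have : (fun y => sSup (lineSection Ω i y)) ⁻¹' Set.Ioi c =
      {y | ∃ s ∈ Set.Ioi c, linePoint i s y ∈ Ω} ∪ {y | y ∉ shadow Ω i ∧ c < 0} := by
    ext y
    by_cases hy : (lineSection Ω i y).Nonempty
    · simp only [Set.mem_preimage, Set.mem_Ioi, Set.mem_union, Set.mem_ofPred_eq, shadow, hy,
        not_true_eq_false, false_and, or_false]
      constructor
      · intro h
        obtain ⟨s, hs, hcs⟩ := exists_lt_of_lt_csSup hy h
        exact ⟨s, hcs, hs⟩
      · rintro ⟨s, hcs, hs⟩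
        exact lt_of_lt_of_le hcs (le_csSup (isBounded_lineSection hb i y).bddAbove hs)
    · have he := Set.not_nonempty_iff_eq_empty.1 hy
      have h2 : ¬ ∃ s ∈ Set.Ioi c, linePoint i s y ∈ Ω := by
        rintro ⟨s, -, hs⟩
        exact hy ⟨s, hs⟩
      simp only [Set.mem_preimage, Set.mem_Ioi, Set.mem_union, Set.mem_ofPred_eq, shadow, he,
        Real.sSup_empty, Set.not_nonempty_empty, not_false_eq_true, true_and]
      exact ⟨Or.inr, fun h => h.resolve_left h2⟩
  rw [this]
  refine (isOpen_exists_linePoint hΩ i isOpen_Ioi).measurableSet.union ?_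
  exact (isOpen_shadow hΩ i).measurableSet.compl.inter (MeasurableSet.const _)

theorem measurable_sInf_lineSection (hΩ : IsOpen Ω) (hb : Bornology.IsBounded Ω)
    (i : Fin (n + 1)) : Measurable fun y => sInf (lineSection Ω i y) := by
  refine measurable_of_Iio fun c => ?_
  have : (fun y => sInf (lineSection Ω i y)) ⁻¹' Set.Iio c =
      {y | ∃ s ∈ Set.Iio c, linePoint i s y ∈ Ω} ∪ {y | y ∉ shadow Ω i ∧ 0 < c} := by
    ext y
    by_cases hy : (lineSection Ω i y).Nonempty
    · simp only [Set.mem_preimage, Set.mem_Iio, Set.mem_union, Set.mem_ofPred_eq, shadow, hy,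
        not_true_eq_false, false_and, or_false]
      constructor
      · intro h
        obtain ⟨s, hs, hcs⟩ := exists_lt_of_csInf_lt hy h
        exact ⟨s, hcs, hs⟩
      · rintro ⟨s, hcs, hs⟩
        exact lt_of_le_of_lt (csInf_le (isBounded_lineSection hb i y).bddBelow hs) hcs
    · have he := Set.not_nonempty_iff_eq_empty.1 hy
      have h2 : ¬ ∃ s ∈ Set.Iio c, linePoint i s y ∈ Ω := by
        rintro ⟨s, -, hs⟩
        exact hy ⟨s, hs⟩
      simp only [Set.mem_preimage, Set.mem_Iio, Set.mem_union, Set.mem_ofPred_eq, shadow, he,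
        Real.sInf_empty, Set.not_nonempty_empty, not_false_eq_true, true_and]
      exact ⟨Or.inr, fun h => h.resolve_left h2⟩
  rw [this]
  refine (isOpen_exists_linePoint hΩ i isOpen_Iio).measurableSet.union ?_
  exact (isOpen_shadow hΩ i).measurableSet.compl.inter (MeasurableSet.const _)

theorem shadow_eq_image (i : Fin (n + 1)) : shadow Ω i = dropCoord i '' Ω := by
  ext y
  constructor
  · rintro ⟨s, hs⟩
    exact ⟨_, hs, dropCoord_linePoint i s y⟩
  · rintro ⟨x, hx, rfl⟩
    exact ⟨x i, by simpa [lineSection, linePoint_dropCoord] using hx⟩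

theorem volume_shadow_lt_top (hb : Bornology.IsBounded Ω) (i : Fin (n + 1)) :
    volume (shadow Ω i) < ⊤ := by
  rw [shadow_eq_image]
  exact ((lipschitz_dropCoord i).isBounded_image hb).measure_lt_top

theorem linePoint_mem_frontier (hΩ : IsOpen Ω) {i : Fin (n + 1)} {y : Fin n → ℝ} {s : ℝ}
    (h1 : s ∈ closure (lineSection Ω i y)) (h2 : s ∉ lineSection Ω i y) :
    linePoint i s y ∈ frontier Ω := by
  rw [hΩ.frontier_eq]
  refine ⟨?_, h2⟩
  have hc : Continuous fun s => linePoint i s y :=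
    (continuous_linePoint i).comp (continuous_id.prodMk continuous_const)
  exact map_mem_closure (f := fun s => linePoint i s y) hc h1 fun s hs => hs

/-- The distribution on `∂Ω` of the points `linePoint i (b y) y`, where `y` runs through the
shadow of `Ω`. -/
def endpointMeasure (Ω : Set (𝔼 (n + 1))) (i : Fin (n + 1)) (b : (Fin n → ℝ) → ℝ) :
    Measure (𝔼 (n + 1)) :=
  (volume.restrict (shadow Ω i)).map fun y => linePoint i (b y) y

variable {b : (Fin n → ℝ) → ℝ} {i : Fin (n + 1)}

theorem measurable_linePoint (i : Fin (n + 1)) (hbm : Measurable b) :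
    Measurable fun y => linePoint i (b y) y :=
  (continuous_linePoint i).measurable.comp (hbm.prodMk measurable_id)

theorem isFiniteMeasure_endpointMeasure (hb : Bornology.IsBounded Ω) :
    IsFiniteMeasure (endpointMeasure Ω i b) := by
  have : IsFiniteMeasure (volume.restrict (shadow Ω i)) :=
    ⟨by simpa using volume_shadow_lt_top hb i⟩
  unfold endpointMeasure
  infer_instance

/-- The endpoints are a section of the projection `dropCoord`, and a 1-Lipschitz map does not
increase Hausdorff measure. -/
theorem endpointMeasure_le (hbm : Measurable b)
    (hbf : ∀ y ∈ shadow Ω i, linePoint i (b y) y ∈ frontier Ω) :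
    endpointMeasure Ω i b ≤ surfaceMeasure Ω := by
  refine Measure.le_iff.2 fun A hA => ?_
  have hm := measurable_linePoint i hbm
  rw [endpointMeasure, Measure.map_apply hm hA, Measure.restrict_apply (hm hA), surfaceMeasure,
    Measure.restrict_apply hA]
  have hsub : (fun y => linePoint i (b y) y) ⁻¹' A ∩ shadow Ω i ⊆
      dropCoord i '' (A ∩ frontier Ω) := by
    rintro y ⟨hy, hys⟩
    exact ⟨_, ⟨hy, hbf y hys⟩, dropCoord_linePoint i _ y⟩
  refine (measure_mono hsub).trans ?_
  have h1 := (lipschitz_dropCoord (n := n) i).hausdorffMeasure_image_le (Nat.cast_nonneg n)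
    (A ∩ frontier Ω)
  have h2 : (Measure.hausdorffMeasure (n : ℝ) : Measure (Fin n → ℝ)) = volume := by
    have := hausdorffMeasure_pi_real (ι := Fin n)
    simpa using this
  rw [h2] at h1
  have h3 : ((n + 1 : ℕ) : ℝ) - 1 = n := by push_cast; ring
  rw [h3]
  simpa using h1

/-- Fubini along the lines in direction `i`: convexity makes each section an interval, on which the
fundamental theorem of calculus applies. -/
theorem integral_partialDeriv_eq (hΩ : IsOpen Ω) (hc : Convex ℝ Ω) (hb : Bornology.IsBounded Ω)
    (i : Fin (n + 1)) {φ : (𝔼 (n + 1)) → ℝ} (hφ : ContDiff ℝ ∞ φ) :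
    ∫ x in Ω, partialDeriv i φ x = ∫ y in shadow Ω i,
      (φ (linePoint i (sSup (lineSection Ω i y)) y) -
        φ (linePoint i (sInf (lineSection Ω i y)) y)) := by
  have hmp := measurePreserving_linePoint (n := n) i
  have hme := measurableEmbedding_linePoint (n := n) i
  rw [← hmp.setIntegral_preimage_emb hme]
  have hint : IntegrableOn (fun p : ℝ × (Fin n → ℝ) => partialDeriv i φ (linePoint i p.1 p.2))
      ((fun p : ℝ × (Fin n → ℝ) => linePoint i p.1 p.2) ⁻¹' Ω) :=
    (hmp.integrableOn_comp_preimage hme).2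
      (integrable_of_continuous hΩ hb (continuous_partialDeriv hφ i))
  have hms : MeasurableSet ((fun p : ℝ × (Fin n → ℝ) => linePoint i p.1 p.2) ⁻¹' Ω) :=
    hmp.measurable hΩ.measurableSet
  rw [← integral_indicator hms, Measure.volume_eq_prod,
    integral_prod_symm _ ((integrable_indicator_iff hms).2 hint),
    ← integral_indicator (isOpen_shadow hΩ i).measurableSet]
  congr 1
  ext y
  have e1 : ∀ s, ((fun p : ℝ × (Fin n → ℝ) => linePoint i p.1 p.2) ⁻¹' Ω).indicator
      (fun p : ℝ × (Fin n → ℝ) => partialDeriv i φ (linePoint i p.1 p.2)) (s, y) =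
      (lineSection Ω i y).indicator (fun s => partialDeriv i φ (linePoint i s y)) s :=
    fun s => rfl
  simp only [e1]
  rw [integral_indicator (isOpen_lineSection hΩ i y).measurableSet]
  by_cases hy : (lineSection Ω i y).Nonempty
  · rw [Set.indicator_of_mem (show y ∈ shadow Ω i from hy)]
    have hI := lineSection_eq_Ioo hΩ hc hb hy
    set a := sInf (lineSection Ω i y)
    set b := sSup (lineSection Ω i y)
    rw [hI, ← integral_Ioc_eq_integral_Ioo]
    have hab : a ≤ b := by
      obtain ⟨s, hs⟩ := hy
      rw [hI] at hs
      exact (hs.1.trans hs.2).le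
    rw [← intervalIntegral.integral_of_le hab]
    refine intervalIntegral.integral_eq_sub_of_hasDerivAt
      (fun s _ => hasDerivAt_linePoint hφ i y s) ?_
    refine Continuous.intervalIntegrable ?_ _ _
    exact (continuous_partialDeriv hφ i).comp
      ((continuous_linePoint i).comp (continuous_id.prodMk continuous_const))
  · rw [Set.indicator_of_notMem (show y ∉ shadow Ω i from hy),
      Set.not_nonempty_iff_eq_empty.1 hy]
    simp

end Lines

/-- Gauss–Green formula on a convex domain: the weak derivative in direction `i` of the indicator
function of `Ω` is a difference of two finite measures dominated by the surface measure. -/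
structure IsBoundaryPair {d : ℕ} (Ω : Set (𝔼 d)) (i : Fin d) (lp lm : Measure (𝔼 d)) : Prop where
  finite_pos : IsFiniteMeasure lp
  finite_neg : IsFiniteMeasure lm
  le_pos : lp ≤ surfaceMeasure Ω
  le_neg : lm ≤ surfaceMeasure Ω
  ae_pos : ∀ᵐ x ∂lp, ∃ s > (0 : ℝ), x + (-s) • EuclideanSpace.single i (1 : ℝ) ∈ Ω
  ae_neg : ∀ᵐ x ∂lm, ∃ s > (0 : ℝ), x + s • EuclideanSpace.single i (1 : ℝ) ∈ Ω
  integral_eq : ∀ φ : (𝔼 d) → ℝ, ContDiff ℝ ∞ φ →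
    ∫ x in Ω, partialDeriv i φ x = ∫ x, φ x ∂lp - ∫ x, φ x ∂lm

/-- The two measures are the distributions of the upper and lower endpoints of the chords. From an
endpoint the midpoint of its chord is reached along the `i`-th axis, which gives `ae_pos` and
`ae_neg`; these later show that a hyperplane parallel to the axis and missed by `Ω` is not charged.
-/
theorem exists_isBoundaryPair {d : ℕ} {Ω : Set (𝔼 d)} (hΩ : IsOpen Ω) (hc : Convex ℝ Ω)
    (hb : Bornology.IsBounded Ω) (i : Fin d) : ∃ lp lm, IsBoundaryPair Ω i lp lm := by
  obtain ⟨n, rfl⟩ : ∃ n, d = n + 1 := ⟨d - 1, by have := i.2; omega⟩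
  set b : (Fin n → ℝ) → ℝ := fun y => sSup (lineSection Ω i y) with hbdef
  set a : (Fin n → ℝ) → ℝ := fun y => sInf (lineSection Ω i y) with hadef
  have hbm : Measurable b := measurable_sSup_lineSection hΩ hb i
  have ham : Measurable a := measurable_sInf_lineSection hΩ hb i
  have hab : ∀ y ∈ shadow Ω i, lineSection Ω i y = Set.Ioo (a y) (b y) := fun y hy =>
    lineSection_eq_Ioo hΩ hc hb hy
  have hlt : ∀ y ∈ shadow Ω i, a y < b y := by
    intro y hy
    obtain ⟨s, hs⟩ := id hy
    rw [hab y hy] at hs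
    exact hs.1.trans hs.2
  have hbf : ∀ y ∈ shadow Ω i, linePoint i (b y) y ∈ frontier Ω := by
    intro y hy
    refine linePoint_mem_frontier hΩ ?_ ?_ <;> rw [hab y hy]
    · rw [closure_Ioo (hlt y hy).ne]; exact ⟨(hlt y hy).le, le_rfl⟩
    · simp
  have haf : ∀ y ∈ shadow Ω i, linePoint i (a y) y ∈ frontier Ω := by
    intro y hy
    refine linePoint_mem_frontier hΩ ?_ ?_ <;> rw [hab y hy]
    · rw [closure_Ioo (hlt y hy).ne]; exact ⟨le_rfl, (hlt y hy).le⟩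
    · simp
  have hray : ∀ t : ℝ, IsOpen {x : 𝔼 (n + 1) |
      ∃ s > (0 : ℝ), x + (t * s) • EuclideanSpace.single i (1 : ℝ) ∈ Ω} := by
    intro t
    have : {x : 𝔼 (n + 1) | ∃ s > (0 : ℝ), x + (t * s) • EuclideanSpace.single i (1 : ℝ) ∈ Ω} =
        ⋃ s > (0 : ℝ), {x | x + (t * s) • EuclideanSpace.single i (1 : ℝ) ∈ Ω} := by
      ext x; simp
    rw [this]
    exact isOpen_biUnion fun s _ => hΩ.preimage (continuous_id.add continuous_const)
  have hmid : ∀ y ∈ shadow Ω i, linePoint i ((a y + b y) / 2) y ∈ Ω := by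
    intro y hy
    have : (a y + b y) / 2 ∈ lineSection Ω i y := by
      rw [hab y hy]
      have := hlt y hy
      constructor <;> linarith
    exact this
  have hms := (isOpen_shadow hΩ i).measurableSet
  have hfin : ∀ c, IsFiniteMeasure (endpointMeasure Ω i c) := fun c =>
    isFiniteMeasure_endpointMeasure hb
  refine ⟨endpointMeasure Ω i b, endpointMeasure Ω i a, hfin _, hfin _,
    endpointMeasure_le hbm hbf, endpointMeasure_le ham haf, ?_, ?_, ?_⟩
  · have h := hray (-1)
    simp only [neg_one_mul] at h
    rw [endpointMeasure, ae_map_iff (measurable_linePoint i hbm).aemeasurable h.measurableSet]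
    filter_upwards [ae_restrict_mem hms] with y hy
    refine ⟨(b y - a y) / 2, by have := hlt y hy; linarith, ?_⟩
    rw [← linePoint_add]
    convert hmid y hy using 2
    ring
  · have h := hray 1
    simp only [one_mul] at h
    rw [endpointMeasure, ae_map_iff (measurable_linePoint i ham).aemeasurable h.measurableSet]
    filter_upwards [ae_restrict_mem hms] with y hy
    refine ⟨(b y - a y) / 2, by have := hlt y hy; linarith, ?_⟩
    rw [← linePoint_add]
    convert hmid y hy using 2
    ring
  · intro φ hφ
    have hi : ∀ c, Measurable c → (∀ y ∈ shadow Ω i, linePoint i (c y) y ∈ frontier Ω) →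
        IntegrableOn (fun y => φ (linePoint i (c y) y)) (shadow Ω i) := by
      intro c hcm hcf
      obtain ⟨C, hC⟩ := exists_bound_of_continuous (Metric.isBounded_closure_iff.2 hb)
        hφ.continuous
      have : IsFiniteMeasure (volume.restrict (shadow Ω i)) :=
        ⟨by simpa using volume_shadow_lt_top hb i⟩
      refine Integrable.of_bound (hφ.continuous.measurable.comp
        (measurable_linePoint i hcm)).aestronglyMeasurable C ?_
      filter_upwards [ae_restrict_mem hms] with y hy
      exact hC _ (frontier_subset_closure (hcf y hy))
    rw [integral_partialDeriv_eq hΩ hc hb i hφ, integral_sub (hi b hbm hbf) (hi a ham haf),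
      endpointMeasure, endpointMeasure,
      integral_map (measurable_linePoint i hbm).aemeasurable
        hφ.continuous.aestronglyMeasurable,
      integral_map (measurable_linePoint i ham).aemeasurable
        hφ.continuous.aestronglyMeasurable]

end

/-! ### Affine substitutions and mollification. -/

section

section Affine

variable {E : Type*} [NormedAddCommGroup E] [NormedSpace ℝ E] [MeasurableSpace E] [BorelSpace E]
  [FiniteDimensional ℝ E] (μ : Measure E) [μ.IsAddHaarMeasure]

theorem lintegral_comp_affine (f : E → ENNReal) {r : ℝ} (hr : r ≠ 0) (b : E) :
    ∫⁻ x, f (r • x + b) ∂μ =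
      ENNReal.ofReal |(r ^ Module.finrank ℝ E)⁻¹| * ∫⁻ x, f x ∂μ := by
  have h1 : ∫⁻ x, f (r • x + b) ∂μ = ∫⁻ y, f (y + b) ∂(μ.map (r • ·)) :=
    (lintegral_map_equiv (fun y => f (y + b))
      (Homeomorph.smul (isUnit_iff_ne_zero.2 hr).unit).toMeasurableEquiv).symm
  rw [h1, Measure.map_addHaar_smul μ hr, lintegral_smul_measure, smul_eq_mul,
    lintegral_add_right_eq_self f b]

theorem eLpNorm_comp_affine {f : E → ℝ} {r : ℝ} (hr : r ≠ 0) (b : E) :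
    eLpNorm (fun x => f (r • x + b)) 2 μ =
      ENNReal.ofReal |(r ^ Module.finrank ℝ E)⁻¹| ^ (1 / 2 : ℝ) * eLpNorm f 2 μ := by
  simp only [eLpNorm_eq_lintegral_rpow_enorm_toReal (p := 2) (by norm_num) (by norm_num)]
  rw [lintegral_comp_affine μ (fun x => ‖f x‖ₑ ^ (2 : ENNReal).toReal) hr b,
    ENNReal.mul_rpow_of_nonneg _ _ (by norm_num)]
  simp

end Affine

section Mollify

variable {d : ℕ}

/-- The convolution `x ↦ ∫ F(t) β(x - t) dt`. -/
def mollify (β F : (𝔼 d) → ℝ) : (𝔼 d) → ℝ :=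
  convolution F β (ContinuousLinearMap.lsmul ℝ ℝ) volume

theorem mollify_apply (β F : (𝔼 d) → ℝ) (x : 𝔼 d) : mollify β F x = ∫ t, F t * β (x - t) := rfl

theorem mollify_apply' (β F : (𝔼 d) → ℝ) (x : 𝔼 d) : mollify β F x = ∫ t, β t * F (x - t) := by
  rw [mollify, convolution_eq_swap]
  simp [mul_comm]

theorem mollify_eq_convolution (β F : (𝔼 d) → ℝ) :
    mollify β F = convolution β F (ContinuousLinearMap.lsmul ℝ ℝ) volume := by
  ext x
  rw [mollify_apply', convolution_lsmul]
  simp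

variable {β F : (𝔼 d) → ℝ}

theorem contDiff_mollify (hβ : ContDiff ℝ ∞ β) (hβc : HasCompactSupport β)
    (hF : LocallyIntegrable F) : ContDiff ℝ ∞ (mollify β F) :=
  hβc.contDiff_convolution_right _ hF hβ

theorem partialDeriv_mollify (hβ : ContDiff ℝ ∞ β) (hβc : HasCompactSupport β)
    (hF : LocallyIntegrable F) (i : Fin d) :
    partialDeriv i (mollify β F) = mollify (partialDeriv i β) F := by
  ext x
  have h := (hβc.hasFDerivAt_convolution_right (ContinuousLinearMap.lsmul ℝ ℝ) hF
    (hβ.of_le (by exact_mod_cast le_top)) x).fderiv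
  rw [partialDeriv, mollify, h, convolution_precompR_apply]
  · rfl
  · exact hF
  · exact hβc.fderiv ℝ
  · exact hβ.continuous_fderiv (by simp)

/-- Young's inequality with constant one: compare the `L¹` and `L²` norms for the probability
measure with density `β`, then apply Tonelli and translation invariance. -/
theorem eLpNorm_mollify_le (hβ0 : ∀ x, 0 ≤ β x) (hβ : Continuous β) (hβi : Integrable β)
    (hβ1 : ∫ x, β x = 1) (hF : AEStronglyMeasurable F) :
    eLpNorm (mollify β F) 2 volume ≤ eLpNorm F 2 volume := by
  wlog hm : StronglyMeasurable F generalizing F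
  · have e : mollify β F = mollify β (hF.mk F) := by
      ext x
      simp only [mollify_apply]
      refine integral_congr_ae ?_
      filter_upwards [hF.ae_eq_mk] with t ht
      rw [ht]
    rw [e, eLpNorm_congr_ae hF.ae_eq_mk]
    exact this hF.stronglyMeasurable_mk.aestronglyMeasurable hF.stronglyMeasurable_mk
  set ν : Measure (𝔼 d) := volume.withDensity fun x => ENNReal.ofReal (β x) with hν
  have hβm : Measurable fun x => ENNReal.ofReal (β x) := hβ.measurable.ennreal_ofReal
  have hprob : IsProbabilityMeasure ν := ⟨by
    rw [hν, withDensity_apply _ MeasurableSet.univ, setLIntegral_univ,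
      ← ofReal_integral_eq_lintegral_ofReal hβi (ae_of_all _ hβ0), hβ1, ENNReal.ofReal_one]⟩
  have hpt : ∀ x, ‖mollify β F x‖ₑ ^ (2 : ℝ) ≤
      ∫⁻ s, ENNReal.ofReal (β s) * ‖F (x - s)‖ₑ ^ (2 : ℝ) := by
    intro x
    have hFx : Measurable fun s => F (x - s) := hm.measurable.comp (measurable_const.sub measurable_id)
    have h1 : ‖mollify β F x‖ₑ ≤ eLpNorm (fun s => F (x - s)) 1 ν := by
      rw [mollify_apply', eLpNorm_one_eq_lintegral_enorm, hν,
        lintegral_withDensity_eq_lintegral_mul _ hβm hFx.enorm]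
      refine (enorm_integral_le_lintegral_enorm _).trans (le_of_eq ?_)
      refine lintegral_congr fun s => ?_
      simp [enorm_mul, Real.enorm_eq_ofReal (hβ0 s)]
    have h2 := h1.trans (eLpNorm_le_eLpNorm_of_exponent_le (p := 1) (q := 2) (by norm_num)
      hFx.aestronglyMeasurable)
    have h3 := ENNReal.rpow_le_rpow h2 (by norm_num : (0 : ℝ) ≤ 2)
    refine h3.trans (le_of_eq ?_)
    rw [eLpNorm_eq_lintegral_rpow_enorm_toReal (by norm_num) (by norm_num), ← ENNReal.rpow_mul, hν,
      lintegral_withDensity_eq_lintegral_mul _ hβm (hFx.enorm.pow_const _)]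
    simp
  rw [eLpNorm_eq_lintegral_rpow_enorm_toReal (by norm_num) (by norm_num),
    eLpNorm_eq_lintegral_rpow_enorm_toReal (by norm_num) (by norm_num)]
  refine ENNReal.rpow_le_rpow ?_ (by norm_num)
  simp only [ENNReal.toReal_ofNat]
  calc ∫⁻ x, ‖mollify β F x‖ₑ ^ (2 : ℝ)
      ≤ ∫⁻ x, ∫⁻ s, ENNReal.ofReal (β s) * ‖F (x - s)‖ₑ ^ (2 : ℝ) := lintegral_mono hpt
    _ = ∫⁻ s, ∫⁻ x, ENNReal.ofReal (β s) * ‖F (x - s)‖ₑ ^ (2 : ℝ) := by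
        refine lintegral_lintegral_swap (Measurable.aemeasurable ?_)
        exact (hβm.comp measurable_snd).mul
          ((hm.measurable.comp (measurable_fst.sub measurable_snd)).enorm.pow_const _)
    _ = ∫⁻ s, ENNReal.ofReal (β s) * ∫⁻ x, ‖F x‖ₑ ^ (2 : ℝ) := by
        refine lintegral_congr fun s => ?_
        rw [lintegral_const_mul _ (by
          exact (hm.measurable.comp (measurable_id.sub measurable_const)).enorm.pow_const _)]
        congr 1
        exact lintegral_sub_right_eq_self (fun x => ‖F x‖ₑ ^ (2 : ℝ)) s
    _ = ∫⁻ x, ‖F x‖ₑ ^ (2 : ℝ) := by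
        rw [lintegral_mul_const _ hβm,
          ← ofReal_integral_eq_lintegral_ofReal hβi (ae_of_all _ hβ0), hβ1]
        simp

/-- A standard mollifier supported in the closed ball of radius `δ`. -/
theorem exists_mollifier (d : ℕ) {δ : ℝ} (hδ : 0 < δ) : ∃ β : (𝔼 d) → ℝ, ContDiff ℝ ∞ β ∧
    HasCompactSupport β ∧ (∀ x, 0 ≤ β x) ∧ ∫ x, β x = 1 ∧
    Function.support β = Metric.ball 0 δ := by
  let b : ContDiffBump (0 : 𝔼 d) := ⟨δ / 2, δ, by positivity, by linarith⟩
  exact ⟨b.normed volume, b.contDiff_normed, b.hasCompactSupport_normed, b.nonneg_normed,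
    b.integral_normed, b.support_normed_eq⟩

/-- With `ε = 0` this says that mollification preserves a value taken throughout a ball, which is
how plateaux and supports are tracked later. -/
theorem dist_mollify_le {δ ε : ℝ} (hε : 0 ≤ ε) (hβ0 : ∀ x, 0 ≤ β x) (hβ1 : ∫ x, β x = 1)
    (hs : Function.support β = Metric.ball 0 δ) (hF : AEStronglyMeasurable F) {x : 𝔼 d} {z : ℝ}
    (h : ∀ y ∈ Metric.ball x δ, dist (F y) z ≤ ε) : dist (mollify β F x) z ≤ ε := by
  rw [mollify_eq_convolution]
  exact dist_convolution_le hε hs.subset hβ0 hβ1 hF h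

/-- Approximation in `L²(Ω)` by rescaled mollifications. -/
theorem tendsto_eLpNorm_mollify_comp {Ω : Set (𝔼 d)} (hΩo : IsOpen Ω)
    (hΩ : Bornology.IsBounded Ω) (x₀ : 𝔼 d) {ε δ : ℕ → ℝ} (hε : ∀ n, ε n ∈ Set.Ioc (0 : ℝ) (1 / 2))
    (hεl : Tendsto ε atTop (𝓝 0)) (hδl : Tendsto δ atTop (𝓝 0))
    {β : ℕ → (𝔼 d) → ℝ} (hβ : ∀ n, ContDiff ℝ ∞ (β n)) (hβc : ∀ n, HasCompactSupport (β n))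
    (hβ0 : ∀ n x, 0 ≤ β n x) (hβ1 : ∀ n, ∫ x, β n x = 1)
    (hs : ∀ n, Function.support (β n) = Metric.ball 0 (δ n)) (hF : MemLp F 2 volume) :
    Tendsto (fun n => eLpNorm (fun x => mollify (β n) F ((1 - ε n) • x + ε n • x₀) - F x) 2
      (volume.restrict Ω)) atTop (𝓝 0) := by
  -- The contraction has Jacobian factor `(1 - ε)⁻ᵈ ≤ 2ᵈ`, since `ε ≤ 1/2`.
  set C : ENNReal := (ENNReal.ofReal (2 ^ d)) ^ (1 / 2 : ℝ) with hC
  have hC_top : C ≠ ⊤ := by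
    rw [hC]; exact ENNReal.rpow_ne_top_of_nonneg (by norm_num) ENNReal.ofReal_ne_top
  have hvol : volume Ω ≠ ⊤ := hΩ.measure_lt_top.ne
  rw [ENNReal.tendsto_nhds_zero]
  intro η hη
  obtain ⟨τ, hτ0, hτ⟩ : ∃ τ : NNReal, 0 < τ ∧
      C * τ + τ * (volume Ω) ^ (1 / 2 : ℝ) + τ ≤ η := by
    have hlim : Tendsto (fun τ : ENNReal => C * τ + τ * (volume Ω) ^ (1 / 2 : ℝ) + τ) (𝓝 0)
        (𝓝 0) := by
      have h1 : Tendsto (fun τ : ENNReal => C * τ) (𝓝 0) (𝓝 (C * 0)) :=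
        ENNReal.Tendsto.const_mul tendsto_id (Or.inr hC_top)
      have h2 : Tendsto (fun τ : ENNReal => τ * (volume Ω) ^ (1 / 2 : ℝ)) (𝓝 0)
          (𝓝 (0 * (volume Ω) ^ (1 / 2 : ℝ))) :=
        ENNReal.Tendsto.mul_const tendsto_id
          (Or.inr (ENNReal.rpow_ne_top_of_nonneg (by norm_num) hvol))
      simpa using (h1.add h2).add tendsto_id
    have h3 := (ENNReal.tendsto_nhds_zero.1 hlim) η hη
    rw [ENNReal.nhds_zero_basis.eventually_iff] at h3
    obtain ⟨a, ha, h3⟩ := h3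
    obtain ⟨τ, hτ0, hτa⟩ := ENNReal.lt_iff_exists_nnreal_btwn.1 ha
    exact ⟨τ, by exact_mod_cast hτ0, h3 hτa⟩
  obtain ⟨h, hhc, hFh, hhcont, hhL⟩ := hF.exists_hasCompactSupport_eLpNorm_sub_le
    (by norm_num : (2 : ENNReal) ≠ ⊤) (ε := (τ : ENNReal)) (by exact_mod_cast hτ0.ne')
  have huc : UniformContinuous h := hhc.uniformContinuous_of_continuous hhcont
  obtain ⟨ρ, hρ, hρh⟩ := Metric.uniformContinuous_iff.1 huc τ (by exact_mod_cast hτ0)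
  obtain ⟨R, hR⟩ := (hΩ.sub (Bornology.isBounded_singleton (x := x₀))).exists_norm_le
  have hsmall : ∀ᶠ n in atTop, ε n * R + δ n < ρ := by
    have : Tendsto (fun n => ε n * R + δ n) atTop (𝓝 (0 * R + 0)) :=
      (hεl.mul_const R).add hδl
    rw [zero_mul, zero_add] at this
    exact this.eventually_lt_const hρ
  filter_upwards [hsmall] with n hn
  have hr : (1 - ε n) ≠ 0 := by have := (hε n).2; linarith
  set A : (𝔼 d) → (𝔼 d) := fun x => (1 - ε n) • x + ε n • x₀ with hA
  have hAcont : Continuous A := by fun_prop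
  have hFloc : LocallyIntegrable F := hF.locallyIntegrable (by norm_num)
  have hhloc : LocallyIntegrable h := hhcont.locallyIntegrable
  -- The error `F - h` enters twice, once mollified and once not; the middle term is small by
  -- uniform continuity of the compactly supported `h`.
  have hdecomp : (fun x => mollify (β n) F (A x) - F x) =
      (fun x => mollify (β n) (F - h) (A x)) + ((fun x => mollify (β n) h (A x) - h x) +
        (h - F)) := by
    ext x
    have : mollify (β n) (F - h) (A x) = mollify (β n) F (A x) - mollify (β n) h (A x) := by
      simp only [mollify_apply, Pi.sub_apply, sub_mul]
      refine integral_sub ?_ ?_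
      · exact (hβc n).convolutionExists_right (ContinuousLinearMap.lsmul ℝ ℝ) hFloc
          (hβ n).continuous (A x)
      · exact (hβc n).convolutionExists_right (ContinuousLinearMap.lsmul ℝ ℝ) hhloc
          (hβ n).continuous (A x)
    simp only [Pi.add_apply, Pi.sub_apply, this]
    ring
  have hm1 : Continuous fun x => mollify (β n) (F - h) (A x) :=
    (contDiff_mollify (hβ n) (hβc n) (hFloc.sub hhloc)).continuous.comp hAcont
  have hm2 : Continuous fun x => mollify (β n) h (A x) - h x :=
    ((contDiff_mollify (hβ n) (hβc n) hhloc).continuous.comp hAcont).sub hhcont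
  rw [hdecomp]
  refine (eLpNorm_add_le hm1.aestronglyMeasurable
    (hm2.aestronglyMeasurable.add (hhcont.aestronglyMeasurable.sub hF.1.restrict))
    (by norm_num)).trans ?_
  refine (add_le_add le_rfl (eLpNorm_add_le hm2.aestronglyMeasurable
    (hhcont.aestronglyMeasurable.sub hF.1.restrict) (by norm_num))).trans ?_
  rw [← add_assoc]
  refine le_trans (add_le_add (add_le_add ?_ ?_) ?_) hτ
  · refine (eLpNorm_mono_measure _ Measure.restrict_le_self).trans ?_
    rw [hA, eLpNorm_comp_affine volume hr (ε n • x₀) (f := mollify (β n) (F - h))]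
    refine mul_le_mul' ?_ ((eLpNorm_mollify_le (hβ0 n) (hβ n).continuous
      (integrable_of_integral_eq_one (hβ1 n)) (hβ1 n) (hF.1.sub hhL.1)).trans hFh)
    refine ENNReal.rpow_le_rpow (ENNReal.ofReal_le_ofReal ?_) (by norm_num)
    have h12 : (1 / 2 : ℝ) ≤ 1 - ε n := by have := (hε n).2; linarith
    rw [finrank_euclideanSpace_fin, abs_of_nonneg (by positivity), ← inv_pow]
    refine pow_le_pow_left₀ (by positivity) ?_ d
    rw [inv_le_comm₀ (by linarith) (by norm_num)]
    linarith
  · have hb : ∀ᵐ x ∂(volume.restrict Ω), ‖mollify (β n) h (A x) - h x‖ ≤ τ := by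
      filter_upwards [ae_restrict_mem hΩo.measurableSet] with x hx
      rw [← dist_eq_norm]
      refine dist_mollify_le τ.2 (hβ0 n) (hβ1 n) (hs n) hhcont.aestronglyMeasurable ?_
      intro y hy
      refine (hρh ?_).le
      have h1 : dist (A x) x ≤ ε n * R := by
        have e : A x - x = -(ε n • (x - x₀)) := by
          simp only [hA]; module
        rw [dist_eq_norm, e, norm_neg, norm_smul, Real.norm_of_nonneg (hε n).1.le]
        exact mul_le_mul_of_nonneg_left (hR _ (Set.sub_mem_sub hx rfl)) (hε n).1.le
      calc dist y x ≤ dist y (A x) + dist (A x) x := dist_triangle _ _ _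
        _ < δ n + ε n * R := add_lt_add_of_lt_of_le hy h1
        _ < ρ := by linarith
    have := eLpNorm_le_of_ae_bound (p := 2) hb
    refine this.trans (le_of_eq ?_)
    rw [mul_comm]
    simp
  · refine (eLpNorm_mono_measure _ Measure.restrict_le_self).trans ?_
    rw [eLpNorm_sub_comm]
    exact hFh

end Mollify

end

/-! ### Density of smooth functions in `H¹` of a convex domain. -/

section

variable {d : ℕ}

theorem MemH1.hasWeakPartial {Ω : Set (𝔼 d)} {f : (𝔼 d) → ℝ} (h : MemH1 Ω f) (i : Fin d) :
    HasWeakPartial Ω i f (weakPartial Ω i f) := by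
  obtain ⟨g, hg, -⟩ := h.2 i
  have hex : ∃ g, HasWeakPartial Ω i f g := ⟨g, hg⟩
  unfold weakPartial
  rw [dif_pos hex]
  exact hex.choose_spec

theorem MemH1.memLp_weakPartial {Ω : Set (𝔼 d)} (hΩ : IsOpen Ω) {f : (𝔼 d) → ℝ}
    (h : MemH1 Ω f) (i : Fin d) : MemLp (weakPartial Ω i f) 2 (volume.restrict Ω) := by
  obtain ⟨g, hg, hm⟩ := h.2 i
  exact hm.ae_eq (hg.ae_eq_weakPartial hΩ)

theorem partialDeriv_comp_affine {φ : (𝔼 d) → ℝ} (hφ : ContDiff ℝ ∞ φ) (r : ℝ) (b : 𝔼 d)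
    (i : Fin d) : partialDeriv i (fun x => φ (r • x + b)) =
      fun x => r * partialDeriv i φ (r • x + b) := by
  ext x
  have h1 : HasFDerivAt (fun x : 𝔼 d => r • x + b) (r • ContinuousLinearMap.id ℝ (𝔼 d)) x := by
    simpa using ((hasFDerivAt_id x).const_smul r).add_const b
  have h2 := (hφ.differentiable (by simp) (r • x + b)).hasFDerivAt
  have := (h2.comp x h1).fderiv
  simp only [partialDeriv]
  erw [this]
  simp

/-- Away from the boundary, mollification commutes with weak differentiation. -/
theorem partialDeriv_mollify_indicator {Ω : Set (𝔼 d)} (hΩ : IsOpen Ω) {f g : (𝔼 d) → ℝ}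
    {i : Fin d} (h : HasWeakPartial Ω i f g) {β : (𝔼 d) → ℝ} (hβ : ContDiff ℝ ∞ β)
    (hβc : HasCompactSupport β) {y : 𝔼 d} {δ : ℝ} (hs : Function.support β = Metric.ball 0 δ)
    (hy : Metric.closedBall y δ ⊆ Ω) (hF : LocallyIntegrable (Ω.indicator f)) :
    partialDeriv i (mollify β (Ω.indicator f)) y = mollify β (Ω.indicator g) y := by
  rw [partialDeriv_mollify hβ hβc hF]
  simp only [mollify_apply]
  set φ : (𝔼 d) → ℝ := fun t => β (y - t) with hφ
  have hφs : ContDiff ℝ ∞ φ := hβ.comp (contDiff_const.sub contDiff_id)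
  have hφt : tsupport φ ⊆ Metric.closedBall y δ := by
    refine closure_minimal ?_ Metric.isClosed_closedBall
    intro t ht
    have : y - t ∈ Function.support β := ht
    rw [hs, mem_ball_zero_iff] at this
    rw [Metric.mem_closedBall, dist_comm, dist_eq_norm]
    exact this.le
  have hφc : HasCompactSupport φ :=
    (isCompact_closedBall y δ).of_isClosed_subset (isClosed_tsupport _) hφt
  have hd : ∀ t, partialDeriv i φ t = -partialDeriv i β (y - t) := by
    intro t
    have h1 : HasFDerivAt (fun t : 𝔼 d => y - t) (-ContinuousLinearMap.id ℝ (𝔼 d)) t := by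
      simpa using (hasFDerivAt_id t).const_sub y
    have h2 := (hβ.differentiable (by simp) (y - t)).hasFDerivAt
    have := (h2.comp t h1).fderiv
    simp only [partialDeriv]
    erw [this]
    simp
  have key := h.2.2 φ hφs hφc (hφt.trans hy)
  have e1 : ∫ t, Ω.indicator f t * partialDeriv i β (y - t) =
      - ∫ x in Ω, f x * partialDeriv i φ x := by
    rw [← integral_indicator hΩ.measurableSet, ← integral_neg]
    congr 1
    ext t
    by_cases ht : t ∈ Ω <;> simp [ht, hd]
  have e2 : ∫ t, Ω.indicator g t * β (y - t) = ∫ x in Ω, g x * φ x := by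
    rw [← integral_indicator hΩ.measurableSet]
    congr 1
    ext t
    by_cases ht : t ∈ Ω <;> simp [ht, hφ]
  rw [e1, e2, key, neg_neg]

/-- Functions that are smooth on the whole space are dense in `H¹(Ω)` if `Ω` is convex. -/
theorem MemH1.exists_h1Lim {Ω : Set (𝔼 d)} (hΩo : IsOpen Ω) (hΩ : Bornology.IsBounded Ω)
    (hc : Convex ℝ Ω) (hne : Ω.Nonempty) {f : (𝔼 d) → ℝ} (h : MemH1 Ω f) :
    ∃ φ, H1Lim Ω φ f (fun i => weakPartial Ω i f) := by
  obtain ⟨x₀, hx₀⟩ := hne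
  obtain ⟨r, hr, hball⟩ := Metric.nhds_basis_closedBall.mem_iff.1 (hΩo.mem_nhds hx₀)
  set ε : ℕ → ℝ := fun n => 1 / ((n : ℝ) + 2) with hε
  have hεpos : ∀ n, 0 < ε n := fun n => by positivity
  have hεle : ∀ n, ε n ≤ 1 / 2 := fun n => by
    simp only [hε]
    exact one_div_le_one_div_of_le (by norm_num) (by have : (0 : ℝ) ≤ n := n.cast_nonneg; linarith)
  have hεl : Tendsto ε atTop (𝓝 0) := by
    have := (tendsto_const_nhds (x := (1 : ℝ))).div_atTop
      (tendsto_natCast_atTop_atTop (R := ℝ).atTop_add (tendsto_const_nhds (x := (2 : ℝ))))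
    exact this
  set δ : ℕ → ℝ := fun n => ε n * r with hδ
  have hδl : Tendsto δ atTop (𝓝 0) := by simpa using hεl.mul_const r
  choose β hβ hβc hβ0 hβ1 hβs using fun n => exists_mollifier d
    (show 0 < δ n from mul_pos (hεpos n) hr)
  -- The closed ball is contained in `(1 - ε)x + ε B`, where `B` is the closed ball of radius `r`
  -- around `x₀` inside `Ω`; convexity applies. Contracting first leaves room for mollification.
  have hin : ∀ n, ∀ x ∈ Ω, Metric.closedBall ((1 - ε n) • x + ε n • x₀) (δ n) ⊆ Ω := by
    intro n x hx y hy
    set w : 𝔼 d := x₀ + (ε n)⁻¹ • (y - ((1 - ε n) • x + ε n • x₀)) with hw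
    have hwΩ : w ∈ Ω := by
      refine hball ?_
      rw [Metric.mem_closedBall, dist_eq_norm, hw, add_sub_cancel_left, norm_smul, norm_inv,
        Real.norm_of_nonneg (hεpos n).le, inv_mul_le_iff₀ (hεpos n), ← dist_eq_norm]
      exact hy
    have : y = (1 - ε n) • x + ε n • w := by
      rw [hw, smul_add, smul_smul, mul_inv_cancel₀ (hεpos n).ne']
      module
    rw [this]
    exact hc hx hwΩ (by linarith [hεle n]) (hεpos n).le (by ring)
  have hfin : IsFiniteMeasure (volume.restrict Ω) := ⟨by simpa using hΩ.measure_lt_top⟩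
  have hind : ∀ {g : (𝔼 d) → ℝ}, MemLp g 2 (volume.restrict Ω) →
      MemLp (Ω.indicator g) 2 volume := fun hg =>
    (memLp_indicator_iff_restrict hΩo.measurableSet).2 hg
  have hloc : ∀ {g : (𝔼 d) → ℝ}, MemLp g 2 (volume.restrict Ω) →
      LocallyIntegrable (Ω.indicator g) := fun hg => (hind hg).locallyIntegrable (by norm_num)
  set φ : ℕ → (𝔼 d) → ℝ := fun n x =>
    mollify (β n) (Ω.indicator f) ((1 - ε n) • x + ε n • x₀) with hφ
  have hφs : ∀ n, ContDiff ℝ ∞ (φ n) := fun n =>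
    (contDiff_mollify (hβ n) (hβc n) (hloc h.1)).comp
      ((contDiff_id.const_smul (1 - ε n)).add contDiff_const)
  have happ : ∀ {g : (𝔼 d) → ℝ}, MemLp g 2 (volume.restrict Ω) → Tendsto (fun n => eLpNorm
      ((fun x => mollify (β n) (Ω.indicator g) ((1 - ε n) • x + ε n • x₀)) - g) 2
        (volume.restrict Ω)) atTop (𝓝 0) := by
    intro g hg
    refine (tendsto_eLpNorm_mollify_comp hΩo hΩ x₀ (fun n => ⟨hεpos n, hεle n⟩) hεl hδl hβ hβc hβ0
      hβ1 hβs (hind hg)).congr fun n => eLpNorm_congr_ae ?_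
    filter_upwards [ae_restrict_mem hΩo.measurableSet] with x hx
    simp [hx]
  have hconts : ∀ {g : (𝔼 d) → ℝ}, MemLp g 2 (volume.restrict Ω) → ∀ n, MemLp (fun x =>
      mollify (β n) (Ω.indicator g) ((1 - ε n) • x + ε n • x₀)) 2 (volume.restrict Ω) :=
    fun hg n => memLp_of_continuous hΩo hΩ
      ((contDiff_mollify (hβ n) (hβc n) (hloc hg)).continuous.comp (by fun_prop)) 2
  refine ⟨φ, hφs, ⟨hconts h.1, h.1, happ h.1⟩, fun i => ?_⟩
  have hg := h.memLp_weakPartial hΩo i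
  have hbase : L2Lim (volume.restrict Ω) (fun n x =>
      mollify (β n) (Ω.indicator (weakPartial Ω i f)) ((1 - ε n) • x + ε n • x₀))
      (weakPartial Ω i f) := ⟨hconts hg, hg, happ hg⟩
  -- The factor `1 - ε` comes from the chain rule for the contraction and tends to one.
  have hscaled : L2Lim (volume.restrict Ω) (fun n x => (1 - ε n) *
      mollify (β n) (Ω.indicator (weakPartial Ω i f)) ((1 - ε n) • x + ε n • x₀))
      (fun x => 1 * weakPartial Ω i f x) := by
    refine hbase.bdd_seq_mul (c := fun n _ => 1 - ε n) (c₀ := fun _ => 1) (C := 1)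
      (fun n => aestronglyMeasurable_const) (fun n => ae_of_all _ fun _ => ?_)
      (ae_of_all _ fun _ => ?_)
    · rw [abs_of_nonneg] <;> linarith [hεle n, hεpos n]
    · simpa using hεl.const_sub 1
  simp only [one_mul] at hscaled
  have heq : ∀ n, (fun x => (1 - ε n) *
      mollify (β n) (Ω.indicator (weakPartial Ω i f)) ((1 - ε n) • x + ε n • x₀))
      =ᵐ[volume.restrict Ω] partialDeriv i (φ n) := by
    intro n
    filter_upwards [ae_restrict_mem hΩo.measurableSet] with x hx
    rw [hφ, partialDeriv_comp_affine (contDiff_mollify (hβ n) (hβc n) (hloc h.1))]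
    beta_reduce
    rw [partialDeriv_mollify_indicator hΩo (h.hasWeakPartial i) (hβ n) (hβc n) (hβs n) (hin n x hx)
        (hloc h.1)]
  refine ⟨fun n => (hscaled.memLp_seq n).ae_eq (heq n), hg, hscaled.tendsto.congr fun n => ?_⟩
  exact eLpNorm_congr_ae ((heq n).sub (ae_eq_refl _))

end

/-! ### Integration by parts with boundary terms. -/

section

variable {d : ℕ} {Ω : Set (𝔼 d)}

theorem ae_mem_frontier {ν : Measure (𝔼 d)} (h : ν ≤ surfaceMeasure Ω) :
    ∀ᵐ x ∂ν, x ∈ frontier Ω :=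
  (Measure.absolutelyContinuous_of_le h).ae_le
    (ae_restrict_mem (isClosed_frontier.measurableSet))

theorem memLp_of_le_surfaceMeasure (hΩ : Bornology.IsBounded Ω) {ν : Measure (𝔼 d)}
    [IsFiniteMeasure ν] (h : ν ≤ surfaceMeasure Ω) {c : (𝔼 d) → ℝ} (hc : Continuous c)
    (p : ENNReal) : MemLp c p ν := by
  obtain ⟨C, hC⟩ := exists_bound_of_continuous (Metric.isBounded_closure_iff.2 hΩ) hc
  refine MemLp.of_bound hc.aestronglyMeasurable C ?_
  filter_upwards [ae_mem_frontier h] with x hx using hC x (frontier_subset_closure hx)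

/-- Integration by parts against a smooth function that vanishes on the relevant part of the
boundary. -/
theorem IsBoundaryPair.integral_add_eq_zero {i : Fin d} {lp lm : Measure (𝔼 d)}
    (h : IsBoundaryPair Ω i lp lm) (hΩo : IsOpen Ω) (hΩ : Bornology.IsBounded Ω)
    {φ : ℕ → (𝔼 d) → ℝ} {f : (𝔼 d) → ℝ}
    {f' : Fin d → (𝔼 d) → ℝ} (hf : H1Lim Ω φ f f') {ψ : (𝔼 d) → ℝ} (hψ : ContDiff ℝ ∞ ψ)
    (h1 : ∀ᵐ x ∂lp, ψ x = 0) (h2 : ∀ᵐ x ∂lm, ψ x = 0) :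
    (∫ x in Ω, f' i x * ψ x) + ∫ x in Ω, f x * partialDeriv i ψ x = 0 := by
  have hψL : ∀ c : (𝔼 d) → ℝ, Continuous c → L2Lim (volume.restrict Ω) (fun _ => c) c :=
    fun c hc => .const (memLp_of_continuous hΩo hΩ hc 2)
  have hl1 := (hf.lim' i).integral_mul (hψL ψ hψ.continuous)
  have hl2 := hf.lim.integral_mul (hψL _ (continuous_partialDeriv hψ i))
  refine tendsto_nhds_unique (hl1.add hl2) ?_
  refine tendsto_const_nhds.congr fun n => ?_
  have hφ := hf.contDiff n
  have e := h.integral_eq (fun x => φ n x * ψ x) (hφ.mul hψ)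
  rw [partialDeriv_mul hφ hψ] at e
  rw [integral_add] at e
  · rw [e]
    have z1 : ∫ x, φ n x * ψ x ∂lp = 0 := integral_eq_zero_of_ae (by
      filter_upwards [h1] with x hx; simp [hx])
    have z2 : ∫ x, φ n x * ψ x ∂lm = 0 := integral_eq_zero_of_ae (by
      filter_upwards [h2] with x hx; simp [hx])
    rw [z1, z2, sub_zero]
  · exact integrable_of_continuous hΩo hΩ ((continuous_partialDeriv hφ i).mul hψ.continuous)
  · exact integrable_of_continuous hΩo hΩ (hφ.continuous.mul (continuous_partialDeriv hψ i))

/-- Tangential integration by parts: the boundary points on a hyperplane `{x | x k = c}` missed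
by `Ω` do not contribute to the boundary terms in a direction parallel to the hyperplane. -/
theorem integral_tangential_eq_zero (hΩo : IsOpen Ω) (hΩ : Bornology.IsBounded Ω)
    (hc : Convex ℝ Ω) {k i : Fin d} (hik : i ≠ k) {c : ℝ} (hmiss : ∀ x ∈ Ω, x k ≠ c)
    {φ : ℕ → (𝔼 d) → ℝ} {f : (𝔼 d) → ℝ} {f' : Fin d → (𝔼 d) → ℝ} (hf : H1Lim Ω φ f f')
    {ψ : (𝔼 d) → ℝ} (hψ : ContDiff ℝ ∞ ψ) (h0 : ∀ x ∈ frontier Ω, x k ≠ c → ψ x = 0) :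
    (∫ x in Ω, f' i x * ψ x) + ∫ x in Ω, f x * partialDeriv i ψ x = 0 := by
  obtain ⟨lp, lm, h⟩ := exists_isBoundaryPair hΩo hc hΩ i
  refine h.integral_add_eq_zero hΩo hΩ hf hψ ?_ ?_
  · filter_upwards [ae_mem_frontier h.le_pos, h.ae_pos] with x hx ⟨s, _, hs⟩
    refine h0 x hx fun hxk => hmiss _ hs ?_
    simp [hxk, hik.symm]
  · filter_upwards [ae_mem_frontier h.le_neg, h.ae_neg] with x hx ⟨s, _, hs⟩
    refine h0 x hx fun hxk => hmiss _ hs ?_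
    simp [hxk, hik.symm]

/-- Integration by parts against test functions with compact support in `Ω`. -/
theorem integral_interior_eq_zero (hΩo : IsOpen Ω) (hΩ : Bornology.IsBounded Ω)
    (hc : Convex ℝ Ω) (i : Fin d)
    {φ : ℕ → (𝔼 d) → ℝ} {f : (𝔼 d) → ℝ} {f' : Fin d → (𝔼 d) → ℝ} (hf : H1Lim Ω φ f f')
    {ψ : (𝔼 d) → ℝ} (hψ : ContDiff ℝ ∞ ψ) (h0 : tsupport ψ ⊆ Ω) :
    (∫ x in Ω, f' i x * ψ x) + ∫ x in Ω, f x * partialDeriv i ψ x = 0 := by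
  obtain ⟨lp, lm, h⟩ := exists_isBoundaryPair hΩo hc hΩ i
  have key : ∀ x ∈ frontier Ω, ψ x = 0 := fun x hx =>
    image_eq_zero_of_notMem_tsupport fun hxt => (hΩo.frontier_eq ▸ hx).2 (h0 hxt)
  refine h.integral_add_eq_zero hΩo hΩ hf hψ ?_ ?_
  · filter_upwards [ae_mem_frontier h.le_pos] with x hx using key x hx
  · filter_upwards [ae_mem_frontier h.le_neg] with x hx using key x hx

/-- The measure `ν` on the face `{x k = c}` of `∂Ω` and the sign `s` describe the flux through
that face. -/
structure IsFaceMeasure (Ω : Set (𝔼 d)) (k : Fin d) (c : ℝ) (ν : Measure (𝔼 d)) (s : ℝ) :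
    Prop where
  finite : IsFiniteMeasure ν
  le : ν ≤ surfaceMeasure Ω
  sign : s ≠ 0
  integral_eq : ∀ φ : (𝔼 d) → ℝ, ContDiff ℝ ∞ φ → (∀ x ∈ frontier Ω, x k ≠ c → φ x = 0) →
    ∫ x in Ω, partialDeriv k φ x = s * ∫ x, φ x ∂ν

/-- A connected set missing the hyperplane lies on one side of it. Hence only one of the two
endpoint measures in direction `k` can charge the face, and its sign is that of the outer normal
there. -/
theorem exists_isFaceMeasure (hΩo : IsOpen Ω) (hΩ : Bornology.IsBounded Ω) (hc : Convex ℝ Ω)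
    (k : Fin d) {c : ℝ} (hmiss : ∀ x ∈ Ω, x k ≠ c) : ∃ ν s, IsFaceMeasure Ω k c ν s := by
  obtain ⟨lp, lm, h⟩ := exists_isBoundaryPair hΩo hc hΩ k
  have hside : (∀ x ∈ Ω, c < x k) ∨ ∀ x ∈ Ω, x k < c := by
    by_contra! hcon
    obtain ⟨⟨x, hx, hxc⟩, y, hy, hyc⟩ := hcon
    have hcont : ContinuousOn (fun x : 𝔼 d => x k) Ω := by fun_prop
    obtain ⟨z, hz, hzc⟩ := hc.isPreconnected.intermediate_value hx hy hcont ⟨hxc, hyc⟩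
    exact hmiss z hz hzc
  rcases hside with hs | hs
  · refine ⟨lm, -1, h.finite_neg, h.le_neg, by norm_num, fun φ hφ h0 => ?_⟩
    rw [h.integral_eq φ hφ, integral_eq_zero_of_ae (μ := lp)]
    · ring
    · filter_upwards [ae_mem_frontier h.le_pos, h.ae_pos] with x hx ⟨s, hs0, hsx⟩
      refine h0 x hx (ne_of_gt ?_)
      have := hs _ hsx
      simp at this
      linarith
  · refine ⟨lp, 1, h.finite_pos, h.le_pos, by norm_num, fun φ hφ h0 => ?_⟩
    rw [h.integral_eq φ hφ, integral_eq_zero_of_ae (μ := lm)]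
    · ring
    · filter_upwards [ae_mem_frontier h.le_neg, h.ae_neg] with x hx ⟨s, hs0, hsx⟩
      refine h0 x hx (ne_of_lt ?_)
      have := hs _ hsx
      simp at this
      linarith

/-! ### Truncation of `H¹` functions. -/

section Truncation

variable {φ ψ : ℕ → (𝔼 d) → ℝ} {a b : (𝔼 d) → ℝ} {a' b' : Fin d → (𝔼 d) → ℝ}

theorem H1Lim.exists_subseq_ae (h : H1Lim Ω φ a a') : ∃ k : ℕ → ℕ, StrictMono k ∧
    ∀ᵐ x ∂(volume.restrict Ω), Tendsto (fun n => φ (k n) x) atTop (𝓝 (a x)) :=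
  h.lim.exists_subseq_ae

/-- Product of bounded functions of `H¹` functions. -/
theorem H1Lim.comp_mul_comp (hΩo : IsOpen Ω) (hΩ : Bornology.IsBounded Ω)
    (ha : H1Lim Ω φ a a') (hb : H1Lim Ω ψ b b')
    (hca : ∀ᵐ x ∂(volume.restrict Ω), Tendsto (fun n => φ n x) atTop (𝓝 (a x)))
    (hcb : ∀ᵐ x ∂(volume.restrict Ω), Tendsto (fun n => ψ n x) atTop (𝓝 (b x)))
    {T m : ℝ → ℝ} (hT : ContDiff ℝ ∞ T) (hm : ContDiff ℝ ∞ m) {C : ℝ}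
    (hTC : ∀ x, |T x| ≤ C) (hTC' : ∀ x, |deriv T x| ≤ C) (hmC : ∀ x, |m x| ≤ C)
    (hmC' : ∀ x, |deriv m x| ≤ C) :
    H1Lim Ω (fun n x => T (φ n x) * m (ψ n x)) (fun x => T (a x) * m (b x))
      (fun i x => deriv T (a x) * m (b x) * a' i x + T (a x) * deriv m (b x) * b' i x) := by
  have hC0 : 0 ≤ C := (abs_nonneg _).trans (hTC 0)
  have hT'c : Continuous (deriv T) := hT.continuous_deriv (by exact_mod_cast le_top)
  have hm'c : Continuous (deriv m) := hm.continuous_deriv (by exact_mod_cast le_top)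
  have hbd : ∀ {S R : ℝ → ℝ}, (∀ x, |S x| ≤ C) → (∀ x, |R x| ≤ C) → ∀ x y, |S x * R y| ≤ C * C :=
    fun hS hR x y => by
      rw [abs_mul]
      exact mul_le_mul (hS x) (hR y) (abs_nonneg _) hC0
  have hlim : ∀ {S R : ℝ → ℝ}, Continuous S → Continuous R → ∀ᵐ x ∂(volume.restrict Ω),
      Tendsto (fun n => S (φ n x) * R (ψ n x)) atTop (𝓝 (S (a x) * R (b x))) := by
    intro S R hS hR
    filter_upwards [hca, hcb] with x h1 h2
    exact ((hS.tendsto _).comp h1).mul ((hR.tendsto _).comp h2)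
  have hmeas : ∀ {S R : ℝ → ℝ}, Continuous S → Continuous R → ∀ n, AEStronglyMeasurable
      (fun x => S (φ n x) * R (ψ n x)) (volume.restrict Ω) := fun hS hR n =>
    ((hS.comp (ha.contDiff n).continuous).mul
      (hR.comp (hb.contDiff n).continuous)).aestronglyMeasurable
  refine ⟨fun n => (hT.comp (ha.contDiff n)).mul (hm.comp (hb.contDiff n)), ?_, fun i => ?_⟩
  · have h1 : L2Lim (volume.restrict Ω) (fun _ _ => (1 : ℝ)) (fun _ => 1) :=
      .const (memLp_of_continuous hΩo hΩ continuous_const 2)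
    have := h1.bdd_seq_mul (hmeas hT.continuous hm.continuous)
      (fun n => ae_of_all _ fun x => hbd hTC hmC (φ n x) (ψ n x))
      (hlim hT.continuous hm.continuous)
    simpa only [mul_one] using this
  · have e : ∀ n, partialDeriv i (fun x => T (φ n x) * m (ψ n x)) = fun x =>
        deriv T (φ n x) * m (ψ n x) * partialDeriv i (φ n) x +
          T (φ n x) * deriv m (ψ n x) * partialDeriv i (ψ n) x := by
      intro n
      rw [partialDeriv_mul (f := fun x => T (φ n x)) (g := fun x => m (ψ n x))
          (hT.comp (ha.contDiff n)) (hm.comp (hb.contDiff n)),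
        partialDeriv_comp hT (ha.contDiff n), partialDeriv_comp hm (hb.contDiff n)]
      ext x
      ring
    simp only [e]
    exact ((ha.lim' i).bdd_seq_mul (hmeas hT'c hm.continuous)
      (fun n => ae_of_all _ fun x => hbd hTC' hmC (φ n x) (ψ n x)) (hlim hT'c hm.continuous)).add
      ((hb.lim' i).bdd_seq_mul (hmeas hT.continuous hm'c)
      (fun n => ae_of_all _ fun x => hbd hTC hmC' (φ n x) (ψ n x)) (hlim hT.continuous hm'c))

/-- The smooth cutoff `m(x) = 1 - 1 / (1 + N x²)`. -/
def quadCut (N x : ℝ) : ℝ := 1 - (1 + N * x ^ 2)⁻¹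

/-- The smooth truncation `T(x) = x / (1 + x² / N)`. -/
def trunc (N x : ℝ) : ℝ := x * (1 + x ^ 2 / N)⁻¹

variable {N : ℝ}

theorem one_add_pos (hN : 1 ≤ N) (x : ℝ) : 0 < 1 + N * x ^ 2 := by positivity

theorem one_add_div_pos (hN : 1 ≤ N) (x : ℝ) : 0 < 1 + x ^ 2 / N := by positivity

theorem contDiff_quadCut (hN : 1 ≤ N) : ContDiff ℝ ∞ (quadCut N) :=
  contDiff_const.sub ((contDiff_const.add (contDiff_const.mul (contDiff_id.pow 2))).inv
    fun x => (one_add_pos hN x).ne')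

theorem contDiff_trunc (hN : 1 ≤ N) : ContDiff ℝ ∞ (trunc N) :=
  contDiff_id.mul ((contDiff_const.add ((contDiff_id.pow 2).div_const N)).inv
    fun x => (one_add_div_pos hN x).ne')

theorem quadCut_mem (hN : 1 ≤ N) (x : ℝ) : quadCut N x ∈ Set.Icc (0 : ℝ) 1 := by
  have h1 : (1 + N * x ^ 2)⁻¹ ≤ 1 := inv_le_one_of_one_le₀ (by nlinarith [sq_nonneg x])
  have h2 : 0 < (1 + N * x ^ 2)⁻¹ := inv_pos.2 (one_add_pos hN x)
  constructor <;> simp only [quadCut] <;> linarith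

theorem abs_quadCut_le (hN : 1 ≤ N) (x : ℝ) : |quadCut N x| ≤ 1 := by
  rw [abs_of_nonneg (quadCut_mem hN x).1]
  exact (quadCut_mem hN x).2

theorem deriv_quadCut (hN : 1 ≤ N) (x : ℝ) :
    deriv (quadCut N) x = 2 * N * x / (1 + N * x ^ 2) ^ 2 := by
  have h1 : HasDerivAt (fun x : ℝ => 1 + N * x ^ 2) (N * (2 * x)) x := by
    simpa using ((hasDerivAt_pow 2 x).const_mul N).const_add 1
  have h2 := (h1.inv (one_add_pos hN x).ne').const_sub 1
  rw [show quadCut N = fun x => 1 - (fun x : ℝ => 1 + N * x ^ 2)⁻¹ x from rfl, h2.deriv]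
  ring

theorem abs_deriv_quadCut_le (hN : 1 ≤ N) (x : ℝ) : |deriv (quadCut N) x| ≤ 2 * N := by
  rw [deriv_quadCut hN, abs_div, abs_of_pos (pow_pos (one_add_pos hN x) 2),
    div_le_iff₀ (pow_pos (one_add_pos hN x) 2), abs_mul, abs_of_pos (by linarith : 0 < 2 * N)]
  have h0 : |x| ≤ 1 + N * x ^ 2 := by
    nlinarith [sq_abs x, sq_nonneg (|x| - 1), abs_nonneg x, sq_nonneg x]
  have h1 : 1 ≤ 1 + N * x ^ 2 := by nlinarith [sq_nonneg x]
  refine mul_le_mul_of_nonneg_left ?_ (by linarith)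
  nlinarith

theorem abs_trunc_le_abs (hN : 1 ≤ N) (x : ℝ) : |trunc N x| ≤ |x| := by
  rw [trunc, abs_mul, abs_of_pos (inv_pos.2 (one_add_div_pos hN x))]
  refine mul_le_of_le_one_right (abs_nonneg x) (inv_le_one_of_one_le₀ ?_)
  have : 0 ≤ x ^ 2 / N := by positivity
  linarith

theorem abs_trunc_le (hN : 1 ≤ N) (x : ℝ) : |trunc N x| ≤ N := by
  have hp := one_add_div_pos hN x
  rw [trunc, abs_mul, abs_of_pos (inv_pos.2 hp), ← div_eq_mul_inv, div_le_iff₀ hp]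
  have h : N * (1 + x ^ 2 / N) = N + x ^ 2 := by field_simp
  rw [h]
  nlinarith [sq_abs x, sq_nonneg (|x| - 1), abs_nonneg x]

theorem deriv_trunc (hN : 1 ≤ N) (x : ℝ) :
    deriv (trunc N) x = (1 - x ^ 2 / N) / (1 + x ^ 2 / N) ^ 2 := by
  have hp := one_add_div_pos hN x
  have h1 : HasDerivAt (fun x : ℝ => 1 + x ^ 2 / N) (2 * x / N) x := by
    simpa using ((hasDerivAt_pow 2 x).div_const N).const_add 1
  have h2 := (hasDerivAt_id x).mul (h1.inv hp.ne')
  have h3 : deriv (trunc N) x = _ := h2.deriv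
  rw [h3]
  have hN0 : N ≠ 0 := by linarith
  simp only [id, Pi.inv_apply]
  field_simp
  ring

theorem abs_deriv_trunc_le (hN : 1 ≤ N) (x : ℝ) : |deriv (trunc N) x| ≤ 1 := by
  have hp := one_add_div_pos hN x
  have hq : 0 ≤ x ^ 2 / N := by positivity
  rw [deriv_trunc hN, abs_div, abs_of_pos (pow_pos hp 2), div_le_one (pow_pos hp 2), abs_le]
  constructor <;> nlinarith

/-- The gradient of an `H¹` function vanishes almost everywhere on its zero set. -/
theorem H1Lim.ae_grad_eq_zero (hΩo : IsOpen Ω) (hΩ : Bornology.IsBounded Ω) (hc : Convex ℝ Ω)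
    (hb : H1Lim Ω ψ b b') (i : Fin d) :
    ∀ᵐ x ∂(volume.restrict Ω), b x = 0 → b' i x = 0 := by
  obtain ⟨k, hk, hae⟩ := hb.exists_subseq_ae
  replace hb := hb.subseq hk.tendsto_atTop
  -- These functions tend to zero uniformly, while their derivatives stay bounded and tend to the
  -- indicator of `{0}`. Integrating by parts, `1_{b = 0} ∂ᵢb` is orthogonal to every test function.
  set T : ℕ → ℝ → ℝ := fun n y => (n + 1 : ℝ)⁻¹ * trunc 1 ((n + 1) * y) with hTdef
  have hn0 : ∀ n : ℕ, (0 : ℝ) < n + 1 := fun n => by positivity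
  have hT : ∀ n, ContDiff ℝ ∞ (T n) := fun n =>
    contDiff_const.mul ((contDiff_trunc le_rfl).comp (contDiff_const.mul contDiff_id))
  have hTd : ∀ n y, deriv (T n) y = deriv (trunc 1) ((n + 1) * y) := by
    intro n y
    have h1 := (((contDiff_trunc le_rfl).differentiable (by simp)) ((n + 1 : ℝ) * y)).hasDerivAt
    have h2 := (h1.comp y ((hasDerivAt_id y).const_mul (n + 1 : ℝ))).const_mul (n + 1 : ℝ)⁻¹
    have h3 : deriv (T n) y = _ := h2.deriv
    rw [h3]
    field_simp [(hn0 n).ne']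
  have hTb : ∀ n y, |T n y| ≤ (n + 1 : ℝ)⁻¹ := by
    intro n y
    simp only [hTdef, abs_mul, abs_of_pos (inv_pos.2 (hn0 n))]
    exact mul_le_of_le_one_right (inv_pos.2 (hn0 n)).le (abs_trunc_le le_rfl _)
  have hTb1 : ∀ n y, |T n y| ≤ 1 := fun n y => (hTb n y).trans
    (inv_le_one_of_one_le₀ (by have : (0 : ℝ) ≤ n := n.cast_nonneg
                               linarith))
  have hTd1 : ∀ n y, |deriv (T n) y| ≤ 1 := fun n y => by
    rw [hTd]; exact abs_deriv_trunc_le le_rfl _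
  have hlimT : ∀ y, Tendsto (fun n => deriv (T n) y) atTop (𝓝 (if y = 0 then 1 else 0)) := by
    intro y
    simp only [hTd, deriv_trunc le_rfl, div_one]
    split_ifs with h
    · simp [h]
    · have hsq : Tendsto (fun n : ℕ => ((n + 1 : ℝ) * y) ^ 2) atTop atTop := by
        have : Tendsto (fun n : ℕ => ((n : ℝ) + 1)) atTop atTop :=
          tendsto_atTop_add_const_right _ _ tendsto_natCast_atTop_atTop
        have h2 := ((tendsto_pow_atTop two_ne_zero).comp this).atTop_mul_const
          (show 0 < y ^ 2 by positivity)
        refine h2.congr fun n => ?_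
        simp [mul_pow]
      have hz : Tendsto (fun z : ℝ => (1 + z)⁻¹) atTop (𝓝 0) :=
        tendsto_inv_atTop_zero.comp (tendsto_atTop_add_const_left _ _ tendsto_id)
      refine squeeze_zero_norm (fun n => ?_) (hz.comp hsq)
      have hp : 0 ≤ ((n + 1 : ℝ) * y) ^ 2 := sq_nonneg _
      simp only [Function.comp]
      generalize ((n + 1 : ℝ) * y) ^ 2 = z at hp ⊢
      rw [Real.norm_eq_abs, abs_div, abs_of_pos (by positivity : 0 < (1 + z) ^ 2),
        div_le_iff₀ (by positivity)]
      have : (1 + z)⁻¹ * (1 + z) ^ 2 = 1 + z := by field_simp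
      rw [this, abs_le]
      constructor <;> linarith
  have hb2 := (hb.lim' i).memLp
  have : IsFiniteMeasure (volume.restrict Ω) := ⟨by simpa using hΩ.measure_lt_top⟩
  have hbi : Integrable (b' i) (volume.restrict Ω) := hb2.integrable (by norm_num)
  have hbm : AEStronglyMeasurable b (volume.restrict Ω) := hb.lim.memLp.aestronglyMeasurable
  have hmeasT' : ∀ n, AEStronglyMeasurable (fun x => deriv (T n) (b x)) (volume.restrict Ω) :=
    fun n => ((hT n).continuous_deriv (by exact_mod_cast le_top)).comp_aestronglyMeasurable hbm
  set w : (𝔼 d) → ℝ := fun x => (if b x = 0 then 1 else 0) * b' i x with hw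
  have hwm : AEStronglyMeasurable (fun x => if b x = 0 then (1 : ℝ) else 0)
      (volume.restrict Ω) :=
    aestronglyMeasurable_of_tendsto_ae atTop hmeasT' (ae_of_all _ fun x => hlimT (b x))
  have hwi : Integrable w (volume.restrict Ω) := by
    refine hbi.bdd_mul hwm (c := 1) (ae_of_all _ fun x => ?_)
    split_ifs <;> simp
  have key := hΩo.ae_eq_zero_of_integral_contDiff_smul_eq_zero (μ := volume)
    (IntegrableOn.locallyIntegrableOn hwi) ?_
  · rw [ae_restrict_iff' hΩo.measurableSet]
    filter_upwards [key] with x hx hxΩ hb0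
    simpa [hw, hb0] using hx hxΩ
  intro ζ hζ hζc hζs
  have hz : ∀ x, x ∉ Ω → ζ x • w x = 0 := fun x hx => by
    rw [image_eq_zero_of_notMem_tsupport fun h => hx (hζs h), zero_smul]
  rw [← setIntegral_eq_integral_of_forall_compl_eq_zero hz]
  obtain ⟨Cζ, hCζ⟩ := hζc.exists_bound_of_continuous hζ.continuous
  obtain ⟨Cζ', hCζ'⟩ := exists_bound_of_continuous hΩ (continuous_partialDeriv hζ i)
  -- The second factor in the product rule is taken to be the constant one.
  have hparts : ∀ n, (∫ x in Ω, deriv (T n) (b x) * b' i x * ζ x) +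
      ∫ x in Ω, T n (b x) * partialDeriv i ζ x = 0 := by
    intro n
    have h1 := H1Lim.comp_mul_comp hΩo hΩ hb hb hae hae (hT n) (contDiff_const (c := (1 : ℝ)))
      (hTb1 n) (hTd1 n) (fun _ => by simp) (fun _ => by simp)
    have h2 := integral_interior_eq_zero hΩo hΩ hc i h1 hζ hζs
    simpa using h2
  have hl1 : Tendsto (fun n => ∫ x in Ω, deriv (T n) (b x) * b' i x * ζ x) atTop
      (𝓝 (∫ x in Ω, ζ x • w x)) := by
    refine tendsto_integral_of_dominated_convergence (fun x => ‖b' i x‖ * Cζ)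
      (fun n => ((hmeasT' n).mul hbi.1).mul hζ.continuous.aestronglyMeasurable)
      (hbi.norm.mul_const _) (fun n => ae_of_all _ fun x => ?_) (ae_of_all _ fun x => ?_)
    · rw [norm_mul, norm_mul]
      refine mul_le_mul (mul_le_of_le_one_left (norm_nonneg _) (hTd1 n _)) (hCζ x)
        (norm_nonneg _) (norm_nonneg _)
    · have := ((hlimT (b x)).mul_const (b' i x)).mul_const (ζ x)
      refine this.congr' ?_ |>.trans (by simp [hw, mul_comm])
      exact Eventually.of_forall fun n => rfl
  have hl2 : Tendsto (fun n => ∫ x in Ω, T n (b x) * partialDeriv i ζ x) atTop (𝓝 0) := by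
    have hinv : Tendsto (fun n : ℕ => (n + 1 : ℝ)⁻¹) atTop (𝓝 0) := by
      simpa using tendsto_one_div_add_atTop_nhds_zero_nat (𝕜 := ℝ)
    refine squeeze_zero_norm (a := fun n : ℕ => (n + 1 : ℝ)⁻¹ * Cζ' * volume.real Ω)
      (fun n => ?_) (by simpa using (hinv.mul_const Cζ').mul_const (volume.real Ω))
    refine norm_setIntegral_le_of_norm_le_const hΩ.measure_lt_top fun x hx => ?_
    rw [norm_mul]
    exact mul_le_mul (hTb n _) (hCζ' x hx) (norm_nonneg _) (inv_pos.2 (hn0 n)).le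
  have := hl1.add hl2
  simp only [hparts, add_zero] at this
  exact (tendsto_nhds_unique this tendsto_const_nhds)

end Truncation

end

/-! ### The boundary integral over the flat face. -/

section

variable {d : ℕ} {Ω : Set (𝔼 d)}

section Face

variable {φ ψ : ℕ → (𝔼 d) → ℝ} {a b : (𝔼 d) → ℝ} {a' b' : Fin d → (𝔼 d) → ℝ}
  {k j : Fin d} {c s : ℝ} {ν : Measure (𝔼 d)}

/-- The condition `a w = 0` on the face `{x k = c}` of `∂Ω`, in weak form. -/
def VanishesOnFace (Ω : Set (𝔼 d)) (k : Fin d) (c : ℝ) (w a : (𝔼 d) → ℝ)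
    (a' : Fin d → (𝔼 d) → ℝ) : Prop :=
  ∀ h : (𝔼 d) → ℝ, ContDiff ℝ ∞ h → (∀ x ∈ frontier Ω, x k ≠ c → h x = 0) →
    (∫ x in Ω, a' k x * (w x * h x)) +
      ∫ x in Ω, a x * partialDeriv k (fun x => w x * h x) x = 0

theorem L2Lim.of_integral_sq {α : Type*} [MeasurableSpace α] {μ : Measure α} {f : ℕ → α → ℝ}
    (hf : ∀ n, MemLp (f n) 2 μ) (h : Tendsto (fun n => ∫ x, f n x ^ 2 ∂μ) atTop (𝓝 0)) :
    L2Lim μ f 0 := by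
  refine ⟨hf, MemLp.zero, ?_⟩
  have e : ∀ n, eLpNorm (f n - 0) 2 μ = ENNReal.ofReal (√(∫ x, f n x ^ 2 ∂μ)) := by
    intro n
    rw [sub_zero, (hf n).eLpNorm_eq_integral_rpow_norm (by norm_num) (by norm_num)]
    simp [Real.sqrt_eq_rpow]
  simp only [e]
  have h2 : Tendsto (fun n => √(∫ x, f n x ^ 2 ∂μ)) atTop (𝓝 0) := by
    have := (Real.continuous_sqrt.tendsto 0).comp h
    rwa [Real.sqrt_zero] at this
  simpa using ENNReal.tendsto_ofReal h2

/-- The flux identity turns `s ∫ (w χ φₙ)² dν` into a volume integral of `∂ₖ(φₙ · W φₙ)` with `W =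
w²χ²`, whose limit is the weak vanishing condition tested with `w χ² a`. Thus the weak condition
forces the approximating boundary values to zero in `L²` of the face, without traces of `a`. -/
theorem VanishesOnFace.l2Lim (hΩo : IsOpen Ω) (hΩ : Bornology.IsBounded Ω)
    (hν : IsFaceMeasure Ω k c ν s) (ha : H1Lim Ω φ a a') {w : (𝔼 d) → ℝ} (hw : ContDiff ℝ ∞ w)
    (hz : VanishesOnFace Ω k c w a a') {χ : (𝔼 d) → ℝ} (hχ : ContDiff ℝ ∞ χ)
    (h0 : ∀ x ∈ frontier Ω, x k ≠ c → χ x = 0) :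
    L2Lim ν (fun n x => w x * χ x * φ n x) 0 := by
  have := hν.finite
  have hφ := ha.contDiff
  refine .of_integral_sq (fun n => memLp_of_le_surfaceMeasure hΩ hν.le
    ((hw.mul hχ).mul (hφ n)).continuous 2) ?_
  set W : (𝔼 d) → ℝ := fun x => w x * (w x * (χ x * χ x)) with hWdef
  have hW : ContDiff ℝ ∞ W := hw.mul (hw.mul (hχ.mul hχ))
  have hWa := ha.smooth_mul hΩo hΩ hW
  set I : ℝ := (∫ x in Ω, a' k x * (W x * a x)) +
    ∫ x in Ω, a x * (partialDeriv k W x * a x + W x * a' k x) with hI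
  have l1 := ((ha.lim' k).integral_mul hWa.lim).add (ha.lim.integral_mul (hWa.lim' k))
  -- The weak condition admits only smooth `h`, so one factor `a` is approximated by `φₙ` while the
  -- other is held fixed.
  have hI0 : I = 0 := by
    have l2 := ((L2Lim.const (ha.lim' k).memLp).integral_mul hWa.lim).add
      ((L2Lim.const ha.lim.memLp).integral_mul (hWa.lim' k))
    refine tendsto_nhds_unique l2 (tendsto_const_nhds.congr fun n => ?_)
    have := hz (fun x => w x * (χ x * χ x) * φ n x) ((hw.mul (hχ.mul hχ)).mul (hφ n))
      fun x hx hxc => by simp [h0 x hx hxc]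
    rw [← this]
    simp only [hWdef, mul_assoc]
  have l3 : Tendsto (fun n => s * ∫ x, (w x * χ x * φ n x) ^ 2 ∂ν) atTop (𝓝 0) := by
    rw [← hI0]
    refine l1.congr fun n => ?_
    have e := hν.integral_eq (fun x => φ n x * (W x * φ n x)) ((hφ n).mul (hW.mul (hφ n)))
      fun x hx hxc => by simp [hWdef, h0 x hx hxc]
    rw [partialDeriv_mul (hφ n) (hW.mul (hφ n)), integral_add] at e
    · rw [e]
      congr 2
      ext x
      simp only [hWdef]
      ring
    · exact integrable_of_continuous hΩo hΩ ((continuous_partialDeriv (hφ n) k).mul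
        (hW.mul (hφ n)).continuous)
    · exact integrable_of_continuous hΩo hΩ ((hφ n).continuous.mul
        (continuous_partialDeriv (hW.mul (hφ n)) k))
  have := l3.const_mul s⁻¹
  simpa [← mul_assoc, inv_mul_cancel₀ hν.sign] using this

/-- The boundary integral over the face of `χ H ∂_j f` vanishes if `χ H` is a bounded limit of
functions tending to zero almost everywhere on the face. -/
theorem bracket_integral_eq_zero (hΩo : IsOpen Ω) (hΩ : Bornology.IsBounded Ω) (hc : Convex ℝ Ω)
    (hmiss : ∀ x ∈ Ω, x k ≠ c) (hjk : j ≠ k)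
    (hν : IsFaceMeasure Ω k c ν s) (hH : H1Lim Ω φ a a') (hb : H1Lim Ω ψ b b') {C : ℝ}
    (hφC : ∀ n, ∀ x ∈ frontier Ω, |φ n x| ≤ C)
    (hφ0 : ∀ n, ∀ x ∈ frontier Ω, x k ≠ c → φ n x = 0)
    (hφν : ∀ᵐ x ∂ν, Tendsto (fun n => φ n x) atTop (𝓝 0)) :
    ∫ x in Ω, (a' k x * b' j x - a' j x * b' k x) = 0 := by
  have hfin := hν.finite
  -- For smooth `f` the bracket `∂ₖ(·) ∂ⱼf - ∂ⱼ(·) ∂ₖf` of the approximations integrates to a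
  -- boundary integral over the face, which vanishes in the limit by dominated convergence; general
  -- `b` follows by density.
  have hsmooth : ∀ f : (𝔼 d) → ℝ, ContDiff ℝ ∞ f →
      (∫ x in Ω, a' k x * partialDeriv j f x) - ∫ x in Ω, a' j x * partialDeriv k f x = 0 := by
    intro f hf
    have hfL : ∀ g : (𝔼 d) → ℝ, Continuous g → L2Lim (volume.restrict Ω) (fun _ => g) g :=
      fun g hg => .const (memLp_of_continuous hΩo hΩ hg 2)
    have hfj := continuous_partialDeriv hf j
    have hfk := continuous_partialDeriv hf k
    have l1 := ((hH.lim' k).integral_mul (hfL _ hfj)).sub ((hH.lim' j).integral_mul (hfL _ hfk))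
    refine tendsto_nhds_unique l1 ?_
    have l2 : Tendsto (fun n => s * ∫ x, φ n x * partialDeriv j f x ∂ν) atTop (𝓝 (s * 0)) := by
      refine Tendsto.const_mul s ?_
      have hm := memLp_of_le_surfaceMeasure hΩ hν.le (hfj.norm.const_mul C) 1
      rw [← integral_zero (𝔼 d) ℝ (μ := ν)]
      refine tendsto_integral_of_dominated_convergence (fun x => C * ‖partialDeriv j f x‖)
        (fun n => ((hH.contDiff n).continuous.mul hfj).aestronglyMeasurable)
        (memLp_one_iff_integrable.1 hm) (fun n => ?_) ?_
      · filter_upwards [ae_mem_frontier hν.le] with x hx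
        rw [norm_mul]
        exact mul_le_mul_of_nonneg_right (hφC n x hx) (norm_nonneg _)
      · filter_upwards [hφν] with x hx
        simpa using hx.mul_const (partialDeriv j f x)
    rw [mul_zero] at l2
    refine l2.congr fun n => ?_
    have hφ := hH.contDiff n
    have e1 := hν.integral_eq (fun x => φ n x * partialDeriv j f x)
      (hφ.mul (contDiff_partialDeriv hf j)) fun x hx hxc => by rw [hφ0 n x hx hxc, zero_mul]
    -- Direction `j` is parallel to the face, so the second half of the bracket gives no boundary
    -- term.
    have e2 := integral_tangential_eq_zero hΩo hΩ hc hjk hmiss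
      (H1Lim.const hΩo hΩ (contDiff_partialDeriv hf k)) hφ (hφ0 n)
    rw [← e1, partialDeriv_mul hφ (contDiff_partialDeriv hf j), integral_add,
      partialDeriv_comm hf k j]
    · have e3 : ∫ x in Ω, φ n x * partialDeriv j (partialDeriv k f) x =
          ∫ x in Ω, partialDeriv j (partialDeriv k f) x * φ n x := by simp only [mul_comm]
      have e4 : ∫ x in Ω, partialDeriv j (φ n) x * partialDeriv k f x =
          ∫ x in Ω, partialDeriv k f x * partialDeriv j (φ n) x := by simp only [mul_comm]
      rw [e3, e4]
      linarith
    · exact integrable_of_continuous hΩo hΩ ((continuous_partialDeriv hφ k).mul hfj)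
    · exact integrable_of_continuous hΩo hΩ (hφ.continuous.mul
        (continuous_partialDeriv (contDiff_partialDeriv hf j) k))
  rw [integral_sub]
  · have l1 := ((L2Lim.const (hH.lim' k).memLp).integral_mul (hb.lim' j)).sub
      ((L2Lim.const (hH.lim' j).memLp).integral_mul (hb.lim' k))
    refine tendsto_nhds_unique l1 (tendsto_const_nhds.congr fun n => ?_)
    exact (hsmooth _ (hb.contDiff n)).symm
  · exact (hH.lim' k).memLp.integrable_mul (hb.lim' j).memLp
  · exact (hH.lim' j).memLp.integrable_mul (hb.lim' k).memLp

/-- Apply `bracket_integral_eq_zero` to `χ · trunc N a · quadCut N b`: it is bounded, and its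
approximations tend to zero on the face whichever of the two functions vanishes there. The terms
with the derivative of `quadCut` contain `∂ₖb ∂ⱼb - ∂ⱼb ∂ₖb` and cancel, so no bound on them uniform
in `N` is needed. -/
theorem face_integral_trunc_eq_zero (hΩo : IsOpen Ω) (hΩ : Bornology.IsBounded Ω)
    (hc : Convex ℝ Ω) (hmiss : ∀ x ∈ Ω, x k ≠ c) (hjk : j ≠ k)
    (hν : IsFaceMeasure Ω k c ν s) (ha : H1Lim Ω φ a a') (hb : H1Lim Ω ψ b b')
    (hca : ∀ᵐ x ∂(volume.restrict Ω), Tendsto (fun n => φ n x) atTop (𝓝 (a x)))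
    (hcb : ∀ᵐ x ∂(volume.restrict Ω), Tendsto (fun n => ψ n x) atTop (𝓝 (b x)))
    {χ : (𝔼 d) → ℝ} (hχ : ContDiff ℝ ∞ χ) (h0 : ∀ x ∈ frontier Ω, x k ≠ c → χ x = 0)
    (hν0 : ∀ᵐ x ∂ν, Tendsto (fun n => χ x * φ n x) atTop (𝓝 0) ∨
      Tendsto (fun n => χ x * ψ n x) atTop (𝓝 0)) {N : ℝ} (hN : 1 ≤ N) :
    ∫ x in Ω, quadCut N (b x) * (χ x * deriv (trunc N) (a x) * (a' k x * b' j x - a' j x * b' k x)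
      + trunc N (a x) * (partialDeriv k χ x * b' j x - partialDeriv j χ x * b' k x)) = 0 := by
  have hTC : ∀ y, |trunc N y| ≤ 2 * N := fun y => (abs_trunc_le hN y).trans (by linarith)
  have hTd : ∀ y, |deriv (trunc N) y| ≤ 2 * N := fun y =>
    (abs_deriv_trunc_le hN y).trans (by linarith)
  have hmC : ∀ y, |quadCut N y| ≤ 2 * N := fun y => (abs_quadCut_le hN y).trans (by linarith)
  have hH := (H1Lim.comp_mul_comp hΩo hΩ ha hb hca hcb (contDiff_trunc hN) (contDiff_quadCut hN)
    hTC hTd hmC (abs_deriv_quadCut_le hN)).smooth_mul hΩo hΩ hχ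
  obtain ⟨C, hC⟩ := exists_bound_of_continuous (Metric.isBounded_closure_iff.2 hΩ) hχ.continuous
  have key := bracket_integral_eq_zero hΩo hΩ hc hmiss hjk hν hH hb (C := C * (N * 1))
    (fun n x hx => ?_) (fun n x hx hxc => by rw [h0 x hx hxc, zero_mul]) ?_
  · rw [← key]
    congr 1
    ext x
    ring
  · have hCx := hC x (frontier_subset_closure hx)
    rw [abs_mul, abs_mul]
    refine mul_le_mul hCx (mul_le_mul (abs_trunc_le hN _) (abs_quadCut_le hN _)
      (abs_nonneg _) (by linarith)) (by positivity) ((abs_nonneg _).trans hCx)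
  · filter_upwards [hν0] with x hx
    rcases hx with hx | hx
    · refine squeeze_zero_norm (fun n => ?_) (tendsto_zero_iff_norm_tendsto_zero.1 hx)
      rw [norm_mul, norm_mul, norm_mul]
      refine mul_le_mul_of_nonneg_left ?_ (norm_nonneg _)
      exact (mul_le_of_le_one_right (norm_nonneg _) (abs_quadCut_le hN _)).trans
        (abs_trunc_le_abs hN _)
    · rcases eq_or_ne (χ x) 0 with h | h
      · simp [h]
      have h1 : Tendsto (fun n => ψ n x) atTop (𝓝 0) := by
        have := hx.const_mul (χ x)⁻¹
        simpa [← mul_assoc, inv_mul_cancel₀ h] using this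
      have h2 : Tendsto (fun n => quadCut N (ψ n x)) atTop (𝓝 0) := by
        have := ((contDiff_quadCut hN).continuous.tendsto 0).comp h1
        simpa [quadCut, Function.comp_def] using this
      have h3 := (tendsto_zero_iff_norm_tendsto_zero.1 h2).const_mul (|χ x| * N)
      rw [mul_zero] at h3
      refine squeeze_zero_norm (fun n => ?_) h3
      rw [norm_mul, norm_mul, ← mul_assoc]
      exact mul_le_mul_of_nonneg_right (mul_le_mul_of_nonneg_left (abs_trunc_le hN _)
        (abs_nonneg _)) (norm_nonneg _)

theorem tendsto_trunc (y : ℝ) : Tendsto (fun n : ℕ => trunc (n + 1) y) atTop (𝓝 y) := by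
  have h : Tendsto (fun n : ℕ => y ^ 2 / ((n : ℝ) + 1)) atTop (𝓝 0) :=
    tendsto_const_nhds.div_atTop (tendsto_atTop_add_const_right _ _ tendsto_natCast_atTop_atTop)
  simpa [trunc] using ((h.const_add 1).inv₀ (by simp)).const_mul y

theorem tendsto_deriv_trunc (y : ℝ) :
    Tendsto (fun n : ℕ => deriv (trunc (n + 1)) y) atTop (𝓝 1) := by
  have h : Tendsto (fun n : ℕ => y ^ 2 / ((n : ℝ) + 1)) atTop (𝓝 0) :=
    tendsto_const_nhds.div_atTop (tendsto_atTop_add_const_right _ _ tendsto_natCast_atTop_atTop)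
  have e : ∀ n : ℕ, deriv (trunc (n + 1)) y =
      (1 - y ^ 2 / ((n : ℝ) + 1)) / (1 + y ^ 2 / ((n : ℝ) + 1)) ^ 2 := fun n =>
    deriv_trunc (by simp) y
  simp only [e]
  have h2 := (h.const_sub 1).div ((h.const_add 1).pow 2) (by simp)
  simp only [sub_zero, add_zero, one_pow, div_one] at h2
  exact h2

theorem tendsto_quadCut {y : ℝ} (hy : y ≠ 0) :
    Tendsto (fun n : ℕ => quadCut (n + 1) y) atTop (𝓝 1) := by
  have h : Tendsto (fun n : ℕ => 1 + ((n : ℝ) + 1) * y ^ 2) atTop atTop :=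
    tendsto_atTop_add_const_left _ _ ((tendsto_atTop_add_const_right _ _
      tendsto_natCast_atTop_atTop).atTop_mul_const (by positivity))
  simpa [quadCut] using (tendsto_inv_atTop_zero.comp h).const_sub 1

/-- If on the face one of `a`, `b` vanishes at almost every point then the boundary integral
of `a ∂_τ b` over the face is zero. -/
theorem face_integral_eq_zero (hΩo : IsOpen Ω) (hΩ : Bornology.IsBounded Ω) (hc : Convex ℝ Ω)
    (hmiss : ∀ x ∈ Ω, x k ≠ c) (hjk : j ≠ k)
    (hν : IsFaceMeasure Ω k c ν s) (ha : H1Lim Ω φ a a') (hb : H1Lim Ω ψ b b')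
    {w v : (𝔼 d) → ℝ} (hw : ContDiff ℝ ∞ w) (hv : ContDiff ℝ ∞ v)
    (hwv : ∀ᵐ x ∂ν, w x ≠ 0 ∨ v x ≠ 0)
    (hza : VanishesOnFace Ω k c w a a') (hzb : VanishesOnFace Ω k c v b b')
    {χ : (𝔼 d) → ℝ} (hχ : ContDiff ℝ ∞ χ) (h0 : ∀ x ∈ frontier Ω, x k ≠ c → χ x = 0) :
    ∫ x in Ω, (χ x * (a' k x * b' j x - a' j x * b' k x) +
      a x * (partialDeriv k χ x * b' j x - partialDeriv j χ x * b' k x)) = 0 := by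
  have hfin := hν.finite
  -- Four successive subsequences: two for convergence almost everywhere in `Ω`, two for convergence
  -- to zero almost everywhere on the face.
  obtain ⟨κ₁, hκ₁, hae₁⟩ := ha.exists_subseq_ae
  obtain ⟨κ₂, hκ₂, hae₂⟩ := (hb.subseq hκ₁.tendsto_atTop).exists_subseq_ae
  have t12 := hκ₁.tendsto_atTop.comp hκ₂.tendsto_atTop
  obtain ⟨κ₃, hκ₃, hae₃⟩ :=
    (hza.l2Lim hΩo hΩ hν (ha.subseq t12) hw hχ h0).exists_subseq_ae
  have t123 := t12.comp hκ₃.tendsto_atTop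
  obtain ⟨κ₄, hκ₄, hae₄⟩ :=
    (hzb.l2Lim hΩo hΩ hν (hb.subseq t123) hv hχ h0).exists_subseq_ae
  have t := t123.comp hκ₄.tendsto_atTop
  have hcancel : ∀ {r : ℝ} {y : ℝ} {f : ℕ → ℝ}, r ≠ 0 →
      Tendsto (fun n => r * y * f n) atTop (𝓝 0) → Tendsto (fun n => y * f n) atTop (𝓝 0) := by
    intro r y f hr h
    have := h.const_mul r⁻¹
    simpa [← mul_assoc, inv_mul_cancel₀ hr] using this
  have key : ∀ n : ℕ, _ := fun n => face_integral_trunc_eq_zero hΩo hΩ hc hmiss hjk hν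
    (ha.subseq t) (hb.subseq t)
    (by filter_upwards [hae₁] with x hx using
          hx.comp ((hκ₂.tendsto_atTop.comp hκ₃.tendsto_atTop).comp hκ₄.tendsto_atTop))
    (by filter_upwards [hae₂] with x hx using hx.comp (hκ₃.tendsto_atTop.comp hκ₄.tendsto_atTop))
    hχ h0
    (by
      filter_upwards [hwv, hae₃, hae₄] with x hx h3 h4
      rcases hx with hx | hx
      · exact Or.inl (hcancel hx (h3.comp hκ₄.tendsto_atTop))
      · exact Or.inr (hcancel hx h4))
    (N := n + 1) (by simp)
  have hχc := hχ.continuous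
  have hak := (ha.lim' k).memLp
  have haj := (ha.lim' j).memLp
  have hbk := (hb.lim' k).memLp
  have hbj := (hb.lim' j).memLp
  have ham := ha.lim.memLp
  have hbm := hb.lim.memLp.aestronglyMeasurable
  have hg := (memLp_continuous_mul hΩo hΩ hbj (continuous_partialDeriv hχ k)).sub
    (memLp_continuous_mul hΩo hΩ hbk (continuous_partialDeriv hχ j))
  have hdet := ((memLp_continuous_mul hΩo hΩ hak hχc).integrable_mul hbj).sub
    ((memLp_continuous_mul hΩo hΩ haj hχc).integrable_mul hbk)
  have hag := ham.integrable_mul hg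
  refine tendsto_nhds_unique (l := atTop) (f := fun n : ℕ => ∫ x in Ω, quadCut (n + 1) (b x) *
    (χ x * deriv (trunc (n + 1)) (a x) * (a' k x * b' j x - a' j x * b' k x)
      + trunc (n + 1) (a x) * (partialDeriv k χ x * b' j x - partialDeriv j χ x * b' k x))) ?_
    (tendsto_const_nhds.congr fun n => (key n).symm)
  have h1n : ∀ n : ℕ, (1 : ℝ) ≤ n + 1 := fun n => by simp
  -- The majorant is independent of the truncation level because `|quadCut| ≤ 1`, `|trunc'| ≤ 1` and
  -- `|trunc a| ≤ |a|`.
  refine tendsto_integral_of_dominated_convergence _ (fun n => ?_) (hdet.norm.add hag.norm)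
    (fun n => ae_of_all _ fun x => ?_) ?_
  · refine ((contDiff_quadCut (h1n n)).continuous.comp_aestronglyMeasurable hbm).mul
      (((hχc.aestronglyMeasurable.mul (((contDiff_trunc (h1n n)).continuous_deriv
        (by exact_mod_cast le_top)).comp_aestronglyMeasurable ham.1)).mul
        ((hak.1.mul hbj.1).sub (haj.1.mul hbk.1))).add
      (((contDiff_trunc (h1n n)).continuous.comp_aestronglyMeasurable ham.1).mul
        (((continuous_partialDeriv hχ k).aestronglyMeasurable.mul hbj.1).sub
        ((continuous_partialDeriv hχ j).aestronglyMeasurable.mul hbk.1))))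
  · rw [norm_mul]
    refine (mul_le_of_le_one_left (norm_nonneg _) (abs_quadCut_le (h1n n) _)).trans
      ((norm_add_le _ _).trans (add_le_add ?_ ?_))
    · have e : χ x * deriv (trunc (n + 1)) (a x) * (a' k x * b' j x - a' j x * b' k x) =
          deriv (trunc (n + 1)) (a x) * (χ x * a' k x * b' j x - χ x * a' j x * b' k x) := by ring
      rw [e, norm_mul]
      exact mul_le_of_le_one_left (norm_nonneg _) (abs_deriv_trunc_le (h1n n) _)
    · rw [norm_mul]
      beta_reduce
      rw [Pi.mul_apply, norm_mul]
      exact mul_le_mul_of_nonneg_right (abs_trunc_le_abs (h1n n) _) (norm_nonneg _)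
  · filter_upwards [hb.ae_grad_eq_zero hΩo hΩ hc k, hb.ae_grad_eq_zero hΩo hΩ hc j]
      with x hxk hxj
    -- Where `b = 0` the cutoff does not tend to one, but there `∇b` vanishes and so does the whole
    -- integrand.
    by_cases h : b x = 0
    · simp [hxk h, hxj h]
    · have := (tendsto_quadCut h).mul ((((tendsto_deriv_trunc (a x)).const_mul (χ x)).mul_const
        (a' k x * b' j x - a' j x * b' k x)).add ((tendsto_trunc (a x)).mul_const
        (partialDeriv k χ x * b' j x - partialDeriv j χ x * b' k x)))
      simpa using this

end Face

end

/-! ### Geometry of the flat boundary part, and smooth functions as elements of `H¹`. -/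

section

variable {d : ℕ} {Ω : Set (𝔼 d)}

section Geometry

variable {k : Fin d} {c : ℝ}

/-- `Ω` lies on one side of a flat relatively open part of its boundary, and contains a half ball
at every point of this part. -/
theorem exists_halfBall (hΩo : IsOpen Ω) (hc : Convex ℝ Ω) {S : Set (𝔼 d)}
    (hS : IsRelOpenInBoundary Ω S) (hne : S.Nonempty) (hplane : ∀ x ∈ S, x k = c) :
    ∃ z : 𝔼 d, ∃ ρ > (0 : ℝ), ∃ σ : ℝ, (σ = 1 ∨ σ = -1) ∧ z k = c ∧
      (∀ x ∈ Ω, 0 < σ * (x k - c)) ∧ ∀ x ∈ Metric.ball z ρ, 0 < σ * (x k - c) → x ∈ Ω := by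
  obtain ⟨O, hO, rfl⟩ := hS
  obtain ⟨z, hzO, hzf⟩ := hne
  obtain ⟨ρ, hρ, hball⟩ := Metric.isOpen_iff.1 hO z hzO
  have hzc : z k = c := hplane z ⟨hzO, hzf⟩
  set e : 𝔼 d := EuclideanSpace.single k 1 with he
  have hek : ∀ (x : 𝔼 d) (t : ℝ), (x + t • e) k = x k + t := fun x t => by simp [he]
  have hcont : ∀ x : 𝔼 d, Continuous fun t : ℝ => x + t • e := fun x => by fun_prop
  -- perturbation in direction `e`
  have hpert : ∀ U : Set (𝔼 d), IsOpen U → ∀ x ∈ U, ∃ η > (0 : ℝ), ∀ t, |t| < η →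
      x + t • e ∈ U := by
    intro U hU x hx
    have := (hU.preimage (hcont x)).mem_nhds (x := 0) (by simpa using hx)
    obtain ⟨η, hη, h⟩ := Metric.mem_nhds_iff.1 this
    exact ⟨η, hη, fun t ht => h (by simpa using ht)⟩
  set H : ℝ → Set (𝔼 d) := fun σ => Metric.ball z ρ ∩ {x | 0 < σ * (x k - c)} with hH
  have hHconv : ∀ σ, Convex ℝ (H σ) := by
    intro σ
    refine (convex_ball z ρ).inter ?_
    intro x hx y hy a b ha hb hab
    simp only [Set.mem_ofPred_eq, PiLp.add_apply, PiLp.smul_apply, smul_eq_mul] at hx hy ⊢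
    have : σ * (a * x k + b * y k - c) = a * (σ * (x k - c)) + b * (σ * (y k - c)) := by
      linear_combination σ * c * hab
    rw [this]
    rcases ha.eq_or_lt with rfl | ha'
    · have : b = 1 := by linarith
      simpa [this] using hy
    · have := mul_pos ha' hx
      have := mul_nonneg hb hy.le
      linarith
  -- Boundary points in the ball lie on the hyperplane, so an open half ball does not meet the
  -- boundary; being connected, it lies in `Ω` as soon as it meets `Ω`.
  have hHsub : ∀ σ, (H σ ∩ Ω).Nonempty → H σ ⊆ Ω := by
    intro σ hne
    refine IsPreconnected.subset_left_of_subset_union hΩo isClosed_closure.isOpen_compl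
      (Set.disjoint_compl_right_iff_subset.2 subset_closure) (fun x hx => ?_) hne
      (hHconv σ).isPreconnected
    by_contra hcon
    simp only [Set.mem_union, Set.mem_compl_iff, not_or, not_not] at hcon
    have hxf : x ∈ frontier Ω := hΩo.frontier_eq ▸ ⟨hcon.2, hcon.1⟩
    have h2 := hx.2
    simp [hplane x ⟨hball hx.1, hxf⟩] at h2
  obtain ⟨y, hyB, hyΩ⟩ : ∃ y ∈ Metric.ball z ρ, y ∈ Ω := by
    have := (frontier_subset_closure hzf)
    rw [mem_closure_iff] at this
    exact this _ Metric.isOpen_ball (Metric.mem_ball_self hρ)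
  obtain ⟨σ, hσ, hσH⟩ : ∃ σ : ℝ, (σ = 1 ∨ σ = -1) ∧ (H σ ∩ Ω).Nonempty := by
    obtain ⟨η, hη, hηU⟩ := hpert _ (Metric.isOpen_ball.inter hΩo) y ⟨hyB, hyΩ⟩
    rcases lt_trichotomy (y k) c with h | h | h
    · exact ⟨-1, Or.inr rfl, y, ⟨hyB, by simpa using h⟩, hyΩ⟩
    · have h1 := hηU (η / 2) (by rw [abs_of_pos] <;> linarith)
      refine ⟨1, Or.inl rfl, _, ⟨h1.1, ?_⟩, h1.2⟩
      simp only [Set.mem_ofPred_eq, hek]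
      linarith
    · exact ⟨1, Or.inl rfl, y, ⟨hyB, by simpa using h⟩, hyΩ⟩
  have hsub := hHsub σ hσH
  refine ⟨z, ρ, hρ, σ, hσ, hzc, ?_, fun x hx hx' => hsub ⟨hx, hx'⟩⟩
  have hσsq : σ * σ = 1 := by rcases hσ with rfl | rfl <;> norm_num
  -- From a point of `Ω` on the wrong side, continue the segment slightly beyond `z` into the half
  -- ball: convexity would put the boundary point `z` into `Ω`.
  have hstrict : ∀ x ∈ Ω, ¬ σ * (x k - c) < 0 := by
    intro x hx hneg
    have hcont2 : Continuous fun t : ℝ => z + t • (z - x) := by fun_prop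
    have := (Metric.isOpen_ball.preimage hcont2).mem_nhds (x := 0)
      (show z + (0 : ℝ) • (z - x) ∈ Metric.ball z ρ by simpa using hρ)
    obtain ⟨η, hη, h⟩ := Metric.mem_nhds_iff.1 this
    have hw : z + (η / 2) • (z - x) ∈ Ω := by
      refine hsub ⟨h (by simpa [abs_of_pos hη] using hη), ?_⟩
      simp only [Set.mem_ofPred_eq, PiLp.add_apply, PiLp.smul_apply, PiLp.sub_apply, smul_eq_mul,
        hzc]
      have : σ * (c + η / 2 * (c - x k) - c) = -(η / 2 * (σ * (x k - c))) := by ring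
      rw [this]
      have := mul_neg_of_pos_of_neg (half_pos hη) hneg
      linarith
    have hz : z ∈ Ω := by
      have hp : 0 < 1 + η / 2 := by positivity
      have := hc hw hx (a := (1 + η / 2)⁻¹) (b := (1 + η / 2)⁻¹ * (η / 2)) (by positivity)
        (by positivity) (by field_simp)
      convert this using 1
      ext m
      simp only [PiLp.add_apply, PiLp.smul_apply, PiLp.sub_apply, smul_eq_mul]
      field_simp
      ring
    exact (hΩo.frontier_eq ▸ hzf).2 hz
  intro x hx
  -- A point of the open set `Ω` on the hyperplane itself could be pushed to the wrong side.
  refine lt_of_le_of_ne (not_lt.1 (hstrict x hx)) fun h0 => ?_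
  obtain ⟨η, hη, hηU⟩ := hpert _ hΩo x hx
  have h1 := hstrict _ (hηU (-σ * (η / 2)) (by
    have : |-σ * (η / 2)| = η / 2 := by
      rcases hσ with rfl | rfl <;> simp <;> linarith
    rw [this]
    linarith))
  apply h1
  rw [hek]
  have : σ * (x k + -σ * (η / 2) - c) = σ * (x k - c) - σ * σ * (η / 2) := by ring
  rw [this, ← h0, hσsq]
  linarith

/-- The flat part is a Lipschitz image of a bounded set in one dimension less. Finiteness of the
surface measure is needed only here, since the Neumann condition is tested with functions living on
the face. -/
theorem surfaceMeasure_face_lt_top {n : ℕ} {Ω : Set (𝔼 (n + 1))} (hΩ : Bornology.IsBounded Ω)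
    (k : Fin (n + 1)) (c : ℝ) : surfaceMeasure Ω {x | x k = c} < ⊤ := by
  have hlip : LipschitzWith (Real.toNNReal (√(n + 1))) fun y : Fin n → ℝ => linePoint k c y := by
    refine LipschitzWith.of_dist_le_mul fun x y => ?_
    rw [Real.coe_toNNReal _ (Real.sqrt_nonneg _), EuclideanSpace.dist_eq]
    rw [← Real.sqrt_sq (dist_nonneg (x := x) (y := y)), ← Real.sqrt_mul (by positivity)]
    refine Real.sqrt_le_sqrt ?_
    have : ∀ m ∈ Finset.univ, dist (linePoint k c x m) (linePoint k c y m) ^ 2 ≤ dist x y ^ 2 := by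
      intro m _
      refine pow_le_pow_left₀ dist_nonneg ?_ 2
      rcases Fin.eq_self_or_eq_succAbove k m with h | ⟨l, h⟩
      · subst h; simp [linePoint]
      · subst h
        simpa [linePoint] using dist_le_pi_dist x y l
    refine (Finset.sum_le_sum this).trans ?_
    simp
  have hsub : {x : 𝔼 (n + 1) | x k = c} ∩ frontier Ω ⊆
      (fun y => linePoint k c y) '' (dropCoord k '' frontier Ω) := by
    rintro x ⟨hx, hxf⟩
    refine ⟨dropCoord k x, ⟨x, hxf, rfl⟩, ?_⟩
    have hxk : x k = c := hx
    rw [← hxk]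
    exact linePoint_dropCoord k x
  have hm : MeasurableSet {x : 𝔼 (n + 1) | x k = c} :=
    (isClosed_eq (by fun_prop) continuous_const).measurableSet
  have hd : (((n + 1 : ℕ) : ℝ) - 1) = (n : ℝ) := by push_cast; ring
  rw [surfaceMeasure, Measure.restrict_apply hm, hd]
  refine (measure_mono hsub).trans_lt ((hlip.hausdorffMeasure_image_le n.cast_nonneg _).trans_lt ?_)
  refine ENNReal.mul_lt_top (ENNReal.rpow_lt_top_of_nonneg n.cast_nonneg ENNReal.coe_ne_top) ?_
  have h2 : Bornology.IsBounded (dropCoord k '' frontier Ω) :=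
    (lipschitz_dropCoord k).isBounded_image
      ((Metric.isBounded_closure_iff.2 hΩ).subset frontier_subset_closure)
  have h3 := hausdorffMeasure_pi_real (ι := Fin n)
  simp only [Fintype.card_fin] at h3
  rw [h3]
  exact h2.measure_lt_top

end Geometry

section Smooth

theorem hasWeakPartial_of_contDiff (hΩo : IsOpen Ω) (hΩ : Bornology.IsBounded Ω) (hc : Convex ℝ Ω)
    {ψ : (𝔼 d) → ℝ} (hψ : ContDiff ℝ ∞ ψ) (i : Fin d) :
    HasWeakPartial Ω i ψ (partialDeriv i ψ) := by
  refine ⟨hψ.continuous.locallyIntegrable.locallyIntegrableOn _,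
    (continuous_partialDeriv hψ i).locallyIntegrable.locallyIntegrableOn _, fun φ hφ _ hs => ?_⟩
  have := integral_interior_eq_zero hΩo hΩ hc i (H1Lim.const hΩo hΩ hψ) hφ hs
  linarith

theorem memH1_of_contDiff (hΩo : IsOpen Ω) (hΩ : Bornology.IsBounded Ω) (hc : Convex ℝ Ω)
    {ψ : (𝔼 d) → ℝ} (hψ : ContDiff ℝ ∞ ψ) : MemH1 Ω ψ :=
  ⟨memLp_of_continuous hΩo hΩ hψ.continuous 2, fun i => ⟨_, hasWeakPartial_of_contDiff hΩo hΩ hc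
    hψ i, memLp_of_continuous hΩo hΩ (continuous_partialDeriv hψ i) 2⟩⟩

theorem hasTrace_of_contDiff (hΩo : IsOpen Ω) (hΩ : Bornology.IsBounded Ω) (hc : Convex ℝ Ω)
    {ψ : (𝔼 d) → ℝ} (hψ : ContDiff ℝ ∞ ψ) (hm : MemLp ψ 2 (surfaceMeasure Ω)) :
    HasTrace Ω ψ ψ := by
  refine ⟨memH1_of_contDiff hΩo hΩ hc hψ, hm, fun _ => ψ, fun _ => hψ, by simp, fun i => ?_,
    by simp⟩
  have h := (hasWeakPartial_of_contDiff hΩo hΩ hc hψ i).ae_eq_weakPartial hΩo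
  have e : eLpNorm (weakPartial Ω i ψ - partialDeriv i ψ) 2 (volume.restrict Ω) = 0 := by
    rw [← eLpNorm_zero (μ := volume.restrict Ω) (p := 2) (ε := ℝ) (α := 𝔼 d)]
    refine eLpNorm_congr_ae ?_
    filter_upwards [h] with x hx
    simp [hx]
  simp [e]

theorem memLp_surfaceMeasure_of_face (hΩ : Bornology.IsBounded Ω) {ψ : (𝔼 d) → ℝ} {k : Fin d}
    {c : ℝ} (hψ : Continuous ψ) (h0 : ∀ x ∈ frontier Ω, x k ≠ c → ψ x = 0) :
    MemLp ψ 2 (surfaceMeasure Ω) := by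
  obtain ⟨n, rfl⟩ : ∃ n, d = n + 1 := ⟨d - 1, by have := k.pos; omega⟩
  set T : Set (𝔼 (n + 1)) := {x | x k = c} with hT
  have hTm : MeasurableSet T := (isClosed_eq (by fun_prop) continuous_const).measurableSet
  have : IsFiniteMeasure ((surfaceMeasure Ω).restrict T) :=
    ⟨by simpa using surfaceMeasure_face_lt_top hΩ k c⟩
  have hae : ∀ᵐ x ∂(surfaceMeasure Ω), x ∈ frontier Ω := ae_mem_frontier le_rfl
  obtain ⟨C, hC⟩ := exists_bound_of_continuous (Metric.isBounded_closure_iff.2 hΩ) hψ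
  have h1 : MemLp ψ 2 ((surfaceMeasure Ω).restrict T) := by
    refine MemLp.of_bound hψ.aestronglyMeasurable C ?_
    filter_upwards [ae_restrict_of_ae hae] with x hx using hC x (frontier_subset_closure hx)
  refine ((memLp_indicator_iff_restrict hTm).2 h1).ae_eq ?_
  filter_upwards [hae] with x hx
  by_cases hxT : x ∈ T
  · simp [hxT]
  · simp [hxT, h0 x hx hxT]

end Smooth

end

/-! ### Consequences of the Dirichlet and Neumann conditions. -/

section

variable {d : ℕ} {Ω : Set (𝔼 d)}

section BoundaryConditions

variable {Γ Γ' : Set (𝔼 d)} {u : (𝔼 d) → ℝ} {k j : Fin d} {c : ℝ}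

/-- Weak derivatives commute. -/
theorem MemH2.weakPartial_comm (hΩo : IsOpen Ω) (hu : MemH2 Ω u) (i l : Fin d) :
    weakPartial Ω i (weakPartial Ω l u) =ᵐ[volume.restrict Ω]
      weakPartial Ω l (weakPartial Ω i u) := by
  refine HasWeakPartial.ae_eq_weakPartial hΩo ?_
  refine ⟨((hu.2 i).hasWeakPartial l).1, ((hu.2 l).hasWeakPartial i).2.1, fun φ hφ hφc hs => ?_⟩
  have hs' : ∀ m, tsupport (partialDeriv m φ) ⊆ Ω := fun m =>
    (tsupport_partialDeriv_subset m).trans hs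
  have hc' : ∀ m, HasCompactSupport (partialDeriv m φ) := fun m =>
    hφc.mono' ((subset_tsupport _).trans (tsupport_partialDeriv_subset m))
  have h1 := (hu.1.hasWeakPartial i).2.2 _ (contDiff_partialDeriv hφ l) (hc' l) (hs' l)
  have h2 := (hu.1.hasWeakPartial l).2.2 _ (contDiff_partialDeriv hφ i) (hc' i) (hs' i)
  have h3 := ((hu.2 l).hasWeakPartial i).2.2 _ hφ hφc hs
  rw [partialDeriv_comm hφ i l] at h1
  linarith

/-- The gradient of a function vanishing on `Γ` is normal to `Γ`. -/
theorem TraceVanishesOn.curl_eq_zero (hΩo : IsOpen Ω) (hΩ : Bornology.IsBounded Ω)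
    (hc : Convex ℝ Ω) (hu : TraceVanishesOn Ω Γ u) {η : (𝔼 d) → ℝ} (hη : ContDiff ℝ ∞ η)
    (h0 : ∀ᵐ x ∂(surfaceMeasure Ω), x ∉ Γ → partialDeriv k η x = 0 ∧ partialDeriv j η x = 0) :
    (∫ x in Ω, weakPartial Ω j u x * partialDeriv k η x) -
      ∫ x in Ω, weakPartial Ω k u x * partialDeriv j η x = 0 := by
  obtain ⟨g, ⟨hu1, hg, φ, hφ, hφ0, hφ1, hφ2⟩, hgΓ⟩ := hu
  -- By Gauss–Green these are boundary integrals of `φₙ ζ`; they tend to those of `g ζ`, and `g`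
  -- vanishes on `Γ` while `ζ` vanishes off it.
  have hbd : ∀ (l : Fin d) (ζ : (𝔼 d) → ℝ), ContDiff ℝ ∞ ζ →
      (∀ᵐ x ∂(surfaceMeasure Ω), x ∉ Γ → ζ x = 0) →
      Tendsto (fun n => ∫ x in Ω, partialDeriv l (fun x => φ n x * ζ x) x) atTop (𝓝 0) := by
    intro l ζ hζ hζ0
    obtain ⟨lp, lm, h⟩ := exists_isBoundaryPair hΩo hc hΩ l
    have hlim : ∀ ν : Measure (𝔼 d), IsFiniteMeasure ν → ν ≤ surfaceMeasure Ω →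
        Tendsto (fun n => ∫ x, φ n x * ζ x ∂ν) atTop (𝓝 0) := by
      intro ν hfin hν
      have hL : L2Lim ν φ g := by
        refine ⟨fun n => memLp_of_le_surfaceMeasure hΩ hν (hφ n).continuous 2,
          hg.mono_measure hν, ?_⟩
        refine tendsto_of_tendsto_of_tendsto_of_le_of_le tendsto_const_nhds hφ2
          (fun _ => zero_le) fun n => ?_
        rw [← eLpNorm_sub_comm]
        exact eLpNorm_mono_measure _ hν
      have h1 := hL.integral_mul (L2Lim.const (memLp_of_le_surfaceMeasure hΩ hν hζ.continuous 2))
      have h2 : ∫ x, g x * ζ x ∂ν = 0 := by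
        refine integral_eq_zero_of_ae ?_
        filter_upwards [(Measure.absolutelyContinuous_of_le hν).ae_le hζ0,
          (Measure.absolutelyContinuous_of_le hν).ae_le hgΓ] with x hx hx'
        by_cases hxΓ : x ∈ Γ
        · simp [hx' hxΓ]
        · simp [hx hxΓ]
      rwa [h2] at h1
    have := (hlim lp h.finite_pos h.le_pos).sub (hlim lm h.finite_neg h.le_neg)
    rw [sub_zero] at this
    exact this.congr fun n => (h.integral_eq _ ((hφ n).mul hζ)).symm
  have hL' : ∀ i, L2Lim (volume.restrict Ω) (fun n => partialDeriv i (φ n)) (weakPartial Ω i u) :=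
    fun i => ⟨fun n => memLp_of_continuous hΩo hΩ (continuous_partialDeriv (hφ n) i) 2,
      hu1.memLp_weakPartial hΩo i, (hφ1 i).congr fun n => eLpNorm_sub_comm ..⟩
  have hη' : ∀ i, L2Lim (volume.restrict Ω) (fun _ => partialDeriv i η) (partialDeriv i η) :=
    fun i => .const (memLp_of_continuous hΩo hΩ (continuous_partialDeriv hη i) 2)
  have l1 := ((hL' j).integral_mul (hη' k)).sub ((hL' k).integral_mul (hη' j))
  have l2 := (hbd j _ (contDiff_partialDeriv hη k)
    (by filter_upwards [h0] with x hx using fun h => (hx h).1)).sub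
    (hbd k _ (contDiff_partialDeriv hη j)
    (by filter_upwards [h0] with x hx using fun h => (hx h).2))
  rw [sub_zero] at l2
  -- The mixed second derivatives of `η` are equal and cancel in the difference.
  refine tendsto_nhds_unique l1 (l2.congr fun n => ?_)
  have hi : ∀ i m, Integrable (fun x => partialDeriv i (φ n) x * partialDeriv m η x)
      (volume.restrict Ω) := fun i m => integrable_of_continuous hΩo hΩ
    ((continuous_partialDeriv (hφ n) i).mul (continuous_partialDeriv hη m))
  have hi2 : ∀ i m, Integrable (fun x => φ n x * partialDeriv i (partialDeriv m η) x)
      (volume.restrict Ω) := fun i m => integrable_of_continuous hΩo hΩ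
    ((hφ n).continuous.mul (continuous_partialDeriv (contDiff_partialDeriv hη m) i))
  rw [partialDeriv_mul (hφ n) (contDiff_partialDeriv hη k),
    partialDeriv_mul (hφ n) (contDiff_partialDeriv hη j), integral_add (hi j k) (hi2 j k),
    integral_add (hi k j) (hi2 k j), partialDeriv_comm hη j k]
  ring

theorem ae_mem_or_notMem_closure (hΓ : surfaceMeasure Ω (closure Γ \ Γ) = 0) :
    ∀ᵐ x ∂(surfaceMeasure Ω), x ∈ Γ ∨ x ∉ closure Γ := by
  have : ∀ᵐ x ∂(surfaceMeasure Ω), x ∉ closure Γ \ Γ := by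
    rw [ae_iff]
    simp only [not_not]
    exact hΓ
  filter_upwards [this] with x hx
  simp only [Set.mem_sdiff, not_and, not_not] at hx
  tauto

/-- The Neumann condition on the face, in integrated form. -/
theorem U2.vanishesOnFace_normal (hΩo : IsOpen Ω) (hΩ : Bornology.IsBounded Ω) (hc : Convex ℝ Ω)
    (hne : Ω.Nonempty) (hmiss : ∀ x ∈ Ω, x k ≠ c) (hcover : closure Γ ∪ closure Γ' = frontier Ω)
    (hu : u ∈ U2 Ω Γ Γ') {w : (𝔼 d) → ℝ} (hw : ContDiff ℝ ∞ w) (hw0 : ∀ x ∈ closure Γ, w x = 0) :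
    VanishesOnFace Ω k c w (weakPartial Ω k u)
      (fun i => weakPartial Ω i (weakPartial Ω k u)) := by
  intro h hh h0
  obtain ⟨hu2, -, huN⟩ := hu
  set ψ : (𝔼 d) → ℝ := fun x => w x * h x with hψdef
  have hψ : ContDiff ℝ ∞ ψ := hw.mul hh
  have hψ0 : ∀ x ∈ frontier Ω, x k ≠ c → ψ x = 0 := fun x hx hxc => by simp [hψdef, h0 x hx hxc]
  -- The product is an admissible test function: off the closure of `Γ'` the boundary lies in the
  -- closure of `Γ`, where `w` is zero.
  have hN := huN ψ ⟨ψ, hasTrace_of_contDiff hΩo hΩ hc hψ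
    (memLp_surfaceMeasure_of_face hΩ hψ.continuous hψ0), ae_of_all _ fun x hx => by
      have : x ∈ closure Γ := by
        have h1 := hcover.symm ▸ hx.1
        exact h1.resolve_right hx.2
      simp [hψdef, hw0 x this]⟩
  have hψ2 := memLp_of_continuous hΩo hΩ hψ.continuous 2
  have hi1 : ∀ i, Integrable (fun x => weakPartial Ω i u x * partialDeriv i ψ x)
      (volume.restrict Ω) := fun i => (hu2.1.memLp_weakPartial hΩo i).integrable_mul
    (memLp_of_continuous hΩo hΩ (continuous_partialDeriv hψ i) 2)
  have hi2 : ∀ i, Integrable (fun x => weakPartial Ω i (weakPartial Ω i u) x * ψ x)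
      (volume.restrict Ω) := fun i =>
    ((hu2.2 i).memLp_weakPartial hΩo i).integrable_mul hψ2
  have e1 : ∫ x in Ω, ∑ i, weakPartial Ω i u x * weakPartial Ω i ψ x =
      ∑ i, ∫ x in Ω, weakPartial Ω i u x * partialDeriv i ψ x := by
    rw [← integral_finsetSum _ fun i _ => hi1 i]
    refine integral_congr_ae ?_
    have : ∀ᵐ x ∂(volume.restrict Ω), ∀ i, partialDeriv i ψ x = weakPartial Ω i ψ x :=
      ae_all_iff.2 fun i => (hasWeakPartial_of_contDiff hΩo hΩ hc hψ i).ae_eq_weakPartial hΩo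
    filter_upwards [this] with x hx
    simp only [hx]
  have e2 : ∫ x in Ω, weakLaplacian Ω u x * ψ x =
      ∑ i, ∫ x in Ω, weakPartial Ω i (weakPartial Ω i u) x * ψ x := by
    rw [← integral_finsetSum _ fun i _ => hi2 i]
    simp only [weakLaplacian, Finset.sum_mul]
  -- In Green's identity only direction `k` survives: for `i ≠ k` the integration by parts is
  -- tangential to the face and has no boundary term.
  rw [e1, e2, ← Finset.sum_add_distrib, Finset.sum_eq_single k] at hN
  · rw [← hN]
    exact add_comm _ _
  · intro i _ hik
    obtain ⟨φ, hφ⟩ := (hu2.2 i).exists_h1Lim hΩo hΩ hc hne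
    have := integral_tangential_eq_zero hΩo hΩ hc hik hmiss hφ hψ hψ0
    rw [add_comm]
    exact this
  · simp

/-- The Dirichlet condition on the face makes the tangential derivative vanish. -/
theorem U2.vanishesOnFace_tangential (hΩo : IsOpen Ω) (hΩ : Bornology.IsBounded Ω)
    (hc : Convex ℝ Ω) (hne : Ω.Nonempty) (hmiss : ∀ x ∈ Ω, x k ≠ c) (hjk : j ≠ k)
    (hu : u ∈ U2 Ω Γ Γ') {O : Set (𝔼 d)} (hO : Γ = O ∩ frontier Ω) {v : (𝔼 d) → ℝ}
    (hv : ContDiff ℝ ∞ v) (hv0 : ∀ x, x ∉ O → v x = 0) :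
    VanishesOnFace Ω k c (fun x => v x * v x) (weakPartial Ω j u)
      (fun i => weakPartial Ω i (weakPartial Ω j u)) := by
  intro h hh h0
  obtain ⟨hu2, huD, -⟩ := hu
  -- The square of `v` makes the first derivatives of the product vanish wherever `v` does, as the
  -- Dirichlet condition requires.
  have hψ : ContDiff ℝ ∞ fun x => v x * v x * h x := (hv.mul hv).mul hh
  have hcurl := huD.curl_eq_zero (k := k) (j := j) hΩo hΩ hc hψ (by
    filter_upwards [ae_mem_frontier le_rfl] with x hx hxΓ
    have hxO : v x = 0 := hv0 x fun hxO => hxΓ (hO ▸ ⟨hxO, hx⟩)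
    simp only [partialDeriv_mul (hv.mul hv) hh, partialDeriv_mul hv hv, hxO]
    simp)
  obtain ⟨φ, hφ⟩ := (hu2.2 k).exists_h1Lim hΩo hΩ hc hne
  have ht := integral_tangential_eq_zero hΩo hΩ hc hjk hmiss hφ hψ
    fun x hx hxc => by simp [h0 x hx hxc]
  have e : ∫ x in Ω, weakPartial Ω k (weakPartial Ω j u) x * (v x * v x * h x) =
      ∫ x in Ω, weakPartial Ω j (weakPartial Ω k u) x * (v x * v x * h x) := by
    refine integral_congr_ae ?_
    filter_upwards [hu2.weakPartial_comm hΩo k j] with x hx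
    rw [hx]
  rw [e]
  linarith

end BoundaryConditions

/-- The pair `(p, q)` of `H¹` functions is the projection of a gradient field to the plane of the
coordinates `k` and `j`; off the face `{x k = c}` the field is normal to the boundary, and almost
everywhere on the face one of `p` and `q` vanishes. -/
structure IsMixedField (Ω : Set (𝔼 d)) (k j : Fin d) (c : ℝ) (p q : (𝔼 d) → ℝ)
    (p' q' : Fin d → (𝔼 d) → ℝ) : Prop where
  lim_fst : ∃ φ, H1Lim Ω φ p p'
  lim_snd : ∃ ψ, H1Lim Ω ψ q q'
  symm : p' j =ᵐ[volume.restrict Ω] q' k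
  normal : ∀ η : (𝔼 d) → ℝ, ContDiff ℝ ∞ η → (∀ x ∈ frontier Ω, x k = c → x ∉ tsupport η) →
    (∫ x in Ω, q x * partialDeriv k η x) - ∫ x in Ω, p x * partialDeriv j η x = 0
  face : ∃ w v : (𝔼 d) → ℝ, ContDiff ℝ ∞ w ∧ ContDiff ℝ ∞ v ∧
    (∀ᵐ x ∂(surfaceMeasure Ω), w x ≠ 0 ∨ v x ≠ 0) ∧
    VanishesOnFace Ω k c w p p' ∧ VanishesOnFace Ω k c v q q'

theorem exists_contDiff_support_eq {U : Set (𝔼 d)} (hU : IsOpen U) :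
    ∃ f : (𝔼 d) → ℝ, ContDiff ℝ ∞ f ∧ Function.support f = U := by
  obtain ⟨f, h1, h2, -⟩ := hU.exists_contDiff_support_eq (n := ⊤)
  exact ⟨f, h2, h1⟩

/-- The weights are chosen by their supports: `w` is nonzero exactly off the closure of `Γ`, and `v`
exactly on an open set cutting out `Γ`. They cover almost all of the boundary because the relative
boundary of `Γ` is null. Normality off the face needs only test functions whose support avoids the
face, hence avoids the closure of `Γ'`. -/
theorem U2.isMixedField (hΩo : IsOpen Ω) (hΩ : Bornology.IsBounded Ω)
    (hc : Convex ℝ Ω) (hne : Ω.Nonempty) {Γ Γ' : Set (𝔼 d)} {u : (𝔼 d) → ℝ} {k j : Fin d} {c : ℝ}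
    (hmiss : ∀ x ∈ Ω, x k ≠ c) (hjk : j ≠ k) (hcover : closure Γ ∪ closure Γ' = frontier Ω)
    (hplane : ∀ x ∈ Γ', x k = c) (hΓ : IsRelOpenInBoundary Ω Γ)
    (hnull : surfaceMeasure Ω (closure Γ \ Γ) = 0) (hu : u ∈ U2 Ω Γ Γ') :
    IsMixedField Ω k j c (weakPartial Ω k u) (weakPartial Ω j u)
      (fun i => weakPartial Ω i (weakPartial Ω k u))
      (fun i => weakPartial Ω i (weakPartial Ω j u)) := by
  obtain ⟨O, hO, hΓO⟩ := hΓ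
  have hplane' : ∀ x ∈ closure Γ', x k = c := fun x hx =>
    closure_minimal hplane (isClosed_eq (by fun_prop) continuous_const) hx
  obtain ⟨w, hw, hws⟩ := exists_contDiff_support_eq (isClosed_closure (s := Γ)).isOpen_compl
  obtain ⟨v, hv, hvs⟩ := exists_contDiff_support_eq hO
  have hae := ae_mem_or_notMem_closure hnull
  refine ⟨(hu.1.2 k).exists_h1Lim hΩo hΩ hc hne, (hu.1.2 j).exists_h1Lim hΩo hΩ hc hne,
    hu.1.weakPartial_comm hΩo j k, fun η hη h0 => ?_, w, fun x => v x * v x, hw,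
    hv.mul hv, ?_, ?_, ?_⟩
  · refine hu.2.1.curl_eq_zero hΩo hΩ hc hη ?_
    filter_upwards [hae, ae_mem_frontier le_rfl] with x hx hxf hxΓ
    have h1 : x ∈ closure Γ' := by
      have := hcover.symm ▸ hxf
      exact this.resolve_left (hx.resolve_left hxΓ)
    have h2 := h0 x hxf (hplane' x h1)
    exact ⟨partialDeriv_eq_zero h2 k, partialDeriv_eq_zero h2 j⟩
  · filter_upwards [hae] with x hx
    rcases hx with hx | hx
    · right
      have : x ∈ Function.support v := hvs ▸ (hΓO ▸ hx).1
      simpa using this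
    · left
      have : x ∈ Function.support w := hws ▸ hx
      simpa using this
  · refine U2.vanishesOnFace_normal hΩo hΩ hc hne hmiss hcover hu hw fun x hx => ?_
    by_contra h
    have : x ∈ Function.support w := h
    rw [hws] at this
    exact this hx
  · refine U2.vanishesOnFace_tangential hΩo hΩ hc hne hmiss hjk hu hΓO hv fun x hx => ?_
    by_contra h
    exact hx (hvs ▸ h)

end

/-! ### Approximation of a convex domain by smooth concave functions. -/

section

variable {d : ℕ} {Ω : Set (𝔼 d)}

section ConcaveApproximation

variable {β F G : (𝔼 d) → ℝ} {L : NNReal}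

theorem integrable_mul_comp_sub (hβ : Continuous β) (hβc : HasCompactSupport β)
    (hF : Continuous F) (x : 𝔼 d) : Integrable fun t => β t * F (x - t) := by
  refine Continuous.integrable_of_hasCompactSupport (hβ.mul (hF.comp (by fun_prop))) ?_
  exact hβc.mul_right

theorem mollify_sub (hβ : Continuous β) (hβc : HasCompactSupport β) (hF : Continuous F)
    (hG : Continuous G) (x : 𝔼 d) :
    mollify β (fun y => F y - G y) x = mollify β F x - mollify β G x := by
  simp only [mollify_apply', mul_sub]
  exact integral_sub (integrable_mul_comp_sub hβ hβc hF x) (integrable_mul_comp_sub hβ hβc hG x)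

theorem lipschitzWith_mollify (hβ : Continuous β) (hβc : HasCompactSupport β)
    (hβ0 : ∀ x, 0 ≤ β x) (hβ1 : ∫ x, β x = 1) (hF : LipschitzWith L F) :
    LipschitzWith L (mollify β F) := by
  refine LipschitzWith.of_dist_le_mul fun x y => ?_
  have hβi : Integrable β := hβ.integrable_of_hasCompactSupport hβc
  rw [dist_eq_norm, mollify_apply', mollify_apply', ← integral_sub
    (integrable_mul_comp_sub hβ hβc hF.continuous x)
    (integrable_mul_comp_sub hβ hβc hF.continuous y)]
  calc _ ≤ ∫ t, β t * (L * dist x y) := by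
        refine norm_integral_le_of_norm_le (hβi.mul_const _) (ae_of_all _ fun t => ?_)
        rw [← mul_sub, norm_mul, Real.norm_of_nonneg (hβ0 t)]
        refine mul_le_mul_of_nonneg_left ?_ (hβ0 t)
        have := hF.dist_le_mul (x - t) (y - t)
        rwa [dist_sub_right, dist_eq_norm] at this
    _ = L * dist x y := by rw [integral_mul_const, hβ1, one_mul]

theorem concaveOn_mollify (hβ : Continuous β) (hβc : HasCompactSupport β)
    (hβ0 : ∀ x, 0 ≤ β x) (hFc : Continuous F) (hF : ConcaveOn ℝ Set.univ F) :
    ConcaveOn ℝ Set.univ (mollify β F) := by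
  refine ⟨convex_univ, fun x _ y _ a b ha hb hab => ?_⟩
  simp only [mollify_apply', smul_eq_mul]
  rw [← integral_const_mul, ← integral_const_mul, ← integral_add
    ((integrable_mul_comp_sub hβ hβc hFc x).const_mul a)
    ((integrable_mul_comp_sub hβ hβc hFc y).const_mul b)]
  refine integral_mono (((integrable_mul_comp_sub hβ hβc hFc x).const_mul a).add
    ((integrable_mul_comp_sub hβ hβc hFc y).const_mul b))
    (integrable_mul_comp_sub hβ hβc hFc _) fun t => ?_
  have h := hF.2 (Set.mem_univ (x - t)) (Set.mem_univ (y - t)) ha hb hab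
  have e : a • x + b • y - t = a • (x - t) + b • (y - t) := by
    have : t = a • t + b • t := by rw [← add_smul, hab, one_smul]
    rw [smul_sub, smul_sub]
    nth_rw 1 [this]
    abel
  simp only [smul_eq_mul] at h
  rw [e]
  calc _ = β t * (a * F (x - t) + b * F (y - t)) := by ring
    _ ≤ _ := mul_le_mul_of_nonneg_left h (hβ0 t)

theorem abs_partialDeriv_le (hF : LipschitzWith L F) (i : Fin d) (x : 𝔼 d) :
    |partialDeriv i F x| ≤ L := by
  have h := (fderiv ℝ F x).le_opNorm (EuclideanSpace.single i 1)
  have h2 : ‖(EuclideanSpace.single i 1 : 𝔼 d)‖ = 1 := by simp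
  rw [h2, mul_one] at h
  exact h.trans (norm_fderiv_le_of_lipschitz ℝ hF)

/-- The Hessian of a concave function is negative semidefinite. -/
theorem hessian_nonpos (hF : ContDiff ℝ ∞ F) (hc : ConcaveOn ℝ Set.univ F) (k j : Fin d)
    (s t : ℝ) (x : 𝔼 d) :
    s ^ 2 * partialDeriv k (partialDeriv k F) x - 2 * s * t * partialDeriv k (partialDeriv j F) x
      + t ^ 2 * partialDeriv j (partialDeriv j F) x ≤ 0 := by
  set v : 𝔼 d := s • EuclideanSpace.single k 1 - t • EuclideanSpace.single j 1 with hv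
  have hline : ∀ {H : (𝔼 d) → ℝ}, ContDiff ℝ ∞ H → ∀ r : ℝ, HasDerivAt (fun r : ℝ => H (x + r • v))
      (s * partialDeriv k H (x + r • v) - t * partialDeriv j H (x + r • v)) r := by
    intro H hH r
    have h1 : HasDerivAt (fun r : ℝ => x + r • v) v r := by
      simpa using ((hasDerivAt_id r).smul_const v).const_add x
    have h2 := ((hH.differentiable (by simp)) (x + r • v)).hasFDerivAt.comp_hasDerivAt r h1
    refine h2.congr_deriv ?_
    simp [hv, partialDeriv]
  have hg : ConcaveOn ℝ Set.univ fun r : ℝ => F (x + r • v) := by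
    refine ⟨convex_univ, fun r _ r' _ a b ha hb hab => ?_⟩
    have h := hc.2 (Set.mem_univ (x + r • v)) (Set.mem_univ (x + r' • v)) ha hb hab
    have e : x + (a • r + b • r') • v = a • (x + r • v) + b • (x + r' • v) := by
      have : x = a • x + b • x := by rw [← add_smul, hab, one_smul]
      nth_rw 1 [this]
      module
    show a • F (x + r • v) + b • F (x + r' • v) ≤ F (x + (a • r + b • r') • v)
    rw [e]
    exact h
  have hd : (deriv fun r : ℝ => F (x + r • v)) =
      fun r => s * partialDeriv k F (x + r • v) - t * partialDeriv j F (x + r • v) :=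
    funext fun r => (hline hF r).deriv
  have hanti := hg.antitoneOn_deriv fun r _ => (hline hF r).differentiableAt
  rw [hd, antitoneOn_univ] at hanti
  have h := hanti.deriv_nonpos (x := 0)
  have hdd := ((hline (contDiff_partialDeriv hF k) 0).const_mul s).sub
    ((hline (contDiff_partialDeriv hF j) 0).const_mul t)
  rw [show (fun r : ℝ => s * partialDeriv k F (x + r • v) - t * partialDeriv j F (x + r • v)) =
    (fun r : ℝ => s * partialDeriv k F (x + r • v)) -
      fun r : ℝ => t * partialDeriv j F (x + r • v) from rfl, hdd.deriv] at h
  simp only [zero_smul, add_zero, partialDeriv_comm hF j k] at h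
  linarith

/-- A concave Lipschitz function which is positive exactly on `Ω` is approximated by smooth
concave functions `Φ` whose gradient nearly coincides with that of test functions `Θ`. -/
theorem exists_concave_approx {φ : (𝔼 d) → ℝ} (hφL : LipschitzWith L φ)
    (hφc : ConcaveOn ℝ Set.univ φ) (hφ1 : ∀ x, φ x ≤ 1) (hφΩ : ∀ x, 0 < φ x ↔ x ∈ Ω) :
    ∃ Φ Θ : ℕ → (𝔼 d) → ℝ, (∀ m, ContDiff ℝ ∞ (Φ m)) ∧ (∀ m, ConcaveOn ℝ Set.univ (Φ m)) ∧
      (∀ m, ContDiff ℝ ∞ (Θ m)) ∧ (∀ m, tsupport (Θ m) ⊆ Ω) ∧ (∀ m x, |Θ m x| ≤ 1) ∧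
      (∀ x ∈ Ω, Tendsto (fun m => Θ m x) atTop (𝓝 (φ x))) ∧
      (∀ i m x, |partialDeriv i (Φ m) x - partialDeriv i (Θ m) x| ≤ L) ∧
      ∀ i, ∀ x ∈ Ω, Tendsto (fun m => partialDeriv i (Φ m) x - partialDeriv i (Θ m) x) atTop
        (𝓝 0) := by
  set δ : ℕ → ℝ := fun m => 1 / ((m : ℝ) + 1) with hδ
  have hδ0 : ∀ m, 0 < δ m := fun m => by positivity
  have hδl : Tendsto δ atTop (𝓝 0) := tendsto_one_div_add_atTop_nhds_zero_nat
  choose β hβ hβc hβ0 hβ1 hβs using fun m => exists_mollifier d (hδ0 m)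
  set τ : ℕ → ℝ := fun m => (L + 1) * δ m with hτ
  have hτ0 : ∀ m, 0 < τ m := fun m => mul_pos (by positivity) (hδ0 m)
  have hτl : Tendsto τ atTop (𝓝 0) := by simpa using hδl.const_mul ((L : ℝ) + 1)
  set θ : ℕ → (𝔼 d) → ℝ := fun m x => max (φ x - τ m) 0 with hθ
  have hφcont := hφL.continuous
  have hθc : ∀ m, Continuous (θ m) := fun m => (hφcont.sub continuous_const).max continuous_const
  have hsub : ∀ m, (fun x => φ x - θ m x) = fun x => min (φ x) (τ m) := by
    intro m
    ext x
    simp only [hθ]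
    rcases le_total (φ x) (τ m) with h | h
    · rw [max_eq_right (by linarith), min_eq_left h, sub_zero]
    · rw [max_eq_left (by linarith), min_eq_right h]
      ring
  have hΦ : ∀ m, ContDiff ℝ ∞ (mollify (β m) φ) := fun m =>
    contDiff_mollify (hβ m) (hβc m) hφcont.locallyIntegrable
  have hΘ : ∀ m, ContDiff ℝ ∞ (mollify (β m) (θ m)) := fun m =>
    contDiff_mollify (hβ m) (hβc m) (hθc m).locallyIntegrable
  have hdiff : ∀ m, (fun x => mollify (β m) φ x - mollify (β m) (θ m) x) =
      mollify (β m) fun x => min (φ x) (τ m) := by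
    intro m
    rw [← hsub m]
    ext x
    rw [mollify_sub (hβ m).continuous (hβc m) hφcont (hθc m)]
  have hdiff' : ∀ i m x, partialDeriv i (mollify (β m) φ) x -
      partialDeriv i (mollify (β m) (θ m)) x =
        partialDeriv i (mollify (β m) fun x => min (φ x) (τ m)) x := by
    intro i m x
    rw [← hdiff m, partialDeriv_sub (hΦ m) (hΘ m)]
  have hlip : ∀ x y, |φ y - φ x| ≤ L * dist y x := fun x y => by
    have := hφL.dist_le_mul y x
    rwa [Real.dist_eq] at this
  refine ⟨fun m => mollify (β m) φ, fun m => mollify (β m) (θ m), hΦ, fun m =>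
    concaveOn_mollify (hβ m).continuous (hβc m) (hβ0 m) hφcont hφc, hΘ, fun m => ?_,
    fun m x => ?_, fun x hx => ?_, fun i m x => ?_, fun i x hx => ?_⟩
  · have hclosed : IsClosed {x | τ m - L * δ m ≤ φ x} := isClosed_le continuous_const hφcont
    refine (closure_minimal (fun x hx => ?_) hclosed).trans fun x hx => (hφΩ x).1 ?_
    · by_contra hcon
      simp only [Set.mem_ofPred_eq, not_le] at hcon
      apply hx
      have := dist_mollify_le (F := θ m) (z := 0) le_rfl (hβ0 m) (hβ1 m) (hβs m)
        (hθc m).aestronglyMeasurable (x := x) fun y hy => by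
          have h1 := (abs_le.1 (hlip x y)).2
          have h2 : L * dist y x ≤ L * δ m :=
            mul_le_mul_of_nonneg_left (Metric.mem_ball.1 hy).le L.2
          simp only [hθ]
          rw [max_eq_right (by linarith), dist_self]
      simpa using this
    · have h1 : τ m - L * δ m ≤ φ x := hx
      have h2 : τ m - L * δ m = δ m := by simp only [hτ]; ring
      linarith [hδ0 m]
  · have := dist_mollify_le (F := θ m) (z := 0) zero_le_one (hβ0 m) (hβ1 m) (hβs m)
      (hθc m).aestronglyMeasurable (x := x) fun y hy => by
        rw [dist_zero_right, Real.norm_of_nonneg (le_max_right _ _)]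
        exact max_le (by linarith [hφ1 y, hτ0 m]) zero_le_one
    simpa using this
  · have hb : Tendsto (fun m => L * δ m + τ m) atTop (𝓝 0) := by
      simpa using (hδl.const_mul (L : ℝ)).add hτl
    rw [tendsto_iff_dist_tendsto_zero]
    refine squeeze_zero (fun _ => dist_nonneg) (fun m => ?_) hb
    refine dist_mollify_le (by have := hδ0 m; have := hτ0 m; positivity) (hβ0 m) (hβ1 m) (hβs m)
      (hθc m).aestronglyMeasurable fun y hy => ?_
    have h1 := abs_le.1 (hlip x y)
    have h2 : L * dist y x ≤ L * δ m := mul_le_mul_of_nonneg_left (Metric.mem_ball.1 hy).le L.2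
    have h3 := (hφΩ x).2 hx
    rw [Real.dist_eq, abs_le]
    simp only [hθ]
    have := hτ0 m
    constructor
    · have := le_max_left (φ y - τ m) 0
      linarith
    · have : max (φ y - τ m) 0 ≤ φ x + L * δ m := max_le (by linarith)
        (by have := mul_nonneg L.2 (hδ0 m).le; linarith [show (0:ℝ) ≤ L * δ m from this])
      linarith
  · rw [hdiff']
    exact abs_partialDeriv_le (lipschitzWith_mollify (hβ m).continuous (hβc m) (hβ0 m) (hβ1 m)
      (hφL.min_const _)) i x
  · simp only [hdiff']
    have hx0 := (hφΩ x).2 hx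
    obtain ⟨r, hr, hball⟩ := Metric.isOpen_iff.1
      (isOpen_lt continuous_const hφcont : IsOpen {y | φ x / 2 < φ y}) x (half_lt_self hx0)
    have hev : ∀ᶠ m in atTop, δ m < r / 2 ∧ τ m < φ x / 2 :=
      (hδl.eventually (gt_mem_nhds (half_pos hr))).and (hτl.eventually (gt_mem_nhds (half_pos hx0)))
    refine tendsto_const_nhds.congr' ?_
    filter_upwards [hev] with m hm
    -- The two gradients differ by that of the mollified `min φ τ`, which is Lipschitz uniformly in
    -- the scale, and near an interior point is the constant `τ` once the scale is small.
    have hloc : mollify (β m) (fun x => min (φ x) (τ m)) =ᶠ[𝓝 x] fun _ => τ m := by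
      filter_upwards [Metric.ball_mem_nhds x (half_pos hr)] with y hy
      have := dist_mollify_le (F := fun x => min (φ x) (τ m)) (z := τ m) le_rfl (hβ0 m) (hβ1 m)
        (hβs m) (hφcont.min continuous_const).aestronglyMeasurable (x := y) fun t ht => by
          have h1 : t ∈ Metric.ball x r := by
            rw [Metric.mem_ball] at *
            linarith [dist_triangle t y x]
          have h2 : φ x / 2 < φ t := hball h1
          rw [min_eq_right (by linarith), dist_self]
      exact dist_le_zero.1 this
    simp [partialDeriv, hloc.fderiv_eq]

/-- Let `g` be the gauge of `Ω` centred at an interior point. Then `1 - g` is concave, Lipschitz and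
positive exactly on `Ω`; scaling it up and capping at one gives functions increasing to one on `Ω`.
-/
theorem exists_concave_cutoff (hΩo : IsOpen Ω) (hc : Convex ℝ Ω) (hne : Ω.Nonempty) :
    ∃ φ : ℕ → (𝔼 d) → ℝ, (∀ n, (∃ L, LipschitzWith L (φ n)) ∧ ConcaveOn ℝ Set.univ (φ n) ∧
      (∀ x, φ n x ≤ 1) ∧ ∀ x, 0 < φ n x ↔ x ∈ Ω) ∧
      ∀ x ∈ Ω, Tendsto (fun n => φ n x) atTop (𝓝 1) := by
  obtain ⟨x₀, hx₀⟩ := hne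
  set K : Set (𝔼 d) := (fun y => x₀ + y) ⁻¹' Ω with hK
  have hKo : IsOpen K := hΩo.preimage (by fun_prop)
  have hKc : Convex ℝ K := hc.translate_preimage_right x₀
  have hK0 : K ∈ 𝓝 0 := hKo.mem_nhds (by simpa [hK] using hx₀)
  obtain ⟨L, hL⟩ := hKc.lipschitz_gauge hK0
  set g : (𝔼 d) → ℝ := fun x => gauge K (x - x₀) with hg
  have hgL : LipschitzWith L g := by
    have := hL.comp (LipschitzWith.id.sub (LipschitzWith.const x₀))
    simpa [Function.comp_def] using this
  have hgΩ : ∀ x, g x < 1 ↔ x ∈ Ω := by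
    intro x
    rw [hg, gauge_lt_one_iff_mem_interior hKc hK0, hKo.interior_eq, hK]
    simp
  have hgc : ConvexOn ℝ Set.univ g := by
    refine ⟨convex_univ, fun x _ y _ a b ha hb hab => ?_⟩
    have e : a • x + b • y - x₀ = a • (x - x₀) + b • (y - x₀) := by
      have : x₀ = a • x₀ + b • x₀ := by rw [← add_smul, hab, one_smul]
      rw [smul_sub, smul_sub]
      nth_rw 1 [this]
      abel
    simp only [hg, e]
    refine (gauge_add_le hKc (absorbent_nhds_zero hK0) _ _).trans ?_
    rw [gauge_smul_of_nonneg ha, gauge_smul_of_nonneg hb]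
  have hn : ∀ n : ℕ, (0 : ℝ) < n + 1 := fun n => by positivity
  refine ⟨fun n x => min ((n + 1) * (1 - g x)) 1, fun n => ⟨?_, ?_,
    fun x => min_le_right _ _, fun x => ?_⟩, fun x hx => ?_⟩
  · exact ⟨_, ((lipschitzWith_smul ((n : ℝ) + 1)).comp
      ((LipschitzWith.const (1 : ℝ)).sub hgL)).min_const 1⟩
  · have h1 : ConcaveOn ℝ Set.univ fun x => (n + 1 : ℝ) * (1 - g x) := by
      have := ((concaveOn_const (1 : ℝ) convex_univ).sub hgc).smul (hn n).le
      exact this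
    exact h1.inf (concaveOn_const 1 convex_univ)
  · rw [lt_min_iff, ← hgΩ]
    constructor
    · intro h
      have := (mul_pos_iff_of_pos_left (hn n)).1 h.1
      linarith
    · intro h
      exact ⟨mul_pos (hn n) (by linarith), one_pos⟩
  · have hx1 := (hgΩ x).2 hx
    refine tendsto_const_nhds.congr' ?_
    obtain ⟨m, hm⟩ := exists_nat_ge (1 - g x)⁻¹
    filter_upwards [eventually_ge_atTop m] with n hn'
    rw [min_eq_right]
    have h0 : 0 < 1 - g x := by linarith
    have : (m : ℝ) ≤ n := by exact_mod_cast hn'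
    calc (1 : ℝ) = (1 - g x)⁻¹ * (1 - g x) := by field_simp
      _ ≤ _ := mul_le_mul_of_nonneg_right (by linarith) h0.le

end ConcaveApproximation

end

/-! ### The bracket and the sign of the convex boundary. -/

section

variable {d : ℕ} {Ω : Set (𝔼 d)}

section Bracket

variable {k j : Fin d} {c : ℝ} {p q : (𝔼 d) → ℝ} {p' q' : Fin d → (𝔼 d) → ℝ} {χ : (𝔼 d) → ℝ}
  {a b : (𝔼 d) → ℝ} {a' b' : Fin d → (𝔼 d) → ℝ} {φ ψ : ℕ → (𝔼 d) → ℝ}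

/-- The density whose integral is twice the integral of `χ {p, q}` up to terms that contain
derivatives of `χ`; here `{p, q} = ∂ₖp ∂ⱼq - ∂ⱼp ∂ₖq`. -/
def bracketDensity (k j : Fin d) (p q : (𝔼 d) → ℝ) (p' q' : Fin d → (𝔼 d) → ℝ)
    (χ : (𝔼 d) → ℝ) (x : 𝔼 d) : ℝ :=
  2 * (χ x * (p' k x * q' j x - p' j x * q' k x)) +
    (p x * (partialDeriv k χ x * q' j x - partialDeriv j χ x * q' k x) +
      q x * (p' k x * partialDeriv j χ x - p' j x * partialDeriv k χ x))

theorem H1Lim.integrable_bracket (hΩo : IsOpen Ω) (hΩ : Bornology.IsBounded Ω)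
    (ha : H1Lim Ω φ a a') (hb : H1Lim Ω ψ b b') {ξ : (𝔼 d) → ℝ} (hξ : ContDiff ℝ ∞ ξ) :
    Integrable (fun x => ξ x * (a' k x * b' j x - a' j x * b' k x) +
      a x * (partialDeriv k ξ x * b' j x - partialDeriv j ξ x * b' k x))
      (volume.restrict Ω) := by
  have h1 := ((memLp_continuous_mul hΩo hΩ (ha.lim' k).memLp hξ.continuous).integrable_mul
    (hb.lim' j).memLp).sub
    ((memLp_continuous_mul hΩo hΩ (ha.lim' j).memLp hξ.continuous).integrable_mul
    (hb.lim' k).memLp)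
  have h2 := ha.lim.memLp.integrable_mul
    ((memLp_continuous_mul hΩo hΩ (hb.lim' j).memLp (continuous_partialDeriv hξ k)).sub
    (memLp_continuous_mul hΩo hΩ (hb.lim' k).memLp (continuous_partialDeriv hξ j)))
  refine (h1.add h2).congr (ae_of_all _ fun x => ?_)
  simp only [Pi.add_apply, Pi.sub_apply, Pi.mul_apply]
  ring

/-- The bracket is a null Lagrangian. -/
theorem integral_bracket_eq_zero (hΩo : IsOpen Ω) (hΩ : Bornology.IsBounded Ω)
    (hc : Convex ℝ Ω) (ha : H1Lim Ω φ a a') (hb : H1Lim Ω ψ b b') {ξ : (𝔼 d) → ℝ}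
    (hξ : ContDiff ℝ ∞ ξ) (hs : tsupport ξ ⊆ Ω) :
    ∫ x in Ω, (ξ x * (a' k x * b' j x - a' j x * b' k x) +
      a x * (partialDeriv k ξ x * b' j x - partialDeriv j ξ x * b' k x)) = 0 := by
  have hξa := ha.smooth_mul hΩo hΩ hξ
  have hbk := L2Lim.const (hb.lim' k).memLp
  have hbj := L2Lim.const (hb.lim' j).memLp
  -- The integrand is `∂ₖ(ξa) ∂ⱼb - ∂ⱼ(ξa) ∂ₖb`; for a smooth first factor it integrates to zero by
  -- equality of mixed derivatives.
  have l := (hbj.integral_mul (hξa.lim' k)).sub (hbk.integral_mul (hξa.lim' j))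
  have hz : ∀ n, (∫ x in Ω, b' j x * partialDeriv k (fun x => ξ x * φ n x) x) -
      ∫ x in Ω, b' k x * partialDeriv j (fun x => ξ x * φ n x) x = 0 := by
    intro n
    have hζ : ContDiff ℝ ∞ fun x => ξ x * φ n x := hξ.mul (ha.contDiff n)
    have hζs : tsupport (fun x => ξ x * φ n x) ⊆ Ω := (tsupport_mul_subset_left).trans hs
    have h1 := integral_interior_eq_zero hΩo hΩ hc j hb (contDiff_partialDeriv hζ k)
      ((tsupport_partialDeriv_subset k).trans hζs)
    have h2 := integral_interior_eq_zero hΩo hΩ hc k hb (contDiff_partialDeriv hζ j)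
      ((tsupport_partialDeriv_subset j).trans hζs)
    rw [partialDeriv_comm hζ k j] at h2
    linarith
  have l0 := tendsto_nhds_unique l (tendsto_const_nhds.congr fun n => (hz n).symm)
  rw [← integral_sub] at l0
  · rw [← l0]
    refine integral_congr_ae (ae_of_all _ fun x => ?_)
    ring
  · exact (hb.lim' j).memLp.integrable_mul (hξa.lim' k).memLp
  · exact (hb.lim' k).memLp.integrable_mul (hξa.lim' j).memLp

/-- Extends the normality condition by density, so that it can be tested with functions built from
`p` and `q` themselves. -/
theorem IsMixedField.integral_normal (h : IsMixedField Ω k j c p q p' q') (ha : H1Lim Ω φ a a')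
    (hs : ∀ n, ∀ x ∈ frontier Ω, x k = c → x ∉ tsupport (φ n)) :
    Integrable (fun x => q x * a' k x - p x * a' j x) (volume.restrict Ω) ∧
      ∫ x in Ω, (q x * a' k x - p x * a' j x) = 0 := by
  obtain ⟨P, hp⟩ := h.lim_fst
  obtain ⟨Q, hq⟩ := h.lim_snd
  have i1 := hq.lim.memLp.integrable_mul (ha.lim' k).memLp
  have i2 := hp.lim.memLp.integrable_mul (ha.lim' j).memLp
  refine ⟨i1.sub i2, ?_⟩
  refine (integral_sub i1 i2).trans ?_
  have l := ((L2Lim.const hq.lim.memLp).integral_mul (ha.lim' k)).sub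
    ((L2Lim.const hp.lim.memLp).integral_mul (ha.lim' j))
  exact tendsto_nhds_unique l (tendsto_const_nhds.congr fun n =>
    (h.normal (φ n) (ha.contDiff n) (hs n)).symm)

theorem IsMixedField.memLp (h : IsMixedField Ω k j c p q p' q') :
    (MemLp p 2 (volume.restrict Ω) ∧ ∀ i, MemLp (p' i) 2 (volume.restrict Ω)) ∧
      MemLp q 2 (volume.restrict Ω) ∧ ∀ i, MemLp (q' i) 2 (volume.restrict Ω) := by
  obtain ⟨P, hp⟩ := h.lim_fst
  obtain ⟨Q, hq⟩ := h.lim_snd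
  exact ⟨⟨hp.lim.memLp, fun i => (hp.lim' i).memLp⟩, hq.lim.memLp, fun i => (hq.lim' i).memLp⟩

theorem IsMixedField.integrable_bracketDensity (hΩo : IsOpen Ω) (hΩ : Bornology.IsBounded Ω)
    (h : IsMixedField Ω k j c p q p' q') (hχ : ContDiff ℝ ∞ χ) :
    Integrable (bracketDensity k j p q p' q' χ) (volume.restrict Ω) := by
  obtain ⟨P, hp⟩ := h.lim_fst
  obtain ⟨Q, hq⟩ := h.lim_snd
  refine ((hp.integrable_bracket (k := k) (j := j) hΩo hΩ hq hχ).sub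
    (hq.integrable_bracket (k := k) (j := j) hΩo hΩ hp hχ)).congr (ae_of_all _ fun x => ?_)
  simp only [Pi.sub_apply, bracketDensity]
  ring

/-- The derivative of `b` along the field `(q, -p)`, localized by `χ`. -/
def flux (k j : Fin d) (p q : (𝔼 d) → ℝ) (χ b : (𝔼 d) → ℝ) (b' : Fin d → (𝔼 d) → ℝ)
    (x : 𝔼 d) : ℝ :=
  χ x * (q x * b' k x - p x * b' j x) +
    (partialDeriv k χ x * q x - partialDeriv j χ x * p x) * b x

theorem integrable_flux (hΩo : IsOpen Ω) (hΩ : Bornology.IsBounded Ω)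
    (hp : MemLp p 2 (volume.restrict Ω)) (hq : MemLp q 2 (volume.restrict Ω))
    (hχ : ContDiff ℝ ∞ χ) (hb : MemLp b 2 (volume.restrict Ω))
    (hb' : ∀ i, MemLp (b' i) 2 (volume.restrict Ω)) :
    Integrable (flux k j p q χ b b') (volume.restrict Ω) := by
  have h1 := ((memLp_continuous_mul hΩo hΩ hq hχ.continuous).integrable_mul
    (hb' k)).sub ((memLp_continuous_mul hΩo hΩ hp hχ.continuous).integrable_mul (hb' j))
  have h2 := ((memLp_continuous_mul hΩo hΩ hq (continuous_partialDeriv hχ k)).sub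
    (memLp_continuous_mul hΩo hΩ hp (continuous_partialDeriv hχ j))).integrable_mul hb
  refine (h1.add h2).congr (ae_of_all _ fun x => ?_)
  simp only [Pi.add_apply, Pi.sub_apply, Pi.mul_apply, flux]
  ring

theorem Integrable.continuous_mul (hΩo : IsOpen Ω) (hΩ : Bornology.IsBounded Ω)
    {f g : (𝔼 d) → ℝ} (hf : Integrable f (volume.restrict Ω)) (hg : Continuous g) :
    Integrable (fun x => g x * f x) (volume.restrict Ω) := by
  obtain ⟨C, hC⟩ := exists_bound_of_continuous hΩ hg
  exact hf.bdd_mul hg.aestronglyMeasurable (by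
    filter_upwards [ae_restrict_mem hΩo.measurableSet] with x hx using hC x hx)

/-- Test normality with `χ (q ∂ₖΦ - p ∂ⱼΦ)`. The result is the flux expression plus `χ` times the
Hessian of `Φ` at `(q, -p)`. The sum integrates to zero and the Hessian term is nonpositive; this is
the only place where convexity enters as a sign. -/
theorem IsMixedField.flux_nonneg_of_concave (hΩo : IsOpen Ω) (hΩ : Bornology.IsBounded Ω)
    (h : IsMixedField Ω k j c p q p' q') (hχ : ContDiff ℝ ∞ χ) (hχ0 : ∀ x, 0 ≤ χ x)
    (hs : ∀ x ∈ frontier Ω, x k = c → x ∉ tsupport χ) {Φ : (𝔼 d) → ℝ}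
    (hΦ : ContDiff ℝ ∞ Φ) (hΦc : ConcaveOn ℝ Set.univ Φ) :
    0 ≤ ∫ x in Ω, (partialDeriv k Φ x * flux k j p q χ q q' x -
      partialDeriv j Φ x * flux k j p q χ p p' x) := by
  obtain ⟨⟨hp2, hp2'⟩, hq2, hq2'⟩ := h.memLp
  obtain ⟨P, hp⟩ := h.lim_fst
  obtain ⟨Q, hq⟩ := h.lim_snd
  have hΦk := contDiff_partialDeriv hΦ k
  have hΦj := contDiff_partialDeriv hΦ j
  obtain ⟨hi, h0⟩ := h.integral_normal ((hq.smooth_mul hΩo hΩ (hχ.mul hΦk)).sub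
    (hp.smooth_mul hΩo hΩ (hχ.mul hΦj))) fun n x hx hxc hmem => hs x hx hxc (by
      refine (closure_mono ?_ : tsupport _ ⊆ tsupport χ) hmem
      intro y hy hy0
      apply hy
      simp [hy0])
  rw [← h0]
  refine integral_mono hi
    ((Integrable.continuous_mul hΩo hΩ (integrable_flux hΩo hΩ hp2 hq2 hχ hq2 hq2')
      hΦk.continuous).sub
      (Integrable.continuous_mul hΩo hΩ (integrable_flux hΩo hΩ hp2 hq2 hχ hp2 hp2')
        hΦj.continuous)) fun x => ?_
  have hH := mul_nonpos_of_nonneg_of_nonpos (hχ0 x) (hessian_nonpos hΦ hΦc k j (q x) (p x) x)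
  simp only [partialDeriv_mul hχ hΦk, partialDeriv_mul hχ hΦj, flux,
    partialDeriv_comm hΦ j k] at *
  linarith

/-- For a test function `Θ` supported in `Ω` no boundary is seen: combine the null Lagrangian
identities for `(p, q)` and `(q, p)` with weight `χΘ`, and normality tested with `Θ (∂ₖχ q - ∂ⱼχ
p)`. With `∂ⱼp = ∂ₖq` the rest is pointwise algebra. -/
theorem IsMixedField.flux_eq_of_test (hΩo : IsOpen Ω) (hΩ : Bornology.IsBounded Ω)
    (hc : Convex ℝ Ω) (h : IsMixedField Ω k j c p q p' q') (hχ : ContDiff ℝ ∞ χ)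
    {κ' : Fin d → (𝔼 d) → ℝ} {K : ℕ → (𝔼 d) → ℝ}
    (hκ : H1Lim Ω K (fun x => partialDeriv k χ x * q x - partialDeriv j χ x * p x) κ')
    {Θ : (𝔼 d) → ℝ} (hΘ : ContDiff ℝ ∞ Θ) (hΘs : tsupport Θ ⊆ Ω) :
    ∫ x in Ω, (partialDeriv k Θ x * flux k j p q χ q q' x -
      partialDeriv j Θ x * flux k j p q χ p p' x) =
    ∫ x in Ω, Θ x * (bracketDensity k j p q p' q' χ x - (q x * κ' k x - p x * κ' j x)) := by
  obtain ⟨⟨hp2, hp2'⟩, hq2, hq2'⟩ := h.memLp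
  obtain ⟨P, hp⟩ := h.lim_fst
  obtain ⟨Q, hq⟩ := h.lim_snd
  have hξ : ContDiff ℝ ∞ fun x => χ x * Θ x := hχ.mul hΘ
  have hξs : tsupport (fun x => χ x * Θ x) ⊆ Ω := tsupport_mul_subset_right.trans hΘs
  have h1 := integral_bracket_eq_zero (k := k) (j := j) hΩo hΩ hc hp hq hξ hξs
  have h2 := integral_bracket_eq_zero (k := k) (j := j) hΩo hΩ hc hq hp hξ hξs
  obtain ⟨i3, h3⟩ := h.integral_normal (hκ.smooth_mul hΩo hΩ hΘ)
    fun n x hx _ hmem => (hΩo.frontier_eq ▸ hx).2 (hΘs (tsupport_mul_subset_left hmem))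
  have i1 := hp.integrable_bracket (k := k) (j := j) hΩo hΩ hq hξ
  have i2 := hq.integrable_bracket (k := k) (j := j) hΩo hΩ hp hξ
  have iκ := (hq2.integrable_mul (hκ.lim' k).memLp).sub (hp2.integrable_mul (hκ.lim' j).memLp)
  have iW := Integrable.continuous_mul hΩo hΩ
    ((h.integrable_bracketDensity hΩo hΩ hχ).sub iκ) hΘ.continuous
  have iF := (Integrable.continuous_mul hΩo hΩ (integrable_flux (k := k) (j := j) hΩo hΩ hp2 hq2
    hχ hq2 hq2') (continuous_partialDeriv hΘ k)).sub
      (Integrable.continuous_mul hΩo hΩ (integrable_flux (k := k) (j := j) hΩo hΩ hp2 hq2 hχ hp2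
        hp2') (continuous_partialDeriv hΘ j))
  rw [← sub_eq_zero]
  refine (integral_sub iF iW).symm.trans ?_
  have e2 : ∫ x in Ω, -((((fun x => (χ x * Θ x) * (p' k x * q' j x - p' j x * q' k x) +
      p x * (partialDeriv k (fun x => χ x * Θ x) x * q' j x -
        partialDeriv j (fun x => χ x * Θ x) x * q' k x)) -
      fun x => (χ x * Θ x) * (q' k x * p' j x - q' j x * p' k x) +
      q x * (partialDeriv k (fun x => χ x * Θ x) x * p' j x -
        partialDeriv j (fun x => χ x * Θ x) x * p' k x)) - fun x => q x * (partialDeriv k Θ x *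
          (partialDeriv k χ x * q x - partialDeriv j χ x * p x) + Θ x * κ' k x) -
          p x * (partialDeriv j Θ x * (partialDeriv k χ x * q x - partialDeriv j χ x * p x) +
          Θ x * κ' j x)) x) = 0 := by
    rw [integral_neg, integral_sub' (i1.sub i2) i3, integral_sub' i1 i2, h1, h2, h3]
    simp
  rw [← e2]
  refine integral_congr_ae ?_
  filter_upwards [h.symm] with x hx
  simp only [Pi.sub_apply, Pi.mul_apply, partialDeriv_mul hχ hΘ, flux, bracketDensity, hx]
  ring

/-- Off the face the boundary contribution has a sign, because the boundary is convex. -/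
theorem IsMixedField.bracket_nonneg_of_tsupport (hΩo : IsOpen Ω) (hΩ : Bornology.IsBounded Ω)
    (hc : Convex ℝ Ω) (hne : Ω.Nonempty) (h : IsMixedField Ω k j c p q p' q')
    (hχ : ContDiff ℝ ∞ χ) (hχ0 : ∀ x, 0 ≤ χ x)
    (hs : ∀ x ∈ frontier Ω, x k = c → x ∉ tsupport χ) :
    0 ≤ ∫ x in Ω, bracketDensity k j p q p' q' χ x := by
  obtain ⟨⟨hp2, hp2'⟩, hq2, hq2'⟩ := h.memLp
  obtain ⟨P, hp⟩ := h.lim_fst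
  obtain ⟨Q, hq⟩ := h.lim_snd
  have hκ := (hq.smooth_mul hΩo hΩ (contDiff_partialDeriv hχ k)).sub
    (hp.smooth_mul hΩo hΩ (contDiff_partialDeriv hχ j))
  obtain ⟨iκ, h0⟩ := h.integral_normal hκ fun n x hx hxc hmem => hs x hx hxc (by
      refine closure_minimal ?_ (isClosed_tsupport χ) hmem
      intro y hy
      by_contra hy0
      apply hy
      simp [partialDeriv_eq_zero hy0])
  set κ' := fun i x => (partialDeriv i (partialDeriv k χ) x * q x + partialDeriv k χ x * q' i x) -
    (partialDeriv i (partialDeriv j χ) x * p x + partialDeriv j χ x * p' i x) with hκ'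
  have iB := h.integrable_bracketDensity hΩo hΩ hχ
  have iW := iB.sub iκ
  have fq := integrable_flux (k := k) (j := j) hΩo hΩ hp2 hq2 hχ hq2 hq2'
  have fp := integrable_flux (k := k) (j := j) hΩo hΩ hp2 hq2 hχ hp2 hp2'
  have hae := ae_restrict_mem (μ := volume) hΩo.measurableSet
  obtain ⟨φ, hφ, hφl⟩ := exists_concave_cutoff hΩo hc hne
  have hφm : ∀ n, AEStronglyMeasurable (φ n) (volume.restrict Ω) := fun n =>
    let ⟨_, hL⟩ := (hφ n).1
    hL.continuous.aestronglyMeasurable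
  have key : ∀ n, 0 ≤ ∫ x in Ω, φ n x * (bracketDensity k j p q p' q' χ x -
      (q x * κ' k x - p x * κ' j x)) := by
    intro n
    obtain ⟨⟨L, hL⟩, hconc, h1, hpos⟩ := hφ n
    obtain ⟨Φ, Θ, hΦ, hΦc, hΘ, hΘs, hΘ1, hΘl, hb, hl⟩ := exists_concave_approx hL hconc h1 hpos
    -- Replacing the concave function by the test function costs nothing in the limit, as the
    -- difference of gradients is bounded and tends to zero on `Ω`. So the inequality for `Φ` passes
    -- to the identity for `Θ`.
    have t1 : Tendsto (fun m => ∫ x in Ω,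
        ((partialDeriv k (Φ m) x - partialDeriv k (Θ m) x) * flux k j p q χ q q' x -
          (partialDeriv j (Φ m) x - partialDeriv j (Θ m) x) * flux k j p q χ p p' x)) atTop
        (𝓝 0) := by
      rw [← integral_zero (𝔼 d) ℝ (μ := volume.restrict Ω)]
      refine tendsto_integral_of_dominated_convergence
        (fun x => L * ‖flux k j p q χ q q' x‖ + L * ‖flux k j p q χ p p' x‖) (fun m => ?_)
        ((fq.norm.const_mul _).add (fp.norm.const_mul _)) (fun m => ae_of_all _ fun x => ?_) ?_
      · exact ((((continuous_partialDeriv (hΦ m) k).sub (continuous_partialDeriv (hΘ m)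
          k)).aestronglyMeasurable.mul fq.1).sub (((continuous_partialDeriv (hΦ m) j).sub
          (continuous_partialDeriv (hΘ m) j)).aestronglyMeasurable.mul fp.1))
      · refine (norm_sub_le _ _).trans (add_le_add ?_ ?_) <;> rw [norm_mul] <;>
          exact mul_le_mul_of_nonneg_right (hb _ m x) (norm_nonneg _)
      · filter_upwards [hae] with x hx
        simpa using ((hl k x hx).mul_const (flux k j p q χ q q' x)).sub
          ((hl j x hx).mul_const (flux k j p q χ p p' x))
    have t2 : Tendsto (fun m => ∫ x in Ω, Θ m x * (bracketDensity k j p q p' q' χ x -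
        (q x * κ' k x - p x * κ' j x))) atTop (𝓝 (∫ x in Ω, φ n x *
          (bracketDensity k j p q p' q' χ x - (q x * κ' k x - p x * κ' j x)))) := by
      refine tendsto_integral_of_dominated_convergence _
        (fun m => (hΘ m).continuous.aestronglyMeasurable.mul iW.1) iW.norm
        (fun m => ae_of_all _ fun x => ?_) ?_
      · rw [norm_mul]
        exact mul_le_of_le_one_left (norm_nonneg _) (hΘ1 m x)
      · filter_upwards [hae] with x hx
        exact (hΘl x hx).mul_const _
    have t := t1.add t2
    rw [zero_add] at t
    refine ge_of_tendsto' t fun m => ?_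
    have hi : ∀ {F : (𝔼 d) → ℝ}, ContDiff ℝ ∞ F → Integrable (fun x => partialDeriv k F x *
        flux k j p q χ q q' x - partialDeriv j F x * flux k j p q χ p p' x)
        (volume.restrict Ω) := fun hF =>
      (Integrable.continuous_mul hΩo hΩ fq (continuous_partialDeriv hF k)).sub
        (Integrable.continuous_mul hΩo hΩ fp (continuous_partialDeriv hF j))
    rw [← h.flux_eq_of_test hΩo hΩ hc hχ hκ (hΘ m) (hΘs m)]
    have e : (fun x => (partialDeriv k (Φ m) x - partialDeriv k (Θ m) x) * flux k j p q χ q q' x -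
        (partialDeriv j (Φ m) x - partialDeriv j (Θ m) x) * flux k j p q χ p p' x) = fun x =>
        (partialDeriv k (Φ m) x * flux k j p q χ q q' x -
          partialDeriv j (Φ m) x * flux k j p q χ p p' x) -
        (partialDeriv k (Θ m) x * flux k j p q χ q q' x -
          partialDeriv j (Θ m) x * flux k j p q χ p p' x) := by
      ext x; ring
    rw [e, integral_sub (hi (hΦ m)) (hi (hΘ m)), sub_add_cancel]
    exact h.flux_nonneg_of_concave hΩo hΩ hχ hχ0 hs (hΦ m) (hΦc m)
  -- Now the concave weight itself increases to one on `Ω`.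
  have t : Tendsto (fun n => ∫ x in Ω, φ n x * (bracketDensity k j p q p' q' χ x -
      (q x * κ' k x - p x * κ' j x))) atTop (𝓝 (∫ x in Ω, (bracketDensity k j p q p' q' χ x -
      (q x * κ' k x - p x * κ' j x)))) := by
    refine tendsto_integral_of_dominated_convergence _ (fun n => (hφm n).mul iW.1) iW.norm
      (fun n => ?_) ?_
    · filter_upwards [hae] with x hx
      obtain ⟨-, -, h1, hpos⟩ := hφ n
      rw [norm_mul, Real.norm_of_nonneg ((hpos x).2 hx).le]
      exact mul_le_of_le_one_left (norm_nonneg _) (h1 x)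
    · filter_upwards [hae] with x hx
      simpa using (hφl x hx).mul_const (bracketDensity k j p q p' q' χ x -
        (q x * κ' k x - p x * κ' j x))
  have := ge_of_tendsto' t key
  -- The remaining term with derivatives of `∂ₖχ q - ∂ⱼχ p` vanishes, by normality tested with that
  -- function.
  rwa [integral_sub iB iκ, h0, sub_zero] at this

end Bracket

end

/-! ### Combining the face with the rest of the boundary, away from the edge. -/

section

variable {d : ℕ} {Ω : Set (𝔼 d)}

section Away

variable {k j : Fin d} {c : ℝ} {p q : (𝔼 d) → ℝ} {p' q' : Fin d → (𝔼 d) → ℝ} {χ : (𝔼 d) → ℝ}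

/-- The flat face does not contribute to the boundary integral. -/
theorem IsMixedField.bracket_eq_zero_of_face (hΩo : IsOpen Ω) (hΩ : Bornology.IsBounded Ω)
    (hc : Convex ℝ Ω) (hmiss : ∀ x ∈ Ω, x k ≠ c) (hjk : j ≠ k)
    (h : IsMixedField Ω k j c p q p' q') (hχ : ContDiff ℝ ∞ χ)
    (h0 : ∀ x ∈ frontier Ω, x k ≠ c → χ x = 0) :
    ∫ x in Ω, bracketDensity k j p q p' q' χ x = 0 := by
  obtain ⟨P, hp⟩ := h.lim_fst
  obtain ⟨Q, hq⟩ := h.lim_snd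
  obtain ⟨w, v, hw, hv, hwv, hwp, hvq⟩ := h.face
  obtain ⟨ν, s, hν⟩ := exists_isFaceMeasure hΩo hΩ hc k hmiss
  have hwv' : ∀ᵐ x ∂ν, w x ≠ 0 ∨ v x ≠ 0 :=
    (Measure.absolutelyContinuous_of_le hν.le).ae_le hwv
  -- The roles of `p` and `q` are interchanged once; the density is the difference of the two
  -- integrands.
  have h1 := face_integral_eq_zero hΩo hΩ hc hmiss hjk hν hp hq hw hv hwv' hwp hvq hχ h0
  have h2 := face_integral_eq_zero hΩo hΩ hc hmiss hjk hν hq hp hv hw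
    (hwv'.mono fun _ => Or.symm) hvq hwp hχ h0
  have i1 := hp.integrable_bracket (k := k) (j := j) hΩo hΩ hq hχ
  have i2 := hq.integrable_bracket (k := k) (j := j) hΩo hΩ hp hχ
  have e := integral_sub i1 i2
  rw [h1, h2, sub_zero] at e
  rw [← e]
  refine integral_congr_ae (ae_of_all _ fun x => ?_)
  simp only [bracketDensity]
  ring

theorem exists_contDiff_eventually_one {A B : Set (𝔼 d)} (hA : IsClosed A) (hB : IsClosed B)
    (hAB : Disjoint A B) : ∃ θ : (𝔼 d) → ℝ, ContDiff ℝ ∞ θ ∧ (∀ x, θ x ∈ Set.Icc (0 : ℝ) 1) ∧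
      (∀ x ∈ A, ∀ᶠ y in 𝓝 x, θ y = 1) ∧ ∀ x ∈ B, θ x = 0 := by
  obtain ⟨U, hU, hAU, hUB⟩ := normal_exists_closure_subset hA hB.isOpen_compl
    (Set.subset_compl_iff_disjoint_right.2 hAB)
  obtain ⟨θ, h1, h2, h3, h4⟩ := exists_contMDiff_zero_iff_one_iff_of_isClosed
    (modelWithCornersSelf ℝ (𝔼 d)) hB (isClosed_closure (s := U))
    (Set.disjoint_left.2 fun x hx hxU => hUB hxU hx) (n := ⊤)
  refine ⟨θ, h1.contDiff, fun x => h2 ⟨x, rfl⟩, fun x hx => ?_, fun x hx => (h3 x).1 hx⟩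
  filter_upwards [hU.mem_nhds (hAU hx)] with y hy using (h4 y).1 (subset_closure hy)

/-- Away from the edge of the flat face the bracket has nonnegative integral. -/
theorem IsMixedField.bracket_nonneg (hΩo : IsOpen Ω) (hΩ : Bornology.IsBounded Ω)
    (hc : Convex ℝ Ω) (hne : Ω.Nonempty) (hmiss : ∀ x ∈ Ω, x k ≠ c) (hjk : j ≠ k)
    (h : IsMixedField Ω k j c p q p' q') (hχ : ContDiff ℝ ∞ χ) (hχ0 : ∀ x, 0 ≤ χ x)
    (hs : ∀ x ∈ frontier Ω, x k = c → x ∈ closure (frontier Ω ∩ {y | y k ≠ c}) →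
      x ∉ tsupport χ) :
    0 ≤ ∫ x in Ω, bracketDensity k j p q p' q' χ x := by
  set A := tsupport χ ∩ (frontier Ω ∩ {y | y k = c}) with hA
  set B := tsupport χ ∩ closure (frontier Ω ∩ {y | y k ≠ c}) with hB
  have hAc : IsClosed A := (isClosed_tsupport χ).inter
    (isClosed_frontier.inter (isClosed_eq (by fun_prop) continuous_const))
  have hBc : IsClosed B := (isClosed_tsupport χ).inter isClosed_closure
  -- On the support of `χ` the face and the rest of the boundary are disjoint closed sets, because
  -- the edge is avoided. A smooth `θ` splits `χ` into one piece for each; being one in a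
  -- neighbourhood of the face, it keeps the support of the second piece off the face.
  obtain ⟨θ, hθ, hθI, hθA, hθB⟩ := exists_contDiff_eventually_one hAc hBc
    (Set.disjoint_left.2 fun x hx hx' => hs x hx.2.1 hx.2.2 hx'.2 hx.1)
  have hθ' : ContDiff ℝ ∞ fun x => 1 - θ x := contDiff_const.sub hθ
  have hχ1 : ContDiff ℝ ∞ fun x => χ x * θ x := hχ.mul hθ
  have hχ2 : ContDiff ℝ ∞ fun x => χ x * (1 - θ x) := hχ.mul hθ'
  have h1 := h.bracket_eq_zero_of_face hΩo hΩ hc hmiss hjk hχ1 fun x hx hxc => by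
    by_cases hxt : x ∈ tsupport χ
    · rw [hθB x ⟨hxt, subset_closure ⟨hx, hxc⟩⟩, mul_zero]
    · rw [image_eq_zero_of_notMem_tsupport hxt, zero_mul]
  have h2 := h.bracket_nonneg_of_tsupport hΩo hΩ hc hne hχ2
    (fun x => mul_nonneg (hχ0 x) (by linarith [(hθI x).2])) fun x hx hxc hxt => by
      have hxA : x ∈ A := ⟨tsupport_mul_subset_left hxt, hx, hxc⟩
      refine notMem_tsupport_iff_eventuallyEq.2 ?_ hxt
      filter_upwards [hθA x hxA] with y hy
      simp [hy]
  have e := integral_add (h.integrable_bracketDensity hΩo hΩ hχ1)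
    (h.integrable_bracketDensity hΩo hΩ hχ2)
  rw [h1, zero_add] at e
  rw [← e] at h2
  refine h2.trans_eq (integral_congr_ae (ae_of_all _ fun x => ?_))
  have e2 : χ = fun x => χ x * θ x + χ x * (1 - θ x) := by ext x; ring
  have e3 : ∀ i, partialDeriv i χ x = partialDeriv i (fun x => χ x * θ x) x +
      partialDeriv i (fun x => χ x * (1 - θ x)) x := by
    intro i
    conv_lhs => rw [e2, partialDeriv_add hχ1 hχ2]
  simp only [bracketDensity, e3]
  ring

end Away

end

/-! ### The logarithmic estimate at a planar corner. -/

section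

section OneDim

/-- Weighted Cauchy-Schwarz inequality. -/
theorem sq_intervalIntegral_le {a b : ℝ} (hab : a ≤ b) {h ρ : ℝ → ℝ} (hh : Continuous h)
    (hρ : Continuous ρ) (hρ0 : ∀ t ∈ Set.Icc a b, 0 < ρ t) :
    (∫ t in a..b, h t) ^ 2 ≤ (∫ t in a..b, (ρ t)⁻¹) * ∫ t in a..b, ρ t * h t ^ 2 := by
  have hinv : ContinuousOn (fun t => (ρ t)⁻¹) (Set.uIcc a b) := by
    rw [Set.uIcc_of_le hab]
    exact hρ.continuousOn.inv₀ fun t ht => (hρ0 t ht).ne'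
  have i1 : IntervalIntegrable (fun t => (ρ t)⁻¹) volume a b := hinv.intervalIntegrable
  have i2 : IntervalIntegrable h volume a b := hh.intervalIntegrable a b
  have i3 : IntervalIntegrable (fun t => ρ t * h t ^ 2) volume a b :=
    (hρ.mul (hh.pow 2)).intervalIntegrable a b
  -- This quadratic polynomial in `c` is the integral of `ρ⁻¹ (c - ρh)²`; its discriminant is
  -- nonpositive.
  have key : ∀ c : ℝ, 0 ≤ (∫ t in a..b, (ρ t)⁻¹) * (c * c) + (-2 * ∫ t in a..b, h t) * c +
      ∫ t in a..b, ρ t * h t ^ 2 := by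
    intro c
    have e : (∫ t in a..b, (ρ t)⁻¹) * (c * c) + (-2 * ∫ t in a..b, h t) * c +
        ∫ t in a..b, ρ t * h t ^ 2 =
        ∫ t in a..b, ((ρ t)⁻¹ * (c * c) + h t * (-2 * c) + ρ t * h t ^ 2) := by
      rw [intervalIntegral.integral_add ((i1.mul_const _).add (i2.mul_const _)) i3,
        intervalIntegral.integral_add (i1.mul_const _) (i2.mul_const _),
        intervalIntegral.integral_mul_const, intervalIntegral.integral_mul_const]
      ring
    rw [e]
    refine intervalIntegral.integral_nonneg hab fun t ht => ?_
    have h0 := hρ0 t ht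
    have : (ρ t)⁻¹ * (c * c) + h t * (-2 * c) + ρ t * h t ^ 2 = (ρ t)⁻¹ * (c - ρ t * h t) ^ 2 := by
      field_simp
      ring
    rw [this]
    positivity
  have := discrim_le_zero key
  simp only [discrim] at this
  nlinarith

theorem sq_sub_le_of_hasDerivAt {a b K : ℝ} (hab : a ≤ b) {f f' h ρ : ℝ → ℝ}
    (hf : ∀ t, HasDerivAt f (f' t) t) (hf' : Continuous f') (hh : Continuous h)
    (hle : ∀ t, |f' t| ≤ K * h t) (hρ : Continuous ρ) (hρ0 : ∀ t ∈ Set.Icc a b, 0 < ρ t) :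
    f a ^ 2 ≤ 2 * f b ^ 2 +
      2 * (K ^ 2 * (∫ t in a..b, (ρ t)⁻¹)) * ∫ t in a..b, ρ t * h t ^ 2 := by
  have h1 : f b - f a = ∫ t in a..b, f' t :=
    (intervalIntegral.integral_eq_sub_of_hasDerivAt (fun t _ => hf t)
      (hf'.intervalIntegrable a b)).symm
  have h2 : |f b - f a| ≤ K * ∫ t in a..b, h t := by
    rw [h1, ← intervalIntegral.integral_const_mul]
    refine (intervalIntegral.abs_integral_le_integral_abs hab).trans ?_
    exact intervalIntegral.integral_mono_on hab (hf'.abs.intervalIntegrable a b)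
      ((hh.const_mul K).intervalIntegrable a b) fun t _ => hle t
  have h3 := sq_intervalIntegral_le hab hh hρ hρ0
  have h4 : (f b - f a) ^ 2 ≤ K ^ 2 * (∫ t in a..b, h t) ^ 2 := by
    rw [← mul_pow, ← sq_abs]
    exact pow_le_pow_left₀ (abs_nonneg _) h2 2
  have h5 := mul_le_mul_of_nonneg_left h3 (sq_nonneg K)
  -- Uses `f(a)² ≤ 2 f(b)² + 2 (f(b) - f(a))²`, whose defect is `(2 f(b) - f(a))²`.
  nlinarith [sq_nonneg (2 * f b - f a)]

end OneDim

section Segments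

variable {E : Type*} [NormedAddCommGroup E] [NormedSpace ℝ E] {F : E → ℝ}

/-- The square of a function, as an extended nonnegative number. -/
def sqE (F : E → ℝ) (x : E) : ENNReal := ENNReal.ofReal (F x ^ 2)

/-- The squared norm of the derivative, as an extended nonnegative number. -/
def gradE (F : E → ℝ) (x : E) : ENNReal := ENNReal.ofReal (‖fderiv ℝ F x‖ ^ 2)

theorem continuous_sqE (hF : ContDiff ℝ ∞ F) : Continuous (sqE F) :=
  ENNReal.continuous_ofReal.comp (hF.continuous.pow 2)

theorem continuous_gradE (hF : ContDiff ℝ ∞ F) : Continuous (gradE F) :=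
  ENNReal.continuous_ofReal.comp ((hF.continuous_fderiv (by simp)).norm.pow 2)

theorem sqE_le_line (hF : ContDiff ℝ ∞ F) {a b K : ℝ} (hab : a ≤ b) (x v : E) (hv : ‖v‖ ≤ K)
    {ρ : ℝ → ℝ} (hρ : Continuous ρ) (hρ0 : ∀ t ∈ Set.Icc a b, 0 < ρ t) :
    sqE F (x + a • v) ≤ 2 * sqE F (x + b • v) +
      2 * ENNReal.ofReal (K ^ 2 * ∫ t in a..b, (ρ t)⁻¹) *
        ∫⁻ t in Set.Ioc a b, ENNReal.ofReal (ρ t) * gradE F (x + t • v) := by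
  have hline : Continuous fun t : ℝ => x + t • v := by fun_prop
  have hc := (hF.continuous_fderiv (by simp)).comp hline
  have hd : ∀ t : ℝ, HasDerivAt (fun t : ℝ => F (x + t • v)) (fderiv ℝ F (x + t • v) v) t := by
    intro t
    have h1 : HasDerivAt (fun r : ℝ => x + r • v) v t := by
      simpa using ((hasDerivAt_id t).smul_const v).const_add x
    exact ((hF.differentiable (by simp)) (x + t • v)).hasFDerivAt.comp_hasDerivAt t h1
  have hcont : Continuous fun t => ρ t * ‖fderiv ℝ F (x + t • v)‖ ^ 2 := hρ.mul (hc.norm.pow 2)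
  have hinv0 : 0 ≤ ∫ t in a..b, (ρ t)⁻¹ :=
    intervalIntegral.integral_nonneg hab fun t ht => (inv_pos.2 (hρ0 t ht)).le
  have hpos0 : 0 ≤ ∫ t in a..b, ρ t * ‖fderiv ℝ F (x + t • v)‖ ^ 2 :=
    intervalIntegral.integral_nonneg hab fun t ht => mul_nonneg (hρ0 t ht).le (sq_nonneg _)
  have h := sq_sub_le_of_hasDerivAt hab hd (hc.clm_apply continuous_const) hc.norm
    (fun t => by
      refine ((fderiv ℝ F (x + t • v)).le_opNorm v).trans ?_
      rw [mul_comm]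
      exact mul_le_mul_of_nonneg_right hv (norm_nonneg _)) hρ hρ0
  have e : ENNReal.ofReal (∫ t in a..b, ρ t * ‖fderiv ℝ F (x + t • v)‖ ^ 2) =
      ∫⁻ t in Set.Ioc a b, ENNReal.ofReal (ρ t) * gradE F (x + t • v) := by
    rw [intervalIntegral.integral_of_le hab, ofReal_integral_eq_lintegral_ofReal]
    · refine setLIntegral_congr_fun measurableSet_Ioc fun t ht => ?_
      exact ENNReal.ofReal_mul (hρ0 t (Set.Ioc_subset_Icc_self ht)).le
    · exact (hcont.intervalIntegrable a b).1
    · filter_upwards [ae_restrict_mem measurableSet_Ioc] with t ht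
      exact mul_nonneg (hρ0 t (Set.Ioc_subset_Icc_self ht)).le (sq_nonneg _)
  rw [← e]
  refine (ENNReal.ofReal_le_ofReal h).trans_eq ?_
  rw [ENNReal.ofReal_add (by positivity) (by positivity), ENNReal.ofReal_mul (by norm_num),
    ENNReal.ofReal_mul (by positivity), ENNReal.ofReal_mul (by norm_num)]
  simp [sqE]

theorem sqE_le_segment (hF : ContDiff ℝ ∞ F) (x y : E) {K : ℝ} (hK : ‖y - x‖ ≤ K) :
    sqE F x ≤ 2 * sqE F y + 2 * ENNReal.ofReal (K ^ 2) *
      ∫⁻ t in Set.Ioc (0 : ℝ) 1, gradE F (x + t • (y - x)) := by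
  have := sqE_le_line hF (zero_le_one' ℝ) x (y - x) hK (ρ := fun _ => 1) continuous_const
    (fun _ _ => one_pos)
  simpa using this

/-- The weight `ρ(t) = t` is that of the area element in polar coordinates, and `∫ dt/t` over `(r,
1)` is the logarithm in the final estimate. -/
theorem sqE_le_ray (hF : ContDiff ℝ ∞ F) (e w : E) {M r : ℝ} (hM : ‖w - e‖ ≤ M) (hr : 0 < r)
    (hr1 : r ≤ 1) :
    sqE F (e + r • (w - e)) ≤ 2 * sqE F w + 2 * ENNReal.ofReal (M ^ 2 * Real.log (1 / r)) *
      ∫⁻ t in Set.Ioc r 1, ENNReal.ofReal t * gradE F (e + t • (w - e)) := by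
  have := sqE_le_line hF hr1 e (w - e) hM (ρ := fun t => t) continuous_id
    (fun t ht => hr.trans_le ht.1)
  rw [integral_inv_of_pos hr one_pos] at this
  simpa using this

theorem combo_mem {D : Set E} (hDo : IsOpen D) (hDc : Convex ℝ D) {x y : E}
    (hx : x ∈ closure D) (hy : y ∈ D)
    {t : ℝ} (ht : 0 < t) (ht1 : t ≤ 1) : x + t • (y - x) ∈ D := by
  have := hDc.combo_interior_closure_mem_interior (hDo.interior_eq.symm ▸ hy) hx
    ht (by linarith : 0 ≤ 1 - t) (by ring)
  rw [hDo.interior_eq] at this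
  convert this using 1
  module

end Segments

section Planar

variable {E : Type*} [NormedAddCommGroup E] [NormedSpace ℝ E] [FiniteDimensional ℝ E]
  [MeasurableSpace E] [BorelSpace E] (μ : Measure E) [μ.IsAddHaarMeasure] {F : E → ℝ}
  {D : Set E} {e w₀ : E} {δ m M : ℝ}

/-- The set is the interval `[a/M, a/m]`; by scale invariance of `dt/t` the value does not depend on
`a`. -/
theorem lintegral_inv_eq {a : ℝ} (ha : 0 < a) (hm : 0 < m) (hmM : m ≤ M) :
    ∫⁻ t in {t : ℝ | 0 < t ∧ t * m ≤ a ∧ a ≤ t * M}, ENNReal.ofReal t⁻¹ =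
      ENNReal.ofReal (Real.log (M / m)) := by
  have hM : 0 < M := hm.trans_le hmM
  have hle : a / M ≤ a / m := div_le_div_of_nonneg_left ha.le hm hmM
  have hpos : 0 < a / M := div_pos ha hM
  have hset : {t : ℝ | 0 < t ∧ t * m ≤ a ∧ a ≤ t * M} = Set.Icc (a / M) (a / m) := by
    ext t
    constructor
    · rintro ⟨-, h2, h3⟩
      exact ⟨(div_le_iff₀ hM).2 h3, (le_div_iff₀ hm).2 h2⟩
    · rintro ⟨h2, h3⟩
      exact ⟨hpos.trans_le h2, (le_div_iff₀ hm).1 h3, (div_le_iff₀ hM).1 h2⟩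
  rw [hset, setLIntegral_congr Ioc_ae_eq_Icc.symm, ← ofReal_integral_eq_lintegral_ofReal,
    ← intervalIntegral.integral_of_le hle, integral_inv_of_pos hpos (div_pos ha hm)]
  · congr 2
    field_simp
  · refine (ContinuousOn.intervalIntegrable ?_ (μ := volume) (a := a / M) (b := a / m)).1
    rw [Set.uIcc_of_le hle]
    exact continuousOn_id.inv₀ fun t ht => (hpos.trans_le ht.1).ne'
  · filter_upwards [ae_restrict_mem measurableSet_Ioc] with t ht
    exact inv_nonneg.2 (hpos.trans ht.1).le

theorem lintegral_inv_le {a : ℝ} (hm : 0 < m) (hmM : m ≤ M) :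
    ∫⁻ t in {t : ℝ | 0 < t ∧ t * m ≤ a ∧ a ≤ t * M}, ENNReal.ofReal t⁻¹ ≤
      ENNReal.ofReal (Real.log (M / m)) := by
  rcases le_or_gt a 0 with ha | ha
  · have : {t : ℝ | 0 < t ∧ t * m ≤ a ∧ a ≤ t * M} = ∅ := by
      ext t
      simp only [Set.mem_ofPred_eq, Set.mem_empty_iff_false, iff_false]
      rintro ⟨h1, h2, -⟩
      have := mul_pos h1 hm
      linarith
    simp [this]
  · exact (lintegral_inv_eq ha hm hmM).le

/-- Logarithmic growth of the mean square on the homothetic copies of a ball. -/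
theorem lintegral_homothety_le (hdim : Module.finrank ℝ E = 2) (hDo : IsOpen D)
    (hDc : Convex ℝ D) (he : e ∈ closure D) (hQ : Metric.ball w₀ δ ⊆ D) (hm : 0 < m)
    (hmM : ∀ w ∈ Metric.ball w₀ δ, m ≤ ‖w - e‖ ∧ ‖w - e‖ ≤ M) (hle : m ≤ M)
    (hF : ContDiff ℝ ∞ F) {r : ℝ} (hr : 0 < r) (hr1 : r ≤ 1) :
    ∫⁻ w in Metric.ball w₀ δ, sqE F (e + r • (w - e)) ∂μ ≤
      2 * ∫⁻ x in D, sqE F x ∂μ + 2 * ENNReal.ofReal (M ^ 2 * Real.log (1 / r)) *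
        (ENNReal.ofReal (Real.log (M / m)) * ∫⁻ x in D, gradE F x ∂μ) := by
  have hgm := (continuous_gradE hF).measurable
  have hpath : Continuous fun p : E × ℝ => e + p.2 • (p.1 - e) := by fun_prop
  have hB : MeasurableSet (Metric.ball w₀ δ) := Metric.isOpen_ball.measurableSet
  set T : Set (ℝ × E) := {p | 0 < p.1 ∧ p.1 * m ≤ ‖p.2 - e‖ ∧ ‖p.2 - e‖ ≤ p.1 * M} with hT
  have hTm : MeasurableSet T := by
    have c1 : Continuous fun p : ℝ × E => ‖p.2 - e‖ := by fun_prop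
    refine (isOpen_lt continuous_const continuous_fst).measurableSet.inter ?_
    exact (isClosed_le (by fun_prop) c1).measurableSet.inter
      (isClosed_le c1 (by fun_prop)).measurableSet
  set G : ℝ × E → ENNReal := T.indicator fun p => ENNReal.ofReal p.1⁻¹ * (D.indicator (gradE F)) p.2
    with hG
  have hGm : Measurable G := by
    refine Measurable.indicator ?_ hTm
    exact (ENNReal.measurable_ofReal.comp measurable_fst.inv).mul
      ((hgm.indicator hDo.measurableSet).comp measurable_snd)
  -- Substitute `x = e + t(w - e)`. In dimension two this turns the weight `t` into `t⁻¹`, and for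
  -- fixed `x` the admissible `t` have `t m ≤ ‖x - e‖ ≤ t M`, so their integral is at most `log
  -- (M/m)`.
  have step : ∫⁻ w in Metric.ball w₀ δ, (∫⁻ t in Set.Ioc r 1, ENNReal.ofReal t *
      gradE F (e + t • (w - e))) ∂μ ≤
      ENNReal.ofReal (Real.log (M / m)) * ∫⁻ x in D, gradE F x ∂μ := by
    calc _ = ∫⁻ t in Set.Ioc r 1, ∫⁻ w in Metric.ball w₀ δ, ENNReal.ofReal t *
          gradE F (e + t • (w - e)) ∂μ := by
          refine lintegral_lintegral_swap (Measurable.aemeasurable ?_)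
          exact (ENNReal.measurable_ofReal.comp measurable_snd).mul (hgm.comp hpath.measurable)
      _ ≤ ∫⁻ t in Set.Ioc r 1, ∫⁻ x, G (t, x) ∂μ := by
          refine setLIntegral_mono' measurableSet_Ioc fun t ht => ?_
          have ht0 : 0 < t := hr.trans ht.1
          have e1 : ∫⁻ x, G (t, x) ∂μ =
              ∫⁻ w, ENNReal.ofReal (t ^ 2) * G (t, t • w + (1 - t) • e) ∂μ := by
            rw [lintegral_const_mul (ENNReal.ofReal (t ^ 2)) (f := fun w => G (t, t • w + (1 - t) • e))
              (hGm.comp (Continuous.measurable (by fun_prop))),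
              lintegral_comp_affine μ (fun x => G (t, x)) ht0.ne', hdim, ← mul_assoc,
              ← ENNReal.ofReal_mul (sq_nonneg t), abs_of_pos (inv_pos.2 (pow_pos ht0 2)),
              mul_inv_cancel₀ (pow_pos ht0 2).ne', ENNReal.ofReal_one, one_mul]
          rw [e1, ← lintegral_indicator hB]
          refine lintegral_mono fun w => ?_
          by_cases hw : w ∈ Metric.ball w₀ δ
          · have hpt : t • w + (1 - t) • e = e + t • (w - e) := by module
            have hmem : e + t • (w - e) ∈ D := combo_mem hDo hDc he (hQ hw) ht0 ht.2
            have hTmem : (t, e + t • (w - e)) ∈ T := by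
              have hn : ‖e + t • (w - e) - e‖ = t * ‖w - e‖ := by
                rw [add_sub_cancel_left, norm_smul, Real.norm_of_nonneg ht0.le]
              simp only [hT, Set.mem_ofPred_eq, hn]
              exact ⟨ht0, mul_le_mul_of_nonneg_left (hmM w hw).1 ht0.le,
                mul_le_mul_of_nonneg_left (hmM w hw).2 ht0.le⟩
            rw [Set.indicator_of_mem hw, hpt, hG, Set.indicator_of_mem hTmem,
              Set.indicator_of_mem hmem, ← mul_assoc, ← ENNReal.ofReal_mul (sq_nonneg t)]
            have : t ^ 2 * t⁻¹ = t := by field_simp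
            rw [this]
          · rw [Set.indicator_of_notMem hw]
            exact zero_le
      _ = ∫⁻ x, (∫⁻ t in Set.Ioc r 1, G (t, x)) ∂μ :=
          lintegral_lintegral_swap hGm.aemeasurable
      _ ≤ ∫⁻ x, ENNReal.ofReal (Real.log (M / m)) * D.indicator (gradE F) x ∂μ := by
          refine lintegral_mono fun x => ?_
          have hTx : MeasurableSet {t : ℝ | 0 < t ∧ t * m ≤ ‖x - e‖ ∧ ‖x - e‖ ≤ t * M} :=
            (measurable_id.prodMk measurable_const : Measurable fun t : ℝ => (t, x)) hTm
          calc ∫⁻ t in Set.Ioc r 1, G (t, x) ≤ ∫⁻ t, G (t, x) := setLIntegral_le_lintegral _ _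
            _ = ∫⁻ t in {t : ℝ | 0 < t ∧ t * m ≤ ‖x - e‖ ∧ ‖x - e‖ ≤ t * M},
                ENNReal.ofReal t⁻¹ * D.indicator (gradE F) x := by
                rw [← lintegral_indicator hTx]
                rfl
            _ = (∫⁻ t in {t : ℝ | 0 < t ∧ t * m ≤ ‖x - e‖ ∧ ‖x - e‖ ≤ t * M},
                ENNReal.ofReal t⁻¹) * D.indicator (gradE F) x :=
                lintegral_mul_const _ (ENNReal.measurable_ofReal.comp measurable_inv)
            _ ≤ _ := mul_le_mul_left (lintegral_inv_le hm hle) _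
      _ = _ := by
          rw [lintegral_const_mul _ (hgm.indicator hDo.measurableSet),
            lintegral_indicator hDo.measurableSet]
  calc _ ≤ ∫⁻ w in Metric.ball w₀ δ, (2 * sqE F w +
        2 * ENNReal.ofReal (M ^ 2 * Real.log (1 / r)) *
          ∫⁻ t in Set.Ioc r 1, ENNReal.ofReal t * gradE F (e + t • (w - e))) ∂μ :=
        setLIntegral_mono' hB fun w hw => sqE_le_ray hF e w (hmM w hw).2 hr hr1
    _ = 2 * ∫⁻ w in Metric.ball w₀ δ, sqE F w ∂μ +
        2 * ENNReal.ofReal (M ^ 2 * Real.log (1 / r)) * ∫⁻ w in Metric.ball w₀ δ,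
          (∫⁻ t in Set.Ioc r 1, ENNReal.ofReal t * gradE F (e + t • (w - e))) ∂μ := by
        rw [lintegral_add_left ((continuous_sqE hF).measurable.const_mul 2),
          lintegral_const_mul _ (continuous_sqE hF).measurable, lintegral_const_mul]
        refine Measurable.lintegral_prod_right' (f := fun p : E × ℝ => ENNReal.ofReal p.2 *
          gradE F (e + p.2 • (p.1 - e))) ?_
        exact (ENNReal.measurable_ofReal.comp measurable_snd).mul (hgm.comp hpath.measurable)
    _ ≤ _ := by
        gcongr

/-- For `t ≤ 1/2` substitute in `x`, with Jacobian `(1 - t)⁻² ≤ 4`; for `t ≥ 1/2` substitute in `w`,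
with Jacobian `(tr)⁻² ≤ 4 r⁻²`. Convexity keeps the segments in `D`. -/
theorem lintegral_lintegral_segment_le (hdim : Module.finrank ℝ E = 2) (hDo : IsOpen D)
    (hDc : Convex ℝ D) (he : e ∈ closure D) {A Q : Set E} (hA : A ⊆ D) (hQ : Q ⊆ D)
    (hAm : MeasurableSet A) (hQm : MeasurableSet Q) (hF : ContDiff ℝ ∞ F) {r : ℝ} (hr : 0 < r)
    (hr1 : r ≤ 1) {t : ℝ} (ht : t ∈ Set.Ioc (0 : ℝ) 1) :
    ∫⁻ x in A, (∫⁻ w in Q, gradE F (x + t • (e + r • (w - e) - x)) ∂μ) ∂μ ≤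
      4 * (μ Q + ENNReal.ofReal (r ^ 2)⁻¹ * μ A) * ∫⁻ x in D, gradE F x ∂μ := by
  set g : E → ENNReal := D.indicator (gradE F) with hg
  have hgm : Measurable g := (continuous_gradE hF).measurable.indicator hDo.measurableSet
  have hgi : ∫⁻ x in D, gradE F x ∂μ = ∫⁻ x, g x ∂μ :=
    (lintegral_indicator hDo.measurableSet _).symm
  have hmem : ∀ x ∈ A, ∀ w ∈ Q, gradE F (x + t • (e + r • (w - e) - x)) =
      g (x + t • (e + r • (w - e) - x)) := by
    intro x hx w hw
    rw [hg, Set.indicator_of_mem]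
    exact combo_mem hDo hDc (subset_closure (hA hx)) (combo_mem hDo hDc he (hQ hw) hr hr1) ht.1
      ht.2
  have e0 : ∫⁻ x in A, (∫⁻ w in Q, gradE F (x + t • (e + r • (w - e) - x)) ∂μ) ∂μ =
      ∫⁻ x in A, (∫⁻ w in Q, g (x + t • (e + r • (w - e) - x)) ∂μ) ∂μ :=
    setLIntegral_congr_fun hAm fun x hx => setLIntegral_congr_fun hQm fun w hw => hmem x hx w hw
  have hfour : ∀ {s : ℝ}, 1 / 2 ≤ s → ENNReal.ofReal |(s ^ 2)⁻¹| ≤ 4 := by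
    intro s hs
    rw [abs_of_nonneg (by positivity), show (4 : ENNReal) = ENNReal.ofReal 4 by norm_num]
    refine ENNReal.ofReal_le_ofReal (inv_le_of_inv_le₀ (by norm_num) ?_)
    nlinarith
  rw [e0, hgi]
  rcases le_total t (1 / 2) with h | h
  · calc _ = ∫⁻ w in Q, (∫⁻ x in A, g (x + t • (e + r • (w - e) - x)) ∂μ) ∂μ := by
          refine lintegral_lintegral_swap (Measurable.aemeasurable ?_)
          refine hgm.comp (Continuous.measurable ?_)
          fun_prop
      _ ≤ ∫⁻ w in Q, 4 * ∫⁻ x, g x ∂μ ∂μ := by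
          refine setLIntegral_mono' hQm fun w _ => (setLIntegral_le_lintegral _ _).trans ?_
          have e1 : ∀ x, x + t • (e + r • (w - e) - x) = (1 - t) • x + t • (e + r • (w - e)) :=
            fun x => by module
          simp only [e1]
          rw [lintegral_comp_affine μ g (by linarith : (0 : ℝ) < 1 - t).ne', hdim]
          exact mul_le_mul_left (hfour (by linarith)) _
      _ = 4 * (∫⁻ x, g x ∂μ) * μ Q := setLIntegral_const _ _
      _ ≤ _ := by
          rw [mul_right_comm]
          gcongr
          exact le_self_add
  · calc _ ≤ ∫⁻ x in A, 4 * ENNReal.ofReal (r ^ 2)⁻¹ * ∫⁻ x, g x ∂μ ∂μ := by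
          refine setLIntegral_mono' hAm fun x _ => (setLIntegral_le_lintegral _ _).trans ?_
          have e1 : ∀ w, x + t • (e + r • (w - e) - x) =
            (t * r) • w + ((1 - t) • x + (t * (1 - r)) • e) := fun w => by module
          simp only [e1]
          rw [lintegral_comp_affine μ g (mul_pos ht.1 hr).ne', hdim, mul_pow, mul_inv, abs_mul,
            ENNReal.ofReal_mul (abs_nonneg _), abs_of_pos (inv_pos.2 (pow_pos hr 2))]
          gcongr
          exact hfour h
      _ = 4 * ENNReal.ofReal (r ^ 2)⁻¹ * (∫⁻ x, g x ∂μ) * μ A := setLIntegral_const _ _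
      _ = 4 * (ENNReal.ofReal (r ^ 2)⁻¹ * μ A) * ∫⁻ x, g x ∂μ := by ring
      _ ≤ _ := by
          gcongr
          exact le_add_self

/-- Integrates a pointwise comparison of `f x` with `g y` along a family of paths over all pairs
`(x, y)`, exchanging the order of integration so that only a bound for each path parameter is
needed. -/
theorem lintegral_le_of_le_average {X Y : Type*} [MeasurableSpace X] [MeasurableSpace Y]
    {α : Measure X} {β : Measure Y} {τ : Measure ℝ} [SFinite α] [SFinite β] [SFinite τ]
    {f : X → ENNReal} {g : Y → ENNReal} {H : X × Y × ℝ → ENNReal} {c : ENNReal} {K : ENNReal}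
    (hf : Measurable f) (hg : Measurable g) (hH : Measurable H)
    (hle : ∀ᵐ x ∂α, ∀ᵐ y ∂β, f x ≤ 2 * g y + c * ∫⁻ t, H (x, y, t) ∂τ)
    (hK : ∀ᵐ t ∂τ, ∫⁻ x, ∫⁻ y, H (x, y, t) ∂β ∂α ≤ K) :
    β Set.univ * ∫⁻ x, f x ∂α ≤ 2 * α Set.univ * ∫⁻ y, g y ∂β + c * (K * τ Set.univ) := by
  have hin : ∀ x, Measurable fun y => ∫⁻ t, H (x, y, t) ∂τ := fun x =>
    (hH.comp measurable_prodMk_left).lintegral_prod_right'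
  have hxty : Measurable fun p : (X × ℝ) × Y => H (p.1.1, p.2, p.1.2) :=
    hH.comp ((measurable_fst.comp measurable_fst).prodMk
      (measurable_snd.prodMk (measurable_snd.comp measurable_fst)))
  have hm2 : Measurable fun p : X × ℝ => ∫⁻ y, H (p.1, y, p.2) ∂β := hxty.lintegral_prod_right'
  have h1 : ∀ x, ∫⁻ y, (2 * g y + c * ∫⁻ t, H (x, y, t) ∂τ) ∂β =
      2 * ∫⁻ y, g y ∂β + c * ∫⁻ t, ∫⁻ y, H (x, y, t) ∂β ∂τ := by
    intro x
    rw [lintegral_add_left (hg.const_mul 2), lintegral_const_mul _ hg,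
      lintegral_const_mul _ (hin x), lintegral_lintegral_swap (f := fun y t => H (x, y, t))
        (hH.comp measurable_prodMk_left).aemeasurable]
  calc β Set.univ * ∫⁻ x, f x ∂α = ∫⁻ x, ∫⁻ _, f x ∂β ∂α := by
        simp only [lintegral_const]
        rw [lintegral_mul_const _ hf, mul_comm]
    _ ≤ ∫⁻ x, ∫⁻ y, (2 * g y + c * ∫⁻ t, H (x, y, t) ∂τ) ∂β ∂α := by
        refine lintegral_mono_ae ?_
        filter_upwards [hle] with x hx using lintegral_mono_ae hx
    _ = 2 * α Set.univ * ∫⁻ y, g y ∂β + c * ∫⁻ t, ∫⁻ x, ∫⁻ y, H (x, y, t) ∂β ∂α ∂τ := by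
        simp only [h1]
        rw [lintegral_add_left measurable_const, lintegral_const,
          lintegral_const_mul _ hm2.lintegral_prod_right', lintegral_lintegral_swap
            hm2.aemeasurable]
        ring
    _ ≤ _ := by
        gcongr
        rw [← lintegral_const]
        exact lintegral_mono_ae hK

/-- A Poincaré-type comparison at scale `r`: points of `A` are joined by segments of length at most
`(C₁ + M) r` to points of the homothetic copy of the ball, where the mean square is already known to
grow logarithmically. -/
theorem lintegral_corner_le_homothety (hdim : Module.finrank ℝ E = 2) (hDo : IsOpen D)
    (hDc : Convex ℝ D) (he : e ∈ closure D) {A : Set E} (hA : A ⊆ D) (hAm : MeasurableSet A)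
    (hQ : Metric.ball w₀ δ ⊆ D) (hM : ∀ w ∈ Metric.ball w₀ δ, ‖w - e‖ ≤ M)
    (hF : ContDiff ℝ ∞ F) {r C₁ : ℝ} (hr : 0 < r) (hr1 : r ≤ 1) (hAC : ∀ x ∈ A, ‖x - e‖ ≤ C₁ * r) :
    μ (Metric.ball w₀ δ) * ∫⁻ x in A, sqE F x ∂μ ≤
      2 * μ A * ∫⁻ w in Metric.ball w₀ δ, sqE F (e + r • (w - e)) ∂μ +
      2 * ENNReal.ofReal (((C₁ + M) * r) ^ 2) *
        (4 * (μ (Metric.ball w₀ δ) + ENNReal.ofReal (r ^ 2)⁻¹ * μ A) *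
          ∫⁻ x in D, gradE F x ∂μ) := by
  have hQm : MeasurableSet (Metric.ball w₀ δ) := Metric.isOpen_ball.measurableSet
  have hpath : Continuous fun p : E × E × ℝ => p.1 + p.2.2 • (e + r • (p.2.1 - e) - p.1) := by
    fun_prop
  have hpath1 : Continuous fun w : E => e + r • (w - e) := by fun_prop
  have hpt : ∀ᵐ x ∂(μ.restrict A), ∀ᵐ w ∂(μ.restrict (Metric.ball w₀ δ)),
      sqE F x ≤ 2 * sqE F (e + r • (w - e)) + 2 * ENNReal.ofReal (((C₁ + M) * r) ^ 2) *
      ∫⁻ t in Set.Ioc (0 : ℝ) 1, gradE F (x + t • (e + r • (w - e) - x)) := by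
    filter_upwards [ae_restrict_mem hAm] with x hx
    filter_upwards [ae_restrict_mem hQm] with w hw
    refine sqE_le_segment hF x _ ?_
    have : e + r • (w - e) - x = r • (w - e) - (x - e) := by abel
    rw [this]
    refine (norm_sub_le _ _).trans ?_
    rw [norm_smul, Real.norm_of_nonneg hr.le]
    have h1 := hAC x hx
    have h2 := mul_le_mul_of_nonneg_left (hM w hw) hr.le
    linarith
  have hK : ∀ᵐ t ∂(volume.restrict (Set.Ioc (0 : ℝ) 1)), ∫⁻ x in A, (∫⁻ w in Metric.ball w₀ δ,
      gradE F (x + t • (e + r • (w - e) - x)) ∂μ) ∂μ ≤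
      4 * (μ (Metric.ball w₀ δ) + ENNReal.ofReal (r ^ 2)⁻¹ * μ A) * ∫⁻ x in D, gradE F x ∂μ := by
    filter_upwards [ae_restrict_mem measurableSet_Ioc] with t ht
    exact lintegral_lintegral_segment_le μ hdim hDo hDc he hA hQ hAm hQm hF hr hr1 ht
  have h := lintegral_le_of_le_average
    (H := fun p : E × E × ℝ => gradE F (p.1 + p.2.2 • (e + r • (p.2.1 - e) - p.1)))
    (continuous_sqE hF).measurable ((continuous_sqE hF).comp hpath1).measurable
    ((continuous_gradE hF).comp hpath).measurable hpt hK
  simp only [Measure.restrict_apply_univ, Real.volume_Ioc, sub_zero, ENNReal.ofReal_one,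
    mul_one] at h
  exact h

/-- In the plane the mean square of an `H¹` function over a disc of radius `r` around a corner
grows at most logarithmically. -/
theorem exists_lintegral_corner_le (hdim : Module.finrank ℝ E = 2) {C₁ : ℝ} (hδ : 0 < δ)
    (hm : 0 < m) (hle : m ≤ M) (hC₁ : 0 ≤ C₁) : ∃ C : ENNReal, C ≠ ⊤ ∧
    ∀ (D : Set E) (e w₀ : E) (F : E → ℝ) (r : ℝ), IsOpen D → Convex ℝ D → e ∈ closure D →
      Metric.ball w₀ δ ⊆ D → (∀ w ∈ Metric.ball w₀ δ, m ≤ ‖w - e‖ ∧ ‖w - e‖ ≤ M) →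
      ContDiff ℝ ∞ F → 0 < r → r ≤ 1 →
      ∫⁻ x in D ∩ Metric.closedBall e (C₁ * r), sqE F x ∂μ ≤
        C * ENNReal.ofReal (r ^ 2 * (1 + Real.log (1 / r))) *
          (∫⁻ x in D, sqE F x ∂μ + ∫⁻ x in D, gradE F x ∂μ) := by
  set b := μ (Metric.ball 0 1) with hb
  set q := μ (Metric.ball (0 : E) δ) with hq
  have hq0 : q ≠ 0 := (Metric.measure_ball_pos μ 0 hδ).ne'
  have hqt : q ≠ ⊤ := measure_ball_lt_top.ne
  have hbt : b ≠ ⊤ := measure_ball_lt_top.ne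
  set B := ENNReal.ofReal (C₁ ^ 2) * b with hB
  set m2 := ENNReal.ofReal (M ^ 2) with hm2
  set L := ENNReal.ofReal (Real.log (M / m)) with hL
  set κ := ENNReal.ofReal ((C₁ + M) ^ 2) with hκ
  have hBt : B ≠ ⊤ := ENNReal.mul_ne_top ENNReal.ofReal_ne_top hbt
  -- The constant depends only on `δ`, `m`, `M`, `C₁` and the measure, not on `D` or `e`; hence it
  -- serves all plane sections at once.
  refine ⟨q⁻¹ * (4 * B + 4 * B * m2 * L + 8 * κ * q + 8 * κ * B), ?_, ?_⟩
  · refine ENNReal.mul_ne_top (ENNReal.inv_ne_top.2 hq0) ?_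
    finiteness
  intro D e w₀ F r hDo hDc he hQ hmM hF hr hr1
  set A := D ∩ Metric.closedBall e (C₁ * r) with hA
  have hμQ : μ (Metric.ball w₀ δ) = q := μ.addHaar_ball_center w₀ δ
  set R := ENNReal.ofReal (r ^ 2) with hR
  set l := ENNReal.ofReal (Real.log (1 / r)) with hl
  have hlog : 0 ≤ Real.log (1 / r) := Real.log_nonneg (by rw [le_div_iff₀ hr]; linarith)
  have hμA : μ A ≤ B * R := by
    refine (measure_mono Set.inter_subset_right).trans ?_
    rw [μ.addHaar_closedBall e (mul_nonneg hC₁ hr.le), hdim, mul_pow,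
      ENNReal.ofReal_mul (sq_nonneg _), hB, mul_right_comm]
  have hRR : ENNReal.ofReal (r ^ 2)⁻¹ * R = 1 := by
    rw [hR, ← ENNReal.ofReal_mul (by positivity), inv_mul_cancel₀ (by positivity),
      ENNReal.ofReal_one]
  have h1 := lintegral_corner_le_homothety μ hdim hDo hDc he (A := A) Set.inter_subset_left
    (hDo.measurableSet.inter Metric.isClosed_closedBall.measurableSet) hQ (fun w hw => (hmM w hw).2)
    hF hr hr1 fun x hx => by simpa [dist_eq_norm] using hx.2
  have h2 := lintegral_homothety_le μ hdim hDo hDc he hQ hm hmM hle hF hr hr1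
  rw [hμQ] at h1
  set S := ∫⁻ x in D, sqE F x ∂μ with hS
  set G := ∫⁻ x in D, gradE F x ∂μ with hG
  have e1 : ENNReal.ofReal (M ^ 2 * Real.log (1 / r)) = m2 * l := ENNReal.ofReal_mul (sq_nonneg _)
  have e2 : ENNReal.ofReal (((C₁ + M) * r) ^ 2) = κ * R := by
    rw [mul_pow, ENNReal.ofReal_mul (sq_nonneg _)]
  have e3 : ENNReal.ofReal (r ^ 2 * (1 + Real.log (1 / r))) = R * (1 + l) := by
    rw [ENNReal.ofReal_mul (sq_nonneg _), ENNReal.ofReal_add zero_le_one hlog, ENNReal.ofReal_one]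
  rw [e1] at h2
  rw [e2] at h1
  rw [e3]
  have h3 : q * ∫⁻ x in A, sqE F x ∂μ ≤ R * (1 + l) *
      (4 * B + 4 * B * m2 * L + 8 * κ * q + 8 * κ * B) * (S + G) := by
    have hA2 : ENNReal.ofReal (r ^ 2)⁻¹ * μ A ≤ B := by
      calc _ ≤ ENNReal.ofReal (r ^ 2)⁻¹ * (B * R) := by gcongr
        _ = B * (ENNReal.ofReal (r ^ 2)⁻¹ * R) := by ring
        _ = B := by rw [hRR, mul_one]
    calc _ ≤ 2 * (B * R) * (2 * S + 2 * (m2 * l) * (L * G)) +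
          2 * (κ * R) * (4 * (q + B) * G) := by
          refine h1.trans ?_
          gcongr
      _ = R * ((4 * B) * (1 * S) + (4 * B * m2 * L) * (l * G) +
          (8 * κ * q + 8 * κ * B) * (1 * G)) := by ring
      _ ≤ R * ((4 * B) * ((1 + l) * (S + G)) + (4 * B * m2 * L) * ((1 + l) * (S + G)) +
          (8 * κ * q + 8 * κ * B) * ((1 + l) * (S + G))) := by
          gcongr <;> first | exact le_self_add | exact le_add_self
      _ = _ := by ring
  calc ∫⁻ x in A, sqE F x ∂μ = q⁻¹ * (q * ∫⁻ x in A, sqE F x ∂μ) := by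
        rw [← mul_assoc, ENNReal.inv_mul_cancel hq0 hqt, one_mul]
    _ ≤ q⁻¹ * (R * (1 + l) * (4 * B + 4 * B * m2 * L + 8 * κ * q + 8 * κ * B) * (S + G)) := by
        gcongr
    _ = _ := by ring

end Planar

end

/-! ### Decomposition of volume integrals into plane sections. -/

section

section Shell

/-- A spherical shell. -/
def shell (E : Type*) [NormedAddCommGroup E] : Set E := {y | 1 ≤ ‖y‖ ∧ ‖y‖ ≤ 2}

theorem measurableSet_shell {E : Type*} [NormedAddCommGroup E] [MeasurableSpace E]
    [BorelSpace E] : MeasurableSet (shell E) :=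
  ((isClosed_le continuous_const continuous_norm).inter
    (isClosed_le continuous_norm continuous_const)).measurableSet

variable {E : Type*} [NormedAddCommGroup E] [NormedSpace ℝ E] [FiniteDimensional ℝ E]
  [MeasurableSpace E] [BorelSpace E]

/-- Integration over a shell and over the rays through it. -/
theorem lintegral_shell [Nontrivial E] (μ : Measure E) [μ.IsAddHaarMeasure] {h : E → ENNReal}
    (hh : Measurable h) :
    ∫⁻ y in shell E, (∫⁻ s in Set.Ioi (0 : ℝ),
      ENNReal.ofReal (s ^ Module.finrank ℝ E * s⁻¹) * h (s • y)) ∂μ =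
      ENNReal.ofReal (Real.log 2) * ∫⁻ x, h x ∂μ := by
  set N := Module.finrank ℝ E
  -- A nonzero `x` is `s • y` with `y` in the shell exactly for `‖x‖/2 ≤ s ≤ ‖x‖`, and `∫ ds/s = log
  -- 2`. A solid shell thus replaces spherical coordinates.
  set T : Set (ℝ × E) := {p | 0 < p.1 ∧ p.1 * 1 ≤ ‖p.2‖ ∧ ‖p.2‖ ≤ p.1 * 2} with hT
  have hTm : MeasurableSet T := by
    have c1 : Continuous fun p : ℝ × E => ‖p.2‖ := by fun_prop
    refine (isOpen_lt continuous_const continuous_fst).measurableSet.inter ?_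
    exact (isClosed_le (by fun_prop) c1).measurableSet.inter
      (isClosed_le c1 (by fun_prop)).measurableSet
  set G : ℝ × E → ENNReal := T.indicator fun p => ENNReal.ofReal p.1⁻¹ * h p.2 with hG
  have hGm : Measurable G := by
    refine Measurable.indicator ?_ hTm
    exact (ENNReal.measurable_ofReal.comp measurable_fst.inv).mul (hh.comp measurable_snd)
  calc _ = ∫⁻ s in Set.Ioi (0 : ℝ), ∫⁻ y in shell E,
        ENNReal.ofReal (s ^ N * s⁻¹) * h (s • y) ∂μ := by
        refine lintegral_lintegral_swap (f := fun y s => ENNReal.ofReal (s ^ N * s⁻¹) * h (s • y))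
          (Measurable.aemeasurable ?_)
        refine (ENNReal.measurable_ofReal.comp
          ((measurable_snd.pow_const N).mul measurable_snd.inv)).mul (hh.comp ?_)
        exact (continuous_snd.smul continuous_fst).measurable
    _ = ∫⁻ s in Set.Ioi (0 : ℝ), ∫⁻ x, G (s, x) ∂μ := by
        refine setLIntegral_congr_fun measurableSet_Ioi fun s hs => ?_
        have hs0 : (0 : ℝ) < s := hs
        have e1 : ∫⁻ x, G (s, x) ∂μ = ∫⁻ y, ENNReal.ofReal (s ^ N) * G (s, s • y + 0) ∂μ := by
          rw [lintegral_const_mul (ENNReal.ofReal (s ^ N)) (f := fun y => G (s, s • y + 0))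
              (hGm.comp (Continuous.measurable (by fun_prop))),
            lintegral_comp_affine μ (fun x => G (s, x)) hs0.ne', ← mul_assoc,
            ← ENNReal.ofReal_mul (pow_nonneg hs0.le _), abs_of_pos (inv_pos.2 (pow_pos hs0 _)),
            mul_inv_cancel₀ (pow_pos hs0 _).ne', ENNReal.ofReal_one, one_mul]
        simp only [e1]
        rw [← lintegral_indicator measurableSet_shell]
        refine lintegral_congr fun y => ?_
        have hmem : (s, s • y + 0) ∈ T ↔ y ∈ shell E := by
          simp only [hT, shell, Set.mem_ofPred_eq, add_zero, norm_smul, Real.norm_of_nonneg hs0.le,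
            mul_le_mul_iff_right₀ hs0, hs0, true_and]
        by_cases hy : y ∈ shell E
        · rw [Set.indicator_of_mem hy, hG, Set.indicator_of_mem (hmem.2 hy), add_zero, ← mul_assoc,
            ← ENNReal.ofReal_mul (pow_nonneg hs0.le _)]
        · rw [Set.indicator_of_notMem hy, hG, Set.indicator_of_notMem (fun h => hy (hmem.1 h)),
            mul_zero]
    _ = ∫⁻ x, (∫⁻ s in Set.Ioi (0 : ℝ), G (s, x)) ∂μ :=
        lintegral_lintegral_swap (f := fun s x => G (s, x)) hGm.aemeasurable
    _ = ∫⁻ x, ENNReal.ofReal (Real.log 2) * h x ∂μ := by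
        have hne : ∀ᵐ x ∂μ, x ≠ 0 := by simp [ae_iff]
        refine lintegral_congr_ae ?_
        filter_upwards [hne] with x hx
        have hTx : MeasurableSet {t : ℝ | 0 < t ∧ t * 1 ≤ ‖x‖ ∧ ‖x‖ ≤ t * 2} :=
          (measurable_id.prodMk measurable_const : Measurable fun t : ℝ => (t, x)) hTm
        have hsub : {t : ℝ | 0 < t ∧ t * 1 ≤ ‖x‖ ∧ ‖x‖ ≤ t * 2} ⊆ Set.Ioi 0 := fun t ht => ht.1
        calc ∫⁻ s in Set.Ioi (0 : ℝ), G (s, x) =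
            ∫⁻ s in Set.Ioi (0 : ℝ), {t : ℝ | 0 < t ∧ t * 1 ≤ ‖x‖ ∧ ‖x‖ ≤ t * 2}.indicator
              (fun t => ENNReal.ofReal t⁻¹ * h x) s := rfl
          _ = ∫⁻ t in {t : ℝ | 0 < t ∧ t * 1 ≤ ‖x‖ ∧ ‖x‖ ≤ t * 2}, ENNReal.ofReal t⁻¹ * h x := by
              rw [lintegral_indicator hTx, Measure.restrict_restrict hTx,
                Set.inter_eq_left.2 hsub]
          _ = _ := by
              rw [lintegral_mul_const (h x) (f := fun t : ℝ => ENNReal.ofReal t⁻¹)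
                  (ENNReal.measurable_ofReal.comp measurable_inv), lintegral_inv_eq (norm_pos_iff.2 hx) one_pos one_le_two, div_one]
    _ = _ := lintegral_const_mul _ hh

end Shell

section PlanarSections

variable {n : ℕ}

/-- The map from the plane to the section of the space in the direction of the `k`-th axis and a
direction `y` orthogonal to it. -/
def sectionMap (k : Fin (n + 1)) (c σ : ℝ) (y₀ y : Fin n → ℝ) (w : ℝ × ℝ) : 𝔼 (n + 1) :=
  linePoint k (c + σ * w.1) (y₀ + w.2 • y)

/-- Apply the shell formula in the coordinates other than `k`, for each fixed value of the `k`-th;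
the translation and the sign `σ` preserve measure. -/
theorem lintegral_sectionMap [Nonempty (Fin n)] (k : Fin (n + 1)) {c σ : ℝ} (hσ : σ = 1 ∨ σ = -1)
    (y₀ : Fin n → ℝ) {h : (𝔼 (n + 1)) → ENNReal} (hh : Measurable h) :
    ∫⁻ y in shell (Fin n → ℝ), (∫⁻ w in {w : ℝ × ℝ | 0 < w.2},
      ENNReal.ofReal (w.2 ^ n * w.2⁻¹) * h (sectionMap k c σ y₀ y w)) =
      ENNReal.ofReal (Real.log 2) * ∫⁻ x, h x := by
  have hset : {w : ℝ × ℝ | 0 < w.2} = Set.univ ×ˢ Set.Ioi 0 := by ext; simp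
  have hmeas : (volume : Measure (ℝ × ℝ)).restrict {w : ℝ × ℝ | 0 < w.2} =
      (volume : Measure ℝ).prod (volume.restrict (Set.Ioi 0)) := by
    rw [hset, Measure.volume_eq_prod, ← Measure.prod_restrict, Measure.restrict_univ]
  have hlp : Measurable fun p : ℝ × (Fin n → ℝ) => h (linePoint k p.1 p.2) :=
    hh.comp (continuous_linePoint k).measurable
  have hlp2 : Measurable fun p : ℝ × (Fin n → ℝ) => h (linePoint k (c + σ * p.1) (y₀ + p.2)) :=
    hlp.comp (Continuous.measurable
      (by fun_prop : Continuous fun p : ℝ × (Fin n → ℝ) => (c + σ * p.1, y₀ + p.2)))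
  set J : (Fin n → ℝ) → ℝ → ℝ → ENNReal := fun y t s =>
    ENNReal.ofReal (s ^ n * s⁻¹) * h (linePoint k (c + σ * t) (y₀ + s • y)) with hJ
  have hJm : Measurable fun p : (Fin n → ℝ) × ℝ × ℝ => J p.1 p.2.1 p.2.2 := by
    have m1 : Measurable fun p : (Fin n → ℝ) × ℝ × ℝ => p.2.2 :=
      measurable_snd.comp measurable_snd
    have m2 : Measurable fun p : (Fin n → ℝ) × ℝ × ℝ => (c + σ * p.2.1, y₀ + p.2.2 • p.1) :=
      Continuous.measurable (by fun_prop)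
    exact (ENNReal.measurable_ofReal.comp ((m1.pow_const n).mul m1.inv)).mul (hlp.comp m2)
  have hσ0 : σ ≠ 0 := by rcases hσ with h | h <;> rw [h] <;> norm_num
  have hσ1 : |(σ ^ Module.finrank ℝ ℝ)⁻¹| = 1 := by rcases hσ with h | h <;> rw [h] <;> simp
  calc _ = ∫⁻ y in shell (Fin n → ℝ), ∫⁻ t, ∫⁻ s in Set.Ioi (0 : ℝ), J y t s := by
        refine lintegral_congr fun y => ?_
        rw [hmeas, lintegral_prod]
        · rfl
        · exact (hJm.comp measurable_prodMk_left).aemeasurable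
    _ = ∫⁻ t, ∫⁻ y in shell (Fin n → ℝ), ∫⁻ s in Set.Ioi (0 : ℝ), J y t s := by
        refine lintegral_lintegral_swap (f := fun y t => ∫⁻ s in Set.Ioi (0 : ℝ), J y t s)
          (Measurable.aemeasurable ?_)
        exact Measurable.lintegral_prod_right' (f := fun p : ((Fin n → ℝ) × ℝ) × ℝ =>
          J p.1.1 p.1.2 p.2) (hJm.comp ((measurable_fst.comp measurable_fst).prodMk
            ((measurable_snd.comp measurable_fst).prodMk measurable_snd)))
    _ = ∫⁻ t, ENNReal.ofReal (Real.log 2) * ∫⁻ y, h (linePoint k (c + σ * t) (y₀ + y)) := by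
        refine lintegral_congr fun t => ?_
        have := lintegral_shell (volume : Measure (Fin n → ℝ))
          (h := fun y => h (linePoint k (c + σ * t) (y₀ + y))) (hlp2.comp measurable_prodMk_left)
        rw [Module.finrank_fin_fun] at this
        exact this
    _ = ENNReal.ofReal (Real.log 2) * ∫⁻ t, ∫⁻ y, h (linePoint k (c + σ * t) y) := by
        rw [lintegral_const_mul _ hlp2.lintegral_prod_right']
        congr 1
        refine lintegral_congr fun t => ?_
        exact lintegral_add_left_eq_self (fun y => h (linePoint k (c + σ * t) y)) y₀
    _ = ENNReal.ofReal (Real.log 2) * ∫⁻ t, ∫⁻ y, h (linePoint k t y) := by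
        have := lintegral_comp_affine (volume : Measure ℝ)
          (fun t => ∫⁻ y, h (linePoint k t y)) hσ0 c
        rw [hσ1, ENNReal.ofReal_one, one_mul] at this
        rw [← this]
        simp only [smul_eq_mul, add_comm c]
    _ = _ := by
        rw [← (measurePreserving_linePoint k).lintegral_comp hh, Measure.volume_eq_prod,
          lintegral_prod _ hlp.aemeasurable]

end PlanarSections

end

/-! ### A frame for the flat face and a distance to its edge. -/

section

section Frame

variable {n : ℕ} {Ω : Set (𝔼 (n + 1))} {k : Fin (n + 1)} {c σ a R : ℝ} {y₀ : Fin n → ℝ}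

/-- The bounded set `Ω` lies on one side of the hyperplane `{x k = c}` and contains a small
cylinder over a disc in this hyperplane. -/
structure IsFaceFrame (Ω : Set (𝔼 (n + 1))) (k : Fin (n + 1)) (c σ a R : ℝ) (y₀ : Fin n → ℝ) :
    Prop where
  sign : σ = 1 ∨ σ = -1
  side : ∀ x ∈ Ω, 0 < σ * (x k - c)
  pos : 0 < a
  cylinder : ∀ (t : ℝ) (y : Fin n → ℝ), 0 < t → t < a → ‖y‖ < a →
    linePoint k (c + σ * t) (y₀ + y) ∈ Ω
  radius_pos : 0 < R
  radius : ∀ x ∈ Ω, ‖dropCoord k x - y₀‖ ≤ R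

theorem exists_isFaceFrame (hΩo : IsOpen Ω) (hΩ : Bornology.IsBounded Ω) (hc : Convex ℝ Ω)
    {S : Set (𝔼 (n + 1))} (hS : IsRelOpenInBoundary Ω S) (hne : S.Nonempty)
    (hplane : ∀ x ∈ S, x k = c) : ∃ σ a R y₀, IsFaceFrame Ω k c σ a R y₀ := by
  obtain ⟨z, ρ, hρ, σ, hσ, hz, hside, hball⟩ := exists_halfBall hΩo hc hS hne hplane
  have hσσ : σ * σ = 1 := by rcases hσ with h | h <;> rw [h] <;> norm_num
  have hcont : Continuous fun p : ℝ × (Fin n → ℝ) => linePoint k (c + σ * p.1) (dropCoord k z + p.2) :=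
    (continuous_linePoint k).comp (by fun_prop : Continuous fun p : ℝ × (Fin n → ℝ) =>
      (c + σ * p.1, dropCoord k z + p.2))
  have h0 : linePoint k (c + σ * (0 : ℝ × (Fin n → ℝ)).1) (dropCoord k z + (0 : ℝ × (Fin n → ℝ)).2)
      = z := by
    rw [Prod.fst_zero, Prod.snd_zero, mul_zero, add_zero, add_zero, ← hz, linePoint_dropCoord]
  obtain ⟨a, ha, hsub⟩ := Metric.continuous_iff.1 hcont 0 ρ hρ
  obtain ⟨R, hR⟩ := (((lipschitz_dropCoord (n := n) k).isBounded_image hΩ)).exists_norm_le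
  refine ⟨σ, a, |R| + ‖dropCoord k z‖ + 1, dropCoord k z, hσ, hside, ha, ?_, by positivity, ?_⟩
  · intro t y ht hta hy
    refine hball _ ?_ ?_
    · have := hsub (t, y) (by
        rw [dist_zero_right, Prod.norm_def, max_lt_iff, Real.norm_of_nonneg ht.le]
        exact ⟨hta, hy⟩)
      rwa [h0] at this
    · have : (linePoint k (c + σ * t) (dropCoord k z + y)) k = c + σ * t := by simp [linePoint]
      rw [this, add_sub_cancel_left, ← mul_assoc, hσσ, one_mul]
      exact ht
  · intro x hx
    have h1 := hR _ ⟨x, hx, rfl⟩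
    have h2 := norm_sub_le (dropCoord k x) (dropCoord k z)
    linarith [le_abs_self R]

/-- The flat face, in the coordinates of the hyperplane centered at `y₀`. -/
def faceSet (Ω : Set (𝔼 (n + 1))) (k : Fin (n + 1)) (c : ℝ) (y₀ : Fin n → ℝ) : Set (Fin n → ℝ) :=
  {y | linePoint k c (y₀ + y) ∈ closure Ω}

/-- A Lipschitz function comparable to the distance from the relative boundary of the flat face. -/
def edgeDist (Ω : Set (𝔼 (n + 1))) (k : Fin (n + 1)) (c : ℝ) (y₀ : Fin n → ℝ) (x : 𝔼 (n + 1)) :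
    ℝ :=
  |x k - c| + |gauge (faceSet Ω k c y₀) (dropCoord k x - y₀) - 1|

theorem isClosed_faceSet : IsClosed (faceSet Ω k c y₀) :=
  isClosed_closure.preimage ((continuous_linePoint k).comp
    (by fun_prop : Continuous fun y : Fin n → ℝ => (c, y₀ + y)))

theorem convex_faceSet (hc : Convex ℝ Ω) : Convex ℝ (faceSet Ω k c y₀) := by
  intro y hy y' hy' α β hα hβ hαβ
  have h := hc.closure hy hy' hα hβ hαβ
  rw [linePoint_combo] at h
  have e : α • (y₀ + y) + β • (y₀ + y') = y₀ + (α • y + β • y') := by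
    have : α • (y₀ + y) + β • (y₀ + y') = (α + β) • y₀ + (α • y + β • y') := by module
    rw [this, hαβ, one_smul]
  rwa [← add_mul, hαβ, one_mul, e] at h

namespace IsFaceFrame

theorem ball_subset (hf : IsFaceFrame Ω k c σ a R y₀) : Metric.ball 0 a ⊆ faceSet Ω k c y₀ := by
  intro y hy
  rw [mem_ball_zero_iff] at hy
  have hcont : Continuous fun t : ℝ => linePoint k (c + σ * t) (y₀ + y) :=
    (continuous_linePoint k).comp (by fun_prop : Continuous fun t : ℝ => (c + σ * t, y₀ + y))
  have hlim : Tendsto (fun t : ℝ => linePoint k (c + σ * t) (y₀ + y)) (𝓝[>] 0)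
      (𝓝 (linePoint k c (y₀ + y))) := by
    have := (hcont.tendsto 0).mono_left (nhdsWithin_le_nhds (s := Set.Ioi 0))
    rwa [mul_zero, add_zero] at this
  refine mem_closure_of_tendsto hlim ?_
  filter_upwards [Ioo_mem_nhdsGT hf.pos] with t ht using hf.cylinder t y ht.1 ht.2 hy

theorem faceSet_mem_nhds (hf : IsFaceFrame Ω k c σ a R y₀) : faceSet Ω k c y₀ ∈ 𝓝 0 :=
  mem_of_superset (Metric.ball_mem_nhds 0 hf.pos) hf.ball_subset

theorem norm_le_of_mem_closure (hf : IsFaceFrame Ω k c σ a R y₀) {x : 𝔼 (n + 1)}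
    (hx : x ∈ closure Ω) : ‖dropCoord k x - y₀‖ ≤ R := by
  have hcl : IsClosed {x : 𝔼 (n + 1) | ‖dropCoord k x - y₀‖ ≤ R} :=
    isClosed_le (((lipschitz_dropCoord k).continuous.sub continuous_const).norm) continuous_const
  exact closure_minimal hf.radius hcl hx

theorem side_closure (hf : IsFaceFrame Ω k c σ a R y₀) {x : 𝔼 (n + 1)}
    (hx : x ∈ closure Ω) : 0 ≤ σ * (x k - c) := by
  have hcl : IsClosed {x : 𝔼 (n + 1) | 0 ≤ σ * (x k - c)} :=
    isClosed_le continuous_const (by fun_prop)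
  exact closure_minimal (fun x hx => (hf.side x hx).le) hcl hx

theorem le_gauge (hf : IsFaceFrame Ω k c σ a R y₀) (y : Fin n → ℝ) :
    ‖y‖ / R ≤ gauge (faceSet Ω k c y₀) y := by
  refine le_gauge_of_subset_closedBall (absorbent_nhds_zero hf.faceSet_mem_nhds) hf.radius_pos.le
    fun y hy => ?_
  have := hf.norm_le_of_mem_closure hy
  rwa [dropCoord_linePoint, add_sub_cancel_left, ← mem_closedBall_zero_iff] at this

/-- The face contains the ball of radius `a`, which bounds its gauge; dually `le_gauge` holds
because the face lies in a ball of radius `R`. -/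
theorem gauge_le (hf : IsFaceFrame Ω k c σ a R y₀) (hc : Convex ℝ Ω) :
    LipschitzWith (Real.toNNReal a)⁻¹ (gauge (faceSet Ω k c y₀)) :=
  (convex_faceSet hc).lipschitzWith_gauge (Real.toNNReal_pos.2 hf.pos) (by
    rw [Real.coe_toNNReal _ hf.pos.le]
    exact hf.ball_subset)

theorem gauge_le_one_iff (hf : IsFaceFrame Ω k c σ a R y₀) (hc : Convex ℝ Ω) {y : Fin n → ℝ} :
    gauge (faceSet Ω k c y₀) y ≤ 1 ↔ y ∈ faceSet Ω k c y₀ := by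
  rw [gauge_le_one_iff_mem_closure (convex_faceSet hc) hf.faceSet_mem_nhds,
    isClosed_faceSet.closure_eq]

theorem lipschitz_edgeDist (hf : IsFaceFrame Ω k c σ a R y₀) (hc : Convex ℝ Ω) :
    ∃ K, LipschitzWith K (edgeDist Ω k c y₀) := by
  have h1 : LipschitzWith 1 fun x : 𝔼 (n + 1) => |x k - c| := by
    refine LipschitzWith.of_dist_le_mul fun x y => ?_
    rw [NNReal.coe_one, one_mul, dist_eq_norm x y, Real.dist_eq]
    refine (abs_abs_sub_abs_le _ _).trans ?_
    rw [sub_sub_sub_cancel_right]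
    exact PiLp.norm_apply_le (x - y) k
  have h2 : LipschitzWith ((Real.toNNReal a)⁻¹ * 1)
      fun x : 𝔼 (n + 1) => gauge (faceSet Ω k c y₀) (dropCoord k x - y₀) := by
    refine (hf.gauge_le hc).comp (LipschitzWith.of_dist_le_mul fun x y => ?_)
    rw [dist_sub_right]
    exact (lipschitz_dropCoord k).dist_le_mul x y
  have h3 : LipschitzWith ((Real.toNNReal a)⁻¹ * 1)
      fun x : 𝔼 (n + 1) => |gauge (faceSet Ω k c y₀) (dropCoord k x - y₀) - 1| := by
    refine LipschitzWith.of_dist_le_mul fun x y => ?_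
    rw [Real.dist_eq]
    refine (abs_abs_sub_abs_le _ _).trans ?_
    rw [sub_sub_sub_cancel_right, ← Real.dist_eq]
    exact h2.dist_le_mul x y
  exact ⟨_, h1.add h3⟩

theorem edgeDist_pos (hf : IsFaceFrame Ω k c σ a R y₀) {x : 𝔼 (n + 1)} (hx : x ∈ Ω) :
    0 < edgeDist Ω k c y₀ x := by
  have h := hf.side x hx
  have : 0 < |x k - c| := abs_pos.2 fun h0 => by rw [h0, mul_zero] at h; exact h.false
  unfold edgeDist
  positivity

/-- The edge of the flat face is the zero set of `edgeDist`. -/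
theorem edgeDist_eq_zero (hf : IsFaceFrame Ω k c σ a R y₀) (hΩo : IsOpen Ω) (hc : Convex ℝ Ω)
    {x : 𝔼 (n + 1)} (hx : x ∈ frontier Ω) (hxk : x k = c)
    (hxc : x ∈ closure (frontier Ω ∩ {y | y k ≠ c})) : edgeDist Ω k c y₀ x = 0 := by
  set g : (𝔼 (n + 1)) → ℝ := fun x => gauge (faceSet Ω k c y₀) (dropCoord k x - y₀) with hg
  have hgc : Continuous g := ((hf.gauge_le hc).continuous).comp
    ((lipschitz_dropCoord k).continuous.sub continuous_const)
  have h1 : g x ≤ 1 := by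
    refine (hf.gauge_le_one_iff hc).2 ?_
    show linePoint k c (y₀ + (dropCoord k x - y₀)) ∈ closure Ω
    rw [add_sub_cancel, ← hxk, linePoint_dropCoord]
    exact frontier_subset_closure hx
  -- If the gauge were less than one at `x`, a nearby boundary point off the hyperplane would be a
  -- convex combination, with positive weight `l`, of the interior point at height `a/2` above `y₀`
  -- and a point of the face. It would then be interior to `Ω`.
  have h2 : 1 ≤ g x := by
    by_contra! hlt
    have ha := hf.pos
    set b := a / 2 with hb
    have hb0 : 0 < b := by positivity
    have hopen : IsOpen {x' : 𝔼 (n + 1) | g x' + σ * (x' k - c) / b < 1} :=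
      isOpen_lt (by fun_prop) continuous_const
    obtain ⟨x', hx', hx'f, hx'k⟩ := mem_closure_iff.1 hxc _ hopen (by
      simpa [hxk] using hlt)
    have hx'c : x' ∈ closure Ω := frontier_subset_closure hx'f
    have hσ0 : σ ≠ 0 := by rcases hf.sign with h | h <;> rw [h] <;> norm_num
    have ht : 0 < σ * (x' k - c) := (hf.side_closure hx'c).lt_of_ne
      (mul_ne_zero hσ0 (sub_ne_zero.2 hx'k)).symm
    have hσσ : σ * σ = 1 := by rcases hf.sign with h | h <;> rw [h] <;> norm_num
    set l := σ * (x' k - c) / b with hl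
    have hl0 : 0 < l := div_pos ht hb0
    have hg0 : 0 ≤ g x' := gauge_nonneg _
    simp only [Set.mem_ofPred_eq] at hx'
    have hl1 : 0 < 1 - l := by linarith
    have hmem : (1 - l)⁻¹ • (dropCoord k x' - y₀) ∈ faceSet Ω k c y₀ := by
      rw [← hf.gauge_le_one_iff hc, gauge_smul_of_nonneg (inv_nonneg.2 hl1.le), smul_eq_mul,
        inv_mul_le_iff₀ hl1]
      change g x' ≤ _
      linarith
    have hx0 : linePoint k (c + σ * b) (y₀ + 0) ∈ Ω :=
      hf.cylinder b 0 hb0 (by rw [hb]; linarith) (by simpa using ha)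
    have := hc.combo_interior_closure_mem_interior (hΩo.interior_eq.symm ▸ hx0) hmem hl0 hl1.le
      (by ring)
    rw [hΩo.interior_eq, linePoint_combo] at this
    have e1 : l * (c + σ * b) + (1 - l) * c = x' k := by
      have : l * b = σ * (x' k - c) := div_mul_cancel₀ _ hb0.ne'
      linear_combination σ * this + (x' k - c) * hσσ
    have e2 : l • (y₀ + 0) + (1 - l) • (y₀ + (1 - l)⁻¹ • (dropCoord k x' - y₀)) =
        dropCoord k x' := by
      rw [smul_add (1 - l), smul_inv_smul₀ hl1.ne']
      module
    rw [e1, e2, linePoint_dropCoord] at this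
    exact hx'f.2 (hΩo.interior_eq.symm ▸ this)
  have h3 : g x = 1 := le_antisymm h1 h2
  simp only [edgeDist, hxk, sub_self, abs_zero, zero_add]
  rw [show gauge (faceSet Ω k c y₀) (dropCoord k x - y₀) = 1 from h3, sub_self, abs_zero]

end IsFaceFrame

end Frame

end

/-! ### Plane sections of the domain and their corners. -/

section

section Sections

variable {n : ℕ} {Ω : Set (𝔼 (n + 1))} {k : Fin (n + 1)} {c σ a R : ℝ} {y₀ y : Fin n → ℝ}

/-- `linePoint` as a continuous linear map. -/
def linePointL (k : Fin (n + 1)) : (ℝ × (Fin n → ℝ)) →L[ℝ] 𝔼 (n + 1) :=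
  LinearMap.toContinuousLinearMap
    { toFun := fun p => linePoint k p.1 p.2
      map_add' := fun p q => by
        have := linePoint_combo k p.1 q.1 1 1 p.2 q.2
        simpa using this.symm
      map_smul' := fun s p => by
        have := linePoint_combo k p.1 0 s 0 p.2 0
        simpa using this.symm }

theorem linePointL_apply (k : Fin (n + 1)) (p : ℝ × (Fin n → ℝ)) :
    linePointL k p = linePoint k p.1 p.2 := rfl

/-- The linear part of `sectionMap`. -/
def sectionLin (k : Fin (n + 1)) (σ : ℝ) (y : Fin n → ℝ) : (ℝ × ℝ) →L[ℝ] 𝔼 (n + 1) :=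
  (linePointL k).comp ((σ • ContinuousLinearMap.fst ℝ ℝ ℝ).prod
    ((ContinuousLinearMap.snd ℝ ℝ ℝ).smulRight y))

theorem sectionMap_eq (w : ℝ × ℝ) :
    sectionMap k c σ y₀ y w = linePoint k c y₀ + sectionLin k σ y w := by
  have h := (linePointL k).map_add (c, y₀) (σ * w.1, w.2 • y)
  simp only [linePointL_apply] at h
  simpa [sectionMap, sectionLin, linePointL_apply] using h

theorem norm_sectionLin_le (hσ : σ = 1 ∨ σ = -1) (hy : y ∈ shell (Fin n → ℝ)) :
    ‖sectionLin k σ y‖ ≤ 2 * ‖linePointL k‖ := by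
  refine ContinuousLinearMap.opNorm_le_bound _ (by positivity) fun w => ?_
  have hσ1 : |σ| = 1 := by rcases hσ with h | h <;> rw [h] <;> norm_num
  have h1 : ‖((σ * w.1, w.2 • y) : ℝ × (Fin n → ℝ))‖ ≤ 2 * ‖w‖ := by
    rw [Prod.norm_def, max_le_iff]
    have e1 := norm_fst_le w
    have e2 := norm_snd_le w
    have e3 := norm_nonneg w
    constructor
    · rw [norm_mul, Real.norm_eq_abs, hσ1]
      linarith
    · rw [norm_smul]
      nlinarith [hy.1, hy.2, norm_nonneg w.2]
  calc ‖sectionLin k σ y w‖ = ‖linePointL k (σ * w.1, w.2 • y)‖ := rfl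
    _ ≤ ‖linePointL k‖ * (2 * ‖w‖) := ((linePointL k).le_opNorm _).trans (by gcongr)
    _ = _ := by ring

theorem hasFDerivAt_sectionMap (w : ℝ × ℝ) :
    HasFDerivAt (sectionMap k c σ y₀ y) (sectionLin k σ y) w := by
  have : sectionMap k c σ y₀ y = fun w => linePoint k c y₀ + sectionLin k σ y w :=
    funext sectionMap_eq
  rw [this]
  exact (sectionLin k σ y).hasFDerivAt.const_add _

theorem contDiff_sectionMap : ContDiff ℝ ∞ (sectionMap k c σ y₀ y) := by
  have : sectionMap k c σ y₀ y = fun w => linePoint k c y₀ + sectionLin k σ y w :=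
    funext sectionMap_eq
  rw [this]
  exact contDiff_const.add (sectionLin k σ y).contDiff

theorem gradE_comp_sectionMap_le {φ : (𝔼 (n + 1)) → ℝ} (hφ : ContDiff ℝ ∞ φ)
    (hσ : σ = 1 ∨ σ = -1) (hy : y ∈ shell (Fin n → ℝ)) (w : ℝ × ℝ) :
    gradE (φ ∘ sectionMap k c σ y₀ y) w ≤
      ENNReal.ofReal ((2 * ‖linePointL k‖) ^ 2) * gradE φ (sectionMap k c σ y₀ y w) := by
  have h := (((hφ.differentiable (by simp)) (sectionMap k c σ y₀ y w)).hasFDerivAt.comp w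
    (hasFDerivAt_sectionMap w)).fderiv
  unfold gradE
  rw [h, ← ENNReal.ofReal_mul (by positivity), ← mul_pow]
  refine ENNReal.ofReal_le_ofReal (pow_le_pow_left₀ (norm_nonneg _) ?_ 2)
  refine (ContinuousLinearMap.opNorm_comp_le _ _).trans ?_
  rw [mul_comm]
  exact mul_le_mul_of_nonneg_right (norm_sectionLin_le hσ hy) (norm_nonneg _)

theorem sectionMap_combo (w v : ℝ × ℝ) {α β : ℝ} (h : α + β = 1) :
    sectionMap k c σ y₀ y (α • w + β • v) =
      α • sectionMap k c σ y₀ y w + β • sectionMap k c σ y₀ y v := by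
  simp only [sectionMap_eq, map_add, map_smul]
  obtain rfl : β = 1 - α := by linarith
  module

/-- The part of a plane section of `Ω` away from the axis. -/
def sectionDomain (Ω : Set (𝔼 (n + 1))) (k : Fin (n + 1)) (c σ η : ℝ) (y₀ y : Fin n → ℝ) :
    Set (ℝ × ℝ) :=
  {w | sectionMap k c σ y₀ y w ∈ Ω ∧ η < w.2}

/-- The point where a plane section of `Ω` meets the edge of the flat face. -/
def sectionCorner (Ω : Set (𝔼 (n + 1))) (k : Fin (n + 1)) (c : ℝ) (y₀ y : Fin n → ℝ) : ℝ × ℝ :=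
  (0, (gauge (faceSet Ω k c y₀) y)⁻¹)

theorem isOpen_sectionDomain (hΩo : IsOpen Ω) {η : ℝ} :
    IsOpen (sectionDomain Ω k c σ η y₀ y) :=
  (hΩo.preimage contDiff_sectionMap.continuous).inter (isOpen_lt continuous_const continuous_snd)

theorem convex_sectionDomain (hc : Convex ℝ Ω) {η : ℝ} :
    Convex ℝ (sectionDomain Ω k c σ η y₀ y) := by
  have h2 : Convex ℝ {w : ℝ × ℝ | η < w.2} :=
    convex_halfSpace_gt (f := fun w : ℝ × ℝ => w.2) ⟨fun _ _ => rfl, fun _ _ => rfl⟩ η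
  intro w hw v hv α β hα hβ hαβ
  refine ⟨?_, h2 hw.2 hv.2 hα hβ hαβ⟩
  rw [sectionMap_combo w v hαβ]
  exact hc hw.1 hv.1 hα hβ hαβ

namespace IsFaceFrame

theorem gauge_pos (hf : IsFaceFrame Ω k c σ a R y₀) (hy : y ∈ shell (Fin n → ℝ)) :
    0 < gauge (faceSet Ω k c y₀) y :=
  (div_pos (one_pos.trans_le hy.1) hf.radius_pos).trans_le (hf.le_gauge y)

theorem corner_le (hf : IsFaceFrame Ω k c σ a R y₀) (hy : y ∈ shell (Fin n → ℝ)) :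
    (gauge (faceSet Ω k c y₀) y)⁻¹ ≤ R := by
  rw [inv_le_comm₀ (hf.gauge_pos hy) hf.radius_pos]
  refine le_trans ?_ (hf.le_gauge y)
  rw [← one_div]
  exact div_le_div_of_nonneg_right hy.1 hf.radius_pos.le

theorem le_corner (hf : IsFaceFrame Ω k c σ a R y₀) (hc : Convex ℝ Ω)
    (hy : y ∈ shell (Fin n → ℝ)) : a / 2 ≤ (gauge (faceSet Ω k c y₀) y)⁻¹ := by
  have ha := hf.pos
  have h := (hf.gauge_le hc).dist_le_mul y 0
  rw [gauge_zero, dist_zero_right, dist_zero_right, Real.norm_eq_abs, NNReal.coe_inv,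
    Real.coe_toNNReal _ ha.le] at h
  rw [le_inv_comm₀ (by positivity) (hf.gauge_pos hy)]
  calc _ ≤ a⁻¹ * ‖y‖ := (le_abs_self _).trans h
    _ ≤ a⁻¹ * 2 := by gcongr; exact hy.2
    _ = _ := by field_simp

/-- Both coordinates of `w` lie between `a/8` and `3a/8`, and `‖y‖ ≤ 2`, so the point stays in the
cylinder of size `a`. This ball is the reference ball of the planar estimate. -/
theorem ball_subset_sectionDomain (hf : IsFaceFrame Ω k c σ a R y₀)
    (hy : y ∈ shell (Fin n → ℝ)) {w : ℝ × ℝ}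
    (hw : w ∈ Metric.ball ((2 * (a / 8), 2 * (a / 8)) : ℝ × ℝ) (a / 8)) :
    w ∈ sectionDomain Ω k c σ (a / 8) y₀ y ∧ a / 8 < w.1 ∧ w.1 < 3 * (a / 8) ∧
      w.2 < 3 * (a / 8) := by
  have ha := hf.pos
  rw [Metric.mem_ball, Prod.dist_eq, max_lt_iff, Real.dist_eq, Real.dist_eq, abs_lt, abs_lt] at hw
  obtain ⟨⟨h1, h2⟩, h3, h4⟩ := hw
  simp only at h1 h2 h3 h4
  refine ⟨⟨hf.cylinder _ _ (by linarith) (by linarith) ?_, by linarith⟩, by linarith, by linarith,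
    by linarith⟩
  rw [norm_smul, Real.norm_of_nonneg (by linarith)]
  nlinarith [hy.1, hy.2]

/-- The corner maps into the face, hence into the closure of `Ω`; move from it towards the centre of
the reference ball. The second coordinate stays above `a/8` since it is at least `a/2` at the
corner. -/
theorem corner_mem_closure (hf : IsFaceFrame Ω k c σ a R y₀) (hΩo : IsOpen Ω) (hc : Convex ℝ Ω)
    (hy : y ∈ shell (Fin n → ℝ)) :
    sectionCorner Ω k c y₀ y ∈ closure (sectionDomain Ω k c σ (a / 8) y₀ y) := by
  have ha := hf.pos
  set e := sectionCorner Ω k c y₀ y with he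
  set w : ℝ × ℝ := (2 * (a / 8), 2 * (a / 8)) with hw
  have hwD := (hf.ball_subset_sectionDomain hy (Metric.mem_ball_self (x := w) (by positivity))).1
  have hg := hf.gauge_pos hy
  have hec : sectionMap k c σ y₀ y e ∈ closure Ω := by
    have : (gauge (faceSet Ω k c y₀) y)⁻¹ • y ∈ faceSet Ω k c y₀ := by
      rw [← hf.gauge_le_one_iff hc, gauge_smul_of_nonneg (inv_nonneg.2 hg.le), smul_eq_mul,
        inv_mul_cancel₀ hg.ne']
    have h0 : c + σ * e.1 = c := by simp [he, sectionCorner]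
    unfold sectionMap
    rw [h0]
    exact this
  have hcont : Continuous fun t : ℝ => t • w + (1 - t) • e := by fun_prop
  have hlim : Tendsto (fun t : ℝ => t • w + (1 - t) • e) (𝓝[>] 0) (𝓝 e) := by
    have := (hcont.tendsto 0).mono_left (nhdsWithin_le_nhds (s := Set.Ioi 0))
    simpa using this
  refine mem_closure_of_tendsto hlim ?_
  filter_upwards [Ioo_mem_nhdsGT (one_pos (α := ℝ))] with t ht
  constructor
  · rw [sectionMap_combo w e (by ring)]
    have := hc.combo_interior_closure_mem_interior (hΩo.interior_eq.symm ▸ hwD.1) hec ht.1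
      (by linarith [ht.2] : 0 ≤ 1 - t) (by ring)
    rwa [hΩo.interior_eq] at this
  · have h1 : a / 2 ≤ e.2 := hf.le_corner hc hy
    have h2 : w.2 = 2 * (a / 8) := rfl
    simp only [Prod.snd_add, Prod.smul_snd, smul_eq_mul, h2]
    nlinarith [ht.1, ht.2]

theorem snd_le_of_mem (hf : IsFaceFrame Ω k c σ a R y₀) (hy : y ∈ shell (Fin n → ℝ)) {w : ℝ × ℝ}
    (hw0 : 0 < w.2) (hw : sectionMap k c σ y₀ y w ∈ Ω) : w.2 ≤ R := by
  have := hf.radius _ hw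
  rw [sectionMap, dropCoord_linePoint, add_sub_cancel_left, norm_smul,
    Real.norm_of_nonneg hw0.le] at this
  nlinarith [hy.1]

/-- With `s` the inverse gauge of `y`, `edgeDist` on the section is `|w₁| + |w₂/s - 1|`, so it
controls the distance to the corner `(0, s)` up to the factor `s ≤ R`. The condition `r ≤ 1/2` gives
`w₂ ≥ s/2 ≥ a/4`, away from the axis. -/
theorem mem_closedBall_corner (hf : IsFaceFrame Ω k c σ a R y₀) (hc : Convex ℝ Ω)
    (hy : y ∈ shell (Fin n → ℝ)) {w : ℝ × ℝ} {r : ℝ} (hr : r ≤ 1 / 2) (hw0 : 0 < w.2)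
    (hw : sectionMap k c σ y₀ y w ∈ Ω) (hwr : edgeDist Ω k c y₀ (sectionMap k c σ y₀ y w) ≤ r) :
    w ∈ sectionDomain Ω k c σ (a / 8) y₀ y ∧
      w ∈ Metric.closedBall (sectionCorner Ω k c y₀ y) ((R + 1) * r) := by
  have ha := hf.pos
  have hg := hf.gauge_pos hy
  have hR := hf.radius_pos
  have hσ1 : |σ| = 1 := by rcases hf.sign with h | h <;> rw [h] <;> norm_num
  set s := (gauge (faceSet Ω k c y₀) y)⁻¹ with hs
  have hs0 : 0 < s := inv_pos.2 hg
  have hsg : s * gauge (faceSet Ω k c y₀) y = 1 := inv_mul_cancel₀ hg.ne'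
  have hk : (sectionMap k c σ y₀ y w) k = c + σ * w.1 := by simp [sectionMap, linePoint]
  rw [edgeDist, hk, add_sub_cancel_left, abs_mul, hσ1, one_mul, sectionMap, dropCoord_linePoint,
    add_sub_cancel_left, gauge_smul_of_nonneg hw0.le, smul_eq_mul] at hwr
  have h1 : |w.1| ≤ r := by linarith [abs_nonneg (w.2 * gauge (faceSet Ω k c y₀) y - 1)]
  have h2 : |w.2 * gauge (faceSet Ω k c y₀) y - 1| ≤ r := by linarith [abs_nonneg w.1]
  have h3 : |w.2 - s| ≤ s * r := by
    have : w.2 - s = s * (w.2 * gauge (faceSet Ω k c y₀) y - 1) := by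
      linear_combination -w.2 * hsg
    rw [this, abs_mul, abs_of_pos hs0]
    gcongr
  have hsR : s ≤ R := hf.corner_le hy
  have has : a / 2 ≤ s := hf.le_corner hc hy
  have hr0 : 0 ≤ r := (abs_nonneg _).trans h1
  refine ⟨⟨hw, ?_⟩, ?_⟩
  · have := (abs_le.1 h3).1
    nlinarith
  · rw [Metric.mem_closedBall, Prod.dist_eq, max_le_iff, Real.dist_eq, Real.dist_eq]
    change |w.1 - 0| ≤ _ ∧ |w.2 - s| ≤ _
    rw [sub_zero]
    constructor <;> nlinarith

/-- The lower bound comes from the first coordinate, which vanishes at the corner and exceeds `a/8`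
on the ball. -/
theorem corner_bounds (hf : IsFaceFrame Ω k c σ a R y₀) (hc : Convex ℝ Ω)
    (hy : y ∈ shell (Fin n → ℝ)) {w : ℝ × ℝ}
    (hw : w ∈ Metric.ball ((2 * (a / 8), 2 * (a / 8)) : ℝ × ℝ) (a / 8)) :
    a / 8 ≤ ‖w - sectionCorner Ω k c y₀ y‖ ∧ ‖w - sectionCorner Ω k c y₀ y‖ ≤ R + a := by
  have ha := hf.pos
  have hR := hf.radius_pos
  obtain ⟨h1, h2, h3, h4⟩ := hf.ball_subset_sectionDomain hy hw
  have h5 := h1.2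
  have hsR := hf.corner_le hy
  have has := hf.le_corner hc hy
  have e1 : (w - sectionCorner Ω k c y₀ y).1 = w.1 := sub_zero _
  have e2 : (w - sectionCorner Ω k c y₀ y).2 = w.2 - (gauge (faceSet Ω k c y₀) y)⁻¹ := rfl
  constructor
  · refine le_trans ?_ (norm_fst_le _)
    rw [e1, Real.norm_eq_abs]
    exact h2.le.trans (le_abs_self _)
  · rw [Prod.norm_def, max_le_iff, e1, e2, Real.norm_eq_abs, Real.norm_eq_abs, abs_le, abs_le]
    refine ⟨⟨?_, ?_⟩, ?_, ?_⟩ <;> linarith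

end IsFaceFrame

end Sections

end

/-! ### Mean squares near the edge of the face. -/

section

section Edge

variable {n : ℕ} {Ω : Set (𝔼 (n + 1))} {k : Fin (n + 1)} {c σ a R : ℝ} {y₀ : Fin n → ℝ}

/-- The planar corner estimate with the weight `w₂ⁿ⁻¹` inserted: on the section domain `a/8 < w₂ ≤
R`, so the weight lies between positive constants. These bounds, like those for corner and ball, are
uniform in `y`. -/
theorem IsFaceFrame.exists_section_le (hf : IsFaceFrame Ω k c σ a R y₀) (hΩo : IsOpen Ω)
    (hc : Convex ℝ Ω) : ∃ C : ENNReal, C ≠ ⊤ ∧ ∀ y ∈ shell (Fin n → ℝ),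
    ∀ (φ : (𝔼 (n + 1)) → ℝ) (r : ℝ), ContDiff ℝ ∞ φ → 0 < r → r ≤ 1 / 2 →
    ∫⁻ w in {w : ℝ × ℝ | 0 < w.2}, ENNReal.ofReal (w.2 ^ n * w.2⁻¹) *
        (Ω ∩ {x | edgeDist Ω k c y₀ x ≤ r}).indicator (sqE φ) (sectionMap k c σ y₀ y w) ≤
      C * ENNReal.ofReal (r ^ 2 * (1 + Real.log (1 / r))) *
        ∫⁻ w in {w : ℝ × ℝ | 0 < w.2}, ENNReal.ofReal (w.2 ^ n * w.2⁻¹) *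
          Ω.indicator (fun x => sqE φ x + gradE φ x) (sectionMap k c σ y₀ y w) := by
  have ha := hf.pos
  have hR := hf.radius_pos
  obtain ⟨C, hC, hcor⟩ := exists_lintegral_corner_le (volume : Measure (ℝ × ℝ)) (by simp)
    (δ := a / 8) (m := a / 8) (M := R + a) (C₁ := R + 1) (by positivity) (by positivity)
    (by linarith) (by linarith)
  set β := ENNReal.ofReal (R ^ n * (a / 8)⁻¹) with hβ
  set γ := ENNReal.ofReal (((a / 8) ^ n * R⁻¹)⁻¹) with hγ
  set κ := ENNReal.ofReal ((2 * ‖linePointL k‖) ^ 2) with hκ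
  refine ⟨β * C * (1 + κ) * γ, by finiteness, ?_⟩
  intro y hy φ r hφ hr hr2
  set X := ENNReal.ofReal (r ^ 2 * (1 + Real.log (1 / r))) with hX
  set D := sectionDomain Ω k c σ (a / 8) y₀ y with hD
  set e := sectionCorner Ω k c y₀ y with he
  set L := sectionMap k c σ y₀ y with hL
  have hDo : IsOpen D := isOpen_sectionDomain hΩo
  have hDpos : ∀ w ∈ D, 0 < w.2 := fun w hw => (by positivity : 0 < a / 8).trans hw.2
  have hLc : ContDiff ℝ ∞ L := contDiff_sectionMap
  have hS : MeasurableSet {w : ℝ × ℝ | 0 < w.2} :=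
    (isOpen_lt continuous_const continuous_snd).measurableSet
  have h1 := hcor D e _ (φ ∘ L) r hDo (convex_sectionDomain hc) (hf.corner_mem_closure hΩo hc hy)
    (fun w hw => (hf.ball_subset_sectionDomain hy hw).1) (fun w hw => hf.corner_bounds hc hy hw)
    (hφ.comp hLc) hr (by linarith)
  have hB : MeasurableSet (D ∩ Metric.closedBall e ((R + 1) * r)) :=
    hDo.measurableSet.inter Metric.isClosed_closedBall.measurableSet
  have h2 : ∫⁻ w in {w : ℝ × ℝ | 0 < w.2}, ENNReal.ofReal (w.2 ^ n * w.2⁻¹) *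
        (Ω ∩ {x | edgeDist Ω k c y₀ x ≤ r}).indicator (sqE φ) (L w) ≤
      β * ∫⁻ w in D ∩ Metric.closedBall e ((R + 1) * r), sqE (φ ∘ L) w := by
    rw [← lintegral_const_mul' _ _ ENNReal.ofReal_ne_top, ← lintegral_indicator hB,
      ← lintegral_indicator hS]
    refine lintegral_mono fun w => ?_
    by_cases hw : 0 < w.2 ∧ L w ∈ Ω ∩ {x | edgeDist Ω k c y₀ x ≤ r}
    · obtain ⟨hw0, hwL⟩ := hw
      have hmem := hf.mem_closedBall_corner hc hy hr2 hw0 hwL.1 hwL.2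
      rw [Set.indicator_of_mem (show w ∈ D ∩ Metric.closedBall e ((R + 1) * r) from hmem),
        Set.indicator_of_mem (show w ∈ {w : ℝ × ℝ | 0 < w.2} from hw0), Set.indicator_of_mem hwL]
      refine mul_le_mul_left (ENNReal.ofReal_le_ofReal ?_) _
      have := hf.snd_le_of_mem hy hw0 hwL.1
      have h3 : a / 8 < w.2 := hmem.1.2
      gcongr
    · refine le_trans (b := 0) (le_of_eq ?_) zero_le
      by_cases hw0 : 0 < w.2
      · rw [Set.indicator_of_mem (show w ∈ {w : ℝ × ℝ | 0 < w.2} from hw0),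
          Set.indicator_of_notMem (fun h => hw ⟨hw0, h⟩), mul_zero]
      · rw [Set.indicator_of_notMem (show w ∉ {w : ℝ × ℝ | 0 < w.2} from hw0)]
  have h3 : (∫⁻ w in D, sqE (φ ∘ L) w) + ∫⁻ w in D, gradE (φ ∘ L) w ≤
      (1 + κ) * ∫⁻ w in D, (sqE φ (L w) + gradE φ (L w)) := by
    rw [← lintegral_add_left (continuous_sqE (hφ.comp hLc)).measurable,
      ← lintegral_const_mul' _ _ (by finiteness)]
    refine lintegral_mono fun w => ?_
    have h4 := gradE_comp_sectionMap_le (k := k) (c := c) (y₀ := y₀) hφ hf.sign hy w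
    calc _ ≤ sqE φ (L w) + κ * gradE φ (L w) := add_le_add le_rfl h4
      _ ≤ (1 + κ) * sqE φ (L w) + (1 + κ) * gradE φ (L w) :=
        add_le_add (le_mul_of_one_le_left zero_le le_self_add) (mul_le_mul_left le_add_self _)
      _ = _ := by ring
  have h4 : ∫⁻ w in D, (sqE φ (L w) + gradE φ (L w)) ≤
      γ * ∫⁻ w in {w : ℝ × ℝ | 0 < w.2}, ENNReal.ofReal (w.2 ^ n * w.2⁻¹) *
          Ω.indicator (fun x => sqE φ x + gradE φ x) (L w) := by
    rw [← lintegral_const_mul' _ _ ENNReal.ofReal_ne_top, ← lintegral_indicator hDo.measurableSet,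
      ← lintegral_indicator hS]
    refine lintegral_mono fun w => ?_
    by_cases hw : w ∈ D
    · have hw0 := hDpos w hw
      rw [Set.indicator_of_mem hw,
        Set.indicator_of_mem (show w ∈ {w : ℝ × ℝ | 0 < w.2} from hw0), Set.indicator_of_mem hw.1,
        ← mul_assoc, ← ENNReal.ofReal_mul (by positivity)]
      refine le_mul_of_one_le_left zero_le (ENNReal.one_le_ofReal.2 ?_)
      rw [← div_eq_inv_mul, one_le_div (by positivity)]
      have := hf.snd_le_of_mem hy hw0 hw.1
      have h5 : a / 8 < w.2 := hw.2
      gcongr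
    · rw [Set.indicator_of_notMem hw]
      exact zero_le
  calc _ ≤ β * (C * X * ((1 + κ) * (γ * ∫⁻ w in {w : ℝ × ℝ | 0 < w.2},
          ENNReal.ofReal (w.2 ^ n * w.2⁻¹) *
            Ω.indicator (fun x => sqE φ x + gradE φ x) (L w)))) := by
        refine h2.trans (mul_le_mul_right (h1.trans (mul_le_mul_right (h3.trans ?_) _)) _)
        exact mul_le_mul_right h4 _
    _ = _ := by ring

/-- The mean square of an `H¹` function over a neighbourhood of width `r` of the edge of the flat
face grows at most like `r² log (1 / r)`. -/
theorem IsFaceFrame.exists_lintegral_edge_le [Nonempty (Fin n)]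
    (hf : IsFaceFrame Ω k c σ a R y₀) (hΩo : IsOpen Ω) (hc : Convex ℝ Ω) :
    ∃ C : ENNReal, C ≠ ⊤ ∧ ∀ (φ : (𝔼 (n + 1)) → ℝ) (r : ℝ), ContDiff ℝ ∞ φ → 0 < r → r ≤ 1 / 2 →
      ∫⁻ x in Ω ∩ {x | edgeDist Ω k c y₀ x ≤ r}, sqE φ x ≤
        C * ENNReal.ofReal (r ^ 2 * (1 + Real.log (1 / r))) *
          ∫⁻ x in Ω, (sqE φ x + gradE φ x) := by
  obtain ⟨C, hC, h⟩ := hf.exists_section_le hΩo hc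
  refine ⟨C, hC, fun φ r hφ hr hr2 => ?_⟩
  obtain ⟨K, hK⟩ := hf.lipschitz_edgeDist hc
  have hA : MeasurableSet (Ω ∩ {x | edgeDist Ω k c y₀ x ≤ r}) :=
    hΩo.measurableSet.inter (isClosed_le hK.continuous continuous_const).measurableSet
  have hm1 := (continuous_sqE hφ).measurable
  have hm2 := (continuous_gradE hφ).measurable
  have e1 := lintegral_sectionMap k (c := c) hf.sign y₀ (hm1.indicator hA)
  have e2 := lintegral_sectionMap k (c := c) hf.sign y₀
    ((hm1.add hm2).indicator hΩo.measurableSet)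
  rw [lintegral_indicator hA] at e1
  rw [lintegral_indicator hΩo.measurableSet] at e2
  have hl0 : ENNReal.ofReal (Real.log 2) ≠ 0 := by
    rw [Ne, ENNReal.ofReal_eq_zero, not_le]
    exact Real.log_pos one_lt_two
  -- Both sides carry the factor `log 2` from the shell formula; it is cancelled.
  refine (ENNReal.mul_le_mul_iff_right hl0 ENNReal.ofReal_ne_top).1 ?_
  rw [mul_left_comm, ← e1]
  refine le_trans ?_ (mul_le_mul_right e2.le _)
  rw [← lintegral_const_mul' _ _ (by finiteness)]
  exact setLIntegral_mono' measurableSet_shell fun y hy => h y hy φ r hφ hr hr2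

theorem gradE_le {d : ℕ} {φ : (𝔼 d) → ℝ} (x : 𝔼 d) :
    gradE φ x ≤ ENNReal.ofReal (d * ∑ i, partialDeriv i φ x ^ 2) := by
  refine ENNReal.ofReal_le_ofReal ?_
  have h1 : ‖fderiv ℝ φ x‖ ≤ ∑ i, |partialDeriv i φ x| := by
    refine ContinuousLinearMap.opNorm_le_bound _ (Finset.sum_nonneg fun i _ => abs_nonneg _)
      fun v => ?_
    have hv : v = ∑ i, v i • EuclideanSpace.single i (1 : ℝ) := by
      ext l
      simp [Pi.single_apply]
    have : fderiv ℝ φ x v = ∑ i, v i * partialDeriv i φ x := by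
      conv_lhs => rw [hv]
      simp [partialDeriv]
    rw [this, Finset.sum_mul]
    refine (Finset.abs_sum_le_sum_abs _ _).trans (Finset.sum_le_sum fun i _ => ?_)
    rw [abs_mul, mul_comm]
    exact mul_le_mul_of_nonneg_left (PiLp.norm_apply_le v i) (abs_nonneg _)
  calc ‖fderiv ℝ φ x‖ ^ 2 ≤ (∑ i, |partialDeriv i φ x|) ^ 2 :=
        pow_le_pow_left₀ (norm_nonneg _) h1 2
    _ ≤ (Finset.univ : Finset (Fin d)).card * ∑ i, |partialDeriv i φ x| ^ 2 :=
        sq_sum_le_card_mul_sum_sq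
    _ = _ := by simp

/-- Square integrals near the edge, for limits of smooth functions in `H¹`. -/
theorem IsFaceFrame.exists_integral_edge_le [Nonempty (Fin n)]
    (hf : IsFaceFrame Ω k c σ a R y₀) (hΩo : IsOpen Ω) (hΩ : Bornology.IsBounded Ω)
    (hc : Convex ℝ Ω) {φ : ℕ → (𝔼 (n + 1)) → ℝ} {f : (𝔼 (n + 1)) → ℝ}
    {f' : Fin (n + 1) → (𝔼 (n + 1)) → ℝ} (h : H1Lim Ω φ f f') :
    ∃ C : ℝ, 0 ≤ C ∧ ∀ r : ℝ, 0 < r → r ≤ 1 / 2 →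
      ∫ x in Ω ∩ {x | edgeDist Ω k c y₀ x ≤ r}, f x ^ 2 ≤ C * (r ^ 2 * (1 + Real.log (1 / r))) := by
  obtain ⟨C, hC, hle⟩ := hf.exists_lintegral_edge_le hΩo hc
  -- The squared `H¹` norm, with the gradient weighted by the dimension to dominate the square of
  -- the operator norm of the derivative; it passes to the limit along the approximation.
  set S : ((𝔼 (n + 1)) → ℝ) → (Fin (n + 1) → (𝔼 (n + 1)) → ℝ) → ℝ := fun g g' =>
    (∫ x in Ω, g x * g x) + (n + 1 : ℕ) * ∑ i, ∫ x in Ω, g' i x * g' i x with hS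
  have hlimS : Tendsto (fun m => S (φ m) (fun i => partialDeriv i (φ m))) atTop (𝓝 (S f f')) :=
    (h.lim.integral_mul h.lim).add
      ((tendsto_finsetSum _ fun i _ => (h.lim' i).integral_mul (h.lim' i)).const_mul _)
  have hS0 : ∀ g g', 0 ≤ S g g' := fun g g' => by
    refine add_nonneg (integral_nonneg fun x => mul_self_nonneg _)
      (mul_nonneg (Nat.cast_nonneg _) (Finset.sum_nonneg fun i _ =>
        integral_nonneg fun x => mul_self_nonneg _))
  refine ⟨C.toReal * S f f', mul_nonneg ENNReal.toReal_nonneg (hS0 _ _), fun r hr hr2 => ?_⟩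
  have hlog : 0 ≤ r ^ 2 * (1 + Real.log (1 / r)) := by
    have : 0 ≤ Real.log (1 / r) := Real.log_nonneg (by rw [le_div_iff₀ hr]; linarith)
    positivity
  set A := Ω ∩ {x | edgeDist Ω k c y₀ x ≤ r} with hA
  have hmono : volume.restrict A ≤ volume.restrict Ω :=
    Measure.restrict_mono Set.inter_subset_left le_rfl
  have hlA := h.lim.mono_measure hmono
  have hlimA := hlA.integral_mul hlA
  have hbound : ∀ m, ∫ x in A, φ m x * φ m x ≤
      C.toReal * S (φ m) (fun i => partialDeriv i (φ m)) * (r ^ 2 * (1 + Real.log (1 / r))) := by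
    intro m
    have hφ := h.contDiff m
    have hI := memLp_of_continuous hΩo hΩ hφ.continuous
    have hI' := fun i => memLp_of_continuous hΩo hΩ (continuous_partialDeriv hφ i)
    have i1 : Integrable (fun x => φ m x * φ m x) (volume.restrict Ω) :=
      (hI 2).integrable_mul (hI 2)
    have i2 : ∀ i, Integrable (fun x => partialDeriv i (φ m) x * partialDeriv i (φ m) x)
      (volume.restrict Ω) := fun i => (hI' i 2).integrable_mul (hI' i 2)
    have i3 : Integrable (fun x => φ m x * φ m x + ((n + 1 : ℕ) : ℝ) *
        ∑ i, partialDeriv i (φ m) x * partialDeriv i (φ m) x) (volume.restrict Ω) :=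
      i1.add ((integrable_finsetSum _ fun i _ => i2 i).const_mul _)
    have hsum : ∫⁻ x in Ω, (sqE (φ m) x + gradE (φ m) x) ≤
        ENNReal.ofReal (S (φ m) (fun i => partialDeriv i (φ m))) := by
      have e : S (φ m) (fun i => partialDeriv i (φ m)) = ∫ x in Ω, (φ m x * φ m x +
          (n + 1 : ℕ) * ∑ i, partialDeriv i (φ m) x * partialDeriv i (φ m) x) := by
        rw [integral_add i1 ((integrable_finsetSum _ fun i _ => i2 i).const_mul _),
          integral_const_mul, integral_finsetSum _ fun i _ => i2 i]
      rw [e, ofReal_integral_eq_lintegral_ofReal i3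
        (ae_of_all _ fun x => add_nonneg (mul_self_nonneg _) (mul_nonneg (Nat.cast_nonneg _)
          (Finset.sum_nonneg fun i _ => mul_self_nonneg _)))]
      refine lintegral_mono fun x => ?_
      rw [ENNReal.ofReal_add (mul_self_nonneg _) (mul_nonneg (Nat.cast_nonneg _)
          (Finset.sum_nonneg fun i _ => mul_self_nonneg _))]
      refine add_le_add ?_ ?_
      · rw [sqE, sq]
      · refine (gradE_le x).trans_eq ?_
        simp only [sq]
    have h2 := (hle (φ m) r hφ hr hr2).trans (mul_le_mul_right hsum _)
    have e3 : ∫⁻ x in A, sqE (φ m) x = ENNReal.ofReal (∫ x in A, φ m x * φ m x) := by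
      rw [ofReal_integral_eq_lintegral_ofReal (i1.mono_measure hmono)
        (ae_of_all _ fun x => mul_self_nonneg _)]
      simp only [sqE, sq]
    rw [e3, ← ENNReal.ofReal_toReal hC, ← ENNReal.ofReal_mul ENNReal.toReal_nonneg,
      ← ENNReal.ofReal_mul (by positivity), ENNReal.ofReal_le_ofReal_iff
        (mul_nonneg (by positivity) (hS0 _ _))] at h2
    linarith
  have := le_of_tendsto_of_tendsto' hlimA ((hlimS.const_mul C.toReal).mul_const _) hbound
  simpa only [sq (f _)] using this

end Edge

end

/-! ### Removing the edge. -/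

section

section EdgeCutoff

variable {d : ℕ} {Ω : Set (𝔼 d)} {ψ : (𝔼 d) → ℝ} {K : NNReal}

/-- A smooth cutoff function at scale `r` that removes the zero set of a Lipschitz function. -/
theorem exists_lipschitz_cutoff (hψ : LipschitzWith K ψ) {r : ℝ} (hr : 0 < r) :
    ∃ χ : (𝔼 d) → ℝ, ContDiff ℝ ∞ χ ∧ (∀ x, χ x ∈ Set.Icc (0 : ℝ) 1) ∧
      (∀ x, r ≤ ψ x → χ x = 1) ∧ tsupport χ ⊆ {x | r / 8 ≤ ψ x} ∧
      ∀ i x, |partialDeriv i χ x| ≤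
        Set.indicator {x | r / 8 ≤ ψ x ∧ ψ x ≤ r} (fun _ => 4 * K / r) x := by
  -- This is zero for `ψ ≤ r/4` and one for `ψ ≥ r/2`.
  set F : (𝔼 d) → ℝ := fun x => max 0 (min 1 (4 / r * ψ x - 1)) with hF
  have hFL : LipschitzWith (Real.toNNReal (4 * K / r)) F := by
    have h1 : LipschitzWith (Real.toNNReal (4 * K / r)) fun x => 4 / r * ψ x - 1 := by
      refine LipschitzWith.of_dist_le' fun x y => ?_
      rw [Real.dist_eq, sub_sub_sub_cancel_right, ← mul_sub, abs_mul, abs_of_pos (by positivity),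
        ← Real.dist_eq]
      calc _ ≤ 4 / r * (K * dist x y) := by gcongr; exact hψ.dist_le_mul x y
        _ = _ := by ring
    exact (h1.const_min 1).const_max 0
  have hF01 : ∀ x, F x ∈ Set.Icc (0 : ℝ) 1 := fun x =>
    ⟨le_max_left _ _, max_le zero_le_one (min_le_left _ _)⟩
  -- At this mollification radius `ψ` varies by at most `r/8`, so both plateaux survive with room to
  -- spare; `K + 1` avoids division by zero.
  have hδ : 0 < r / (8 * (K + 1)) := by positivity
  obtain ⟨β, hβ, hβc, hβ0, hβ1, hβs⟩ := exists_mollifier d hδ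
  have hχ : ContDiff ℝ ∞ (mollify β F) :=
    contDiff_mollify hβ hβc hFL.continuous.locallyIntegrable
  have hnear : ∀ x, ∀ y ∈ Metric.ball x (r / (8 * (K + 1))), |ψ y - ψ x| ≤ r / 8 := by
    intro x y hy
    rw [← Real.dist_eq]
    refine (hψ.dist_le_mul y x).trans ?_
    have h1 : dist y x ≤ r / (8 * (K + 1)) := (Metric.mem_ball.1 hy).le
    calc (K : ℝ) * dist y x ≤ (K + 1) * (r / (8 * (K + 1))) := by
          gcongr
          linarith
      _ = r / 8 := by field_simp
  have hone : ∀ x, 3 * r / 4 < ψ x → mollify β F x = 1 := by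
    intro x hx
    refine dist_le_zero.1 (dist_mollify_le le_rfl hβ0 hβ1 hβs hFL.continuous.aestronglyMeasurable
      fun y hy => ?_)
    have h1 := (abs_le.1 (hnear x y hy)).1
    have h2 : 1 ≤ 4 / r * ψ y - 1 := by
      have : 2 ≤ 4 / r * ψ y := by
        rw [div_mul_eq_mul_div, le_div_iff₀ hr]
        linarith
      linarith
    simp [hF, min_eq_left h2]
  have hzero : ∀ x, ψ x < r / 8 → mollify β F x = 0 := by
    intro x hx
    refine dist_le_zero.1 (dist_mollify_le le_rfl hβ0 hβ1 hβs hFL.continuous.aestronglyMeasurable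
      fun y hy => ?_)
    have h1 := (abs_le.1 (hnear x y hy)).2
    have h2 : 4 / r * ψ y - 1 ≤ 0 := by
      have : 4 / r * ψ y ≤ 1 := by
        rw [div_mul_eq_mul_div, div_le_one hr]
        linarith
      linarith
    simp [hF, max_eq_left ((min_le_right 1 _).trans h2)]
  refine ⟨mollify β F, hχ, fun x => ?_, fun x hx => hone x (by linarith), ?_, fun i x => ?_⟩
  · have h := dist_mollify_le (z := 1 / 2) (x := x) (ε := 1 / 2) (by norm_num) hβ0 hβ1 hβs
      hFL.continuous.aestronglyMeasurable fun y _ => by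
        rw [Real.dist_eq, abs_le]
        constructor <;> linarith [(hF01 y).1, (hF01 y).2]
    rw [Real.dist_eq, abs_le] at h
    constructor <;> linarith [h.1, h.2]
  · refine closure_minimal (fun x hx => ?_) (isClosed_le continuous_const hψ.continuous)
    by_contra h
    exact hx (hzero x (not_le.1 h))
  · by_cases hx : x ∈ {x | r / 8 ≤ ψ x ∧ ψ x ≤ r}
    · rw [Set.indicator_of_mem hx]
      have := abs_partialDeriv_le (lipschitzWith_mollify hβ.continuous hβc hβ0 hβ1 hFL) i x
      rwa [Real.coe_toNNReal _ (by positivity)] at this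
    · rw [Set.indicator_of_notMem hx]
      have hev : ∃ z : ℝ, mollify β F =ᶠ[𝓝 x] fun _ => z := by
        by_cases h : r / 8 ≤ ψ x
        · have h' : r < ψ x := not_le.1 fun h' => hx ⟨h, h'⟩
          refine ⟨1, ?_⟩
          filter_upwards [(isOpen_lt continuous_const hψ.continuous).mem_nhds
            (show 3 * r / 4 < ψ x by linarith)] with y hy using hone y hy
        · refine ⟨0, ?_⟩
          filter_upwards [(isOpen_lt hψ.continuous continuous_const).mem_nhds
            (not_le.1 h)] with y hy using hzero y hy
      obtain ⟨z, hz⟩ := hev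
      rw [partialDeriv, hz.fderiv_eq]
      simp

end EdgeCutoff

section Conclusion

/-- Otherwise the terms eventually exceed `ε/(m+1)`, contradicting divergence of the harmonic
series. -/
theorem frequently_mul_le_of_summable {a : ℕ → ℝ} (ha : Summable a) {ε : ℝ} (hε : 0 < ε) :
    ∃ᶠ m : ℕ in atTop, ((m : ℝ) + 1) * a m ≤ ε := by
  intro h
  obtain ⟨N, hN⟩ := eventually_atTop.1 h
  have h1 : Summable fun m : ℕ => ε * (1 / ((m + N + 1 : ℕ) : ℝ)) := by
    refine Summable.of_nonneg_of_le (fun m => by positivity) (fun m => ?_)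
      ((summable_nat_add_iff N).2 ha)
    have h2 := not_le.1 (hN (m + N) (by omega))
    rw [mul_one_div, div_le_iff₀ (by positivity)]
    push_cast at h2 ⊢
    linarith
  have h2 := (summable_mul_left_iff hε.ne').1 h1
  exact Real.not_summable_one_div_natCast ((summable_nat_add_iff (N + 1)).1 h2)

variable {d : ℕ} {Ω : Set (𝔼 d)} {k j : Fin d} {c : ℝ} {p q : (𝔼 d) → ℝ}
  {p' q' : Fin d → (𝔼 d) → ℝ} {χ ψ : (𝔼 d) → ℝ} {K : NNReal}

/-- Young's inequality with a free parameter `τ`, to be balanced against the scale of the cutoff. -/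
theorem abs_mul_sub_le {l τ u v b f g : ℝ} (hl : 0 ≤ l) (hτ : 0 < τ) (hu : |u| ≤ l) (hv : |v| ≤ l) :
    b * (u * f - v * g) ≤ l * (τ * b ^ 2 + τ⁻¹ * (f ^ 2 + g ^ 2)) := by
  have h1 : |b * (u * f - v * g)| ≤ |b| * (l * |f| + l * |g|) := by
    rw [abs_mul]
    gcongr
    refine (abs_sub _ _).trans ?_
    rw [abs_mul, abs_mul]
    gcongr
  have key : ∀ x : ℝ, |b| * |x| ≤ τ * b ^ 2 / 2 + τ⁻¹ * x ^ 2 / 2 := by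
    intro x
    have h3 : 0 ≤ τ⁻¹ * (τ * |b| - |x|) ^ 2 := by positivity
    have h4 : τ⁻¹ * (τ * |b| - |x|) ^ 2 = τ * b ^ 2 - 2 * (|b| * |x|) + τ⁻¹ * x ^ 2 := by
      rw [← sq_abs b, ← sq_abs x]
      field_simp
      ring
    linarith
  have h5 : 0 ≤ τ⁻¹ * f ^ 2 := by positivity
  have h6 : 0 ≤ τ⁻¹ * g ^ 2 := by positivity
  calc _ ≤ _ := (le_abs_self _).trans h1
    _ = l * (|b| * |f| + |b| * |g|) := by ring
    _ ≤ l * (τ * b ^ 2 + τ⁻¹ * (f ^ 2 + g ^ 2)) :=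
      mul_le_mul_of_nonneg_left (by linarith [key f, key g]) hl

/-- Isolates the error made by a cutoff: the terms with `∇χ` live on `A` and are split by Young's
inequality into a mass term and a gradient term. -/
theorem IsMixedField.integral_bracketDensity_le (hΩo : IsOpen Ω) (hΩ : Bornology.IsBounded Ω)
    (h : IsMixedField Ω k j c p q p' q') (hχ : ContDiff ℝ ∞ χ) {A : Set (𝔼 d)}
    (hA : MeasurableSet A) {l τ : ℝ} (hl : 0 ≤ l) (hτ : 0 < τ)
    (hle : ∀ i x, |partialDeriv i χ x| ≤ A.indicator (fun _ => l) x) :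
    ∫ x in Ω, bracketDensity k j p q p' q' χ x ≤
      2 * (∫ x in Ω, χ x * (p' k x * q' j x - p' j x * q' k x)) +
        l * (τ * ((∫ x in Ω ∩ A, p x ^ 2) + ∫ x in Ω ∩ A, q x ^ 2) +
          τ⁻¹ * ∫ x in Ω ∩ A, (p' k x ^ 2 + p' j x ^ 2 + (q' k x ^ 2 + q' j x ^ 2))) := by
  obtain ⟨⟨hp, hp'⟩, hq, hq'⟩ := h.memLp
  have iB : Integrable (fun x => χ x * (p' k x * q' j x - p' j x * q' k x))
      (volume.restrict Ω) := by
    refine (((memLp_continuous_mul hΩo hΩ (hp' k) hχ.continuous).integrable_mul (hq' j)).sub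
      ((memLp_continuous_mul hΩo hΩ (hp' j) hχ.continuous).integrable_mul (hq' k))).congr
      (ae_of_all _ fun x => ?_)
    simp only [Pi.sub_apply, Pi.mul_apply]
    ring
  have hmono : volume.restrict (Ω ∩ A) ≤ volume.restrict Ω :=
    Measure.restrict_mono Set.inter_subset_left le_rfl
  have iW1 := hp.integrable_sq
  have iW2 := hq.integrable_sq
  have iG : Integrable (fun x => p' k x ^ 2 + p' j x ^ 2 + (q' k x ^ 2 + q' j x ^ 2))
      (volume.restrict Ω) :=
    ((hp' k).integrable_sq.add (hp' j).integrable_sq).add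
      ((hq' k).integrable_sq.add (hq' j).integrable_sq)
  set f : (𝔼 d) → ℝ := fun x => l * (τ * (p x ^ 2 + q x ^ 2) +
    τ⁻¹ * (p' k x ^ 2 + p' j x ^ 2 + (q' k x ^ 2 + q' j x ^ 2))) with hf
  have iW : Integrable (fun x => p x ^ 2 + q x ^ 2) (volume.restrict Ω) := iW1.add iW2
  have iF : Integrable f (volume.restrict Ω) := ((iW.const_mul τ).add (iG.const_mul τ⁻¹)).const_mul l
  have e : l * (τ * ((∫ x in Ω ∩ A, p x ^ 2) + ∫ x in Ω ∩ A, q x ^ 2) +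
      τ⁻¹ * ∫ x in Ω ∩ A, (p' k x ^ 2 + p' j x ^ 2 + (q' k x ^ 2 + q' j x ^ 2))) =
      ∫ x in Ω, A.indicator f x := by
    rw [setIntegral_indicator hA, hf, integral_const_mul, integral_add
      ((iW.mono_measure hmono).const_mul τ) ((iG.mono_measure hmono).const_mul τ⁻¹),
      integral_const_mul, integral_const_mul, integral_add (iW1.mono_measure hmono)
      (iW2.mono_measure hmono)]
  rw [e, ← integral_const_mul, ← integral_add (iB.const_mul 2) (iF.indicator hA)]
  refine integral_mono (h.integrable_bracketDensity hΩo hΩ hχ)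
    ((iB.const_mul 2).add (iF.indicator hA)) fun x => ?_
  simp only [bracketDensity, add_le_add_iff_left]
  have hk := hle k x
  have hj := hle j x
  by_cases hx : x ∈ A
  · rw [Set.indicator_of_mem hx] at hk hj ⊢
    have h1 := abs_mul_sub_le (b := p x) (f := q' j x) (g := q' k x) hl hτ hk hj
    have h2 := abs_mul_sub_le (b := q x) (f := p' k x) (g := p' j x) hl hτ hj hk
    have e3 : p' k x * partialDeriv j χ x - p' j x * partialDeriv k χ x =
      partialDeriv j χ x * p' k x - partialDeriv k χ x * p' j x := by ring
    rw [e3]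
    refine (add_le_add h1 h2).trans_eq ?_
    simp only [hf]
    ring
  · rw [Set.indicator_of_notMem hx] at hk hj ⊢
    rw [abs_nonpos_iff.1 hk, abs_nonpos_iff.1 hj]
    simp

/-- The bracket has nonnegative integral, as the edge of the flat face is negligible. -/
theorem IsMixedField.integral_bracket_nonneg (hΩo : IsOpen Ω) (hΩ : Bornology.IsBounded Ω)
    (hc : Convex ℝ Ω) (hne : Ω.Nonempty) (hmiss : ∀ x ∈ Ω, x k ≠ c) (hjk : j ≠ k)
    (h : IsMixedField Ω k j c p q p' q') (hψ : LipschitzWith K ψ) (hpos : ∀ x ∈ Ω, 0 < ψ x)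
    (hedge : ∀ x ∈ frontier Ω, x k = c → x ∈ closure (frontier Ω ∩ {y | y k ≠ c}) → ψ x = 0)
    {C₁ C₂ : ℝ} (hC₁ : 0 ≤ C₁) (hC₂ : 0 ≤ C₂)
    (hp : ∀ r : ℝ, 0 < r → r ≤ 1 / 2 →
      ∫ x in Ω ∩ {x | ψ x ≤ r}, p x ^ 2 ≤ C₁ * (r ^ 2 * (1 + Real.log (1 / r))))
    (hq : ∀ r : ℝ, 0 < r → r ≤ 1 / 2 →
      ∫ x in Ω ∩ {x | ψ x ≤ r}, q x ^ 2 ≤ C₂ * (r ^ 2 * (1 + Real.log (1 / r)))) :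
    0 ≤ ∫ x in Ω, (p' k x * q' j x - p' j x * q' k x) := by
  obtain ⟨⟨mp, mp'⟩, mq, mq'⟩ := h.memLp
  -- The ratio `1/16` is below the inner relative radius `1/8` of the shells, so consecutive shells
  -- are disjoint.
  set r : ℕ → ℝ := fun m => (1 / 16) ^ m with hr
  have hr0 : ∀ m, 0 < r m := fun m => by positivity
  choose χ hχ hχI hχ1 hχs hχd using fun m => exists_lipschitz_cutoff hψ (hr0 m)
  set A : ℕ → Set (𝔼 d) := fun m => {x | r m / 8 ≤ ψ x ∧ ψ x ≤ r m} with hA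
  have hAm : ∀ m, MeasurableSet (A m) := fun m =>
    ((isClosed_le continuous_const hψ.continuous).inter
      (isClosed_le hψ.continuous continuous_const)).measurableSet
  set G : (𝔼 d) → ℝ := fun x => p' k x ^ 2 + p' j x ^ 2 + (q' k x ^ 2 + q' j x ^ 2) with hG
  have iG : Integrable G (volume.restrict Ω) :=
    ((mp' k).integrable_sq.add (mp' j).integrable_sq).add
      ((mq' k).integrable_sq.add (mq' j).integrable_sq)
  have hdisj : Pairwise (Function.onFun Disjoint fun m => Ω ∩ A m) := by
    have key : ∀ m l, m < l → Disjoint (Ω ∩ A m) (Ω ∩ A l) := by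
      intro m l hml
      refine Set.disjoint_left.2 fun x hx hx' => ?_
      have h1 : r l ≤ r (m + 1) := pow_le_pow_of_le_one (by norm_num) (by norm_num) hml
      have h2 : r (m + 1) = r m * (1 / 16) := pow_succ _ _
      have h3 := hx.2.1
      have h4 := hx'.2.2
      have := hr0 m
      linarith
    intro m l hml
    rcases lt_or_gt_of_ne hml with h | h
    · exact key m l h
    · exact (key l m h).symm
  have hsum : Summable fun m => ∫ x in Ω ∩ A m, G x := by
    refine (hasSum_integral_iUnion (fun m => hΩo.measurableSet.inter (hAm m)) hdisj
      (IntegrableOn.mono_set iG (Set.iUnion_subset fun m => Set.inter_subset_left))).summable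
  set B : (𝔼 d) → ℝ := fun x => p' k x * q' j x - p' j x * q' k x with hB
  have iB : Integrable B (volume.restrict Ω) :=
    ((mp' k).integrable_mul (mq' j)).sub ((mp' j).integrable_mul (mq' k))
  have hlim : Tendsto (fun m => ∫ x in Ω, χ m x * B x) atTop (𝓝 (∫ x in Ω, B x)) := by
    refine tendsto_integral_of_dominated_convergence (fun x => ‖B x‖)
      (fun m => (hχ m).continuous.aestronglyMeasurable.mul iB.aestronglyMeasurable) iB.norm
      (fun m => ae_of_all _ fun x => ?_) ?_
    · rw [norm_mul, Real.norm_of_nonneg (hχI m x).1]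
      exact mul_le_of_le_one_left (norm_nonneg _) (hχI m x).2
    · filter_upwards [ae_restrict_mem hΩo.measurableSet] with x hx
      have hr_lim : Tendsto r atTop (𝓝 0) :=
        tendsto_pow_atTop_nhds_zero_of_lt_one (by norm_num) (by norm_num)
      refine tendsto_const_nhds.congr' ?_
      filter_upwards [hr_lim.eventually (gt_mem_nhds (hpos x hx))] with m hm
      rw [hχ1 m x hm.le, one_mul]
  set L := Real.log 16 with hL
  have hL0 : 0 ≤ L := Real.log_nonneg (by norm_num)
  set M := 4 * K * ((C₁ + C₂) * (1 + L) + 1) with hM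
  have hM0 : 0 ≤ M := by positivity
  have main : ∀ ε : ℝ, 0 < ε → -(M * ε) / 2 ≤ ∫ x in Ω, B x := by
    intro ε hε
    refine ge_of_tendsto_of_frequently hlim ?_
    -- Good scales need occur only infinitely often, as the localized integrals converge along all
    -- scales.
    refine ((frequently_mul_le_of_summable hsum (pow_pos hε 2)).and_eventually
      (eventually_ge_atTop 1)).mono ?_
    rintro m ⟨hm, hm1⟩
    have hrm := hr0 m
    have hr2 : r m ≤ 1 / 2 :=
      calc r m ≤ (1 / 16) ^ 1 := pow_le_pow_of_le_one (by norm_num) (by norm_num) hm1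
        _ ≤ 1 / 2 := by norm_num
    have hlog : Real.log (1 / r m) = m * L := by
      rw [hr, one_div, ← inv_pow, Real.log_pow]
      norm_num [hL]
    have h0 := h.bracket_nonneg hΩo hΩ hc hne hmiss hjk (hχ m) (fun x => (hχI m x).1)
      fun x hx hxk hxc hxt => by
        have h1 : r m / 8 ≤ ψ x := hχs m hxt
        rw [hedge x hx hxk hxc] at h1
        linarith
    -- With this choice the mass term is of order `(1 + m log 16)/(m + 1) · ε`, since `log (1/r) = m
    -- log 16`, and the gradient term is `(m + 1)` times the shell mass over `ε`, at most `ε` at a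
    -- good scale.
    set τ := ε / ((m + 1) * r m) with hτ
    have hτ0 : 0 < τ := by positivity
    have h1 := h.integral_bracketDensity_le hΩo hΩ (hχ m) (hAm m) (l := 4 * K / r m)
      (by positivity) hτ0 (hχd m)
    have hsub : volume.restrict (Ω ∩ A m) ≤ volume.restrict (Ω ∩ {x | ψ x ≤ r m}) :=
      Measure.restrict_mono (Set.inter_subset_inter_right _ fun x hx => hx.2) le_rfl
    have hsub2 : volume.restrict (Ω ∩ {x | ψ x ≤ r m}) ≤ volume.restrict Ω :=
      Measure.restrict_mono Set.inter_subset_left le_rfl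
    have h2 : ∫ x in Ω ∩ A m, p x ^ 2 ≤ C₁ * (r m ^ 2 * (1 + m * L)) := by
      rw [← hlog]
      exact (integral_mono_measure hsub (ae_of_all _ fun x => sq_nonneg _)
        (mp.integrable_sq.mono_measure hsub2)).trans (hp _ hrm hr2)
    have h3 : ∫ x in Ω ∩ A m, q x ^ 2 ≤ C₂ * (r m ^ 2 * (1 + m * L)) := by
      rw [← hlog]
      exact (integral_mono_measure hsub (ae_of_all _ fun x => sq_nonneg _)
        (mq.integrable_sq.mono_measure hsub2)).trans (hq _ hrm hr2)
    have h4 : 4 * K / r m * (τ * ((∫ x in Ω ∩ A m, p x ^ 2) + ∫ x in Ω ∩ A m, q x ^ 2) +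
        τ⁻¹ * ∫ x in Ω ∩ A m, G x) ≤ M * ε := by
      calc _ ≤ 4 * K / r m * (τ * (C₁ * (r m ^ 2 * (1 + m * L)) + C₂ * (r m ^ 2 * (1 + m * L))) +
            τ⁻¹ * ∫ x in Ω ∩ A m, G x) := by gcongr
        _ = 4 * K * ((C₁ + C₂) * ((1 + m * L) / (m + 1)) * ε +
            ((m + 1) * ∫ x in Ω ∩ A m, G x) / ε) := by
            rw [hτ]
            field_simp
        _ ≤ 4 * K * ((C₁ + C₂) * (1 + L) * ε + ε ^ 2 / ε) := by
            gcongr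
            rw [div_le_iff₀ (by positivity)]
            have : (0 : ℝ) ≤ m := Nat.cast_nonneg m
            nlinarith
        _ = M * ε := by
            rw [hM]
            field_simp
    linarith
  by_contra! hneg
  -- For this `ε` the bound reads `I/2 ≤ I` for the negative integral `I`, a contradiction.
  have h5 := main (-(∫ x in Ω, B x) / (M + 1)) (by
    have : 0 < -∫ x in Ω, B x := neg_pos.2 hneg
    positivity)
  have h6 : M * (-(∫ x in Ω, B x) / (M + 1)) ≤ -(∫ x in Ω, B x) := by
    rw [mul_div_assoc', div_le_iff₀ (by positivity)]
    nlinarith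
  linarith

end Conclusion

end

/-! ### Assembling the inequality. -/

section

/-- The bracket inequality for `p = ∂ₖu` and `q = ∂ⱼu`, with `edgeDist` as the distance to the edge;
commuting weak derivatives turn `∂ⱼp ∂ₖq` into the square. -/
theorem U2.integral_sq_le {d : ℕ} (hd : 2 ≤ d) {Ω Γ Γ' : Set (𝔼 d)} (hΩo : IsOpen Ω)
    (hΩ : Bornology.IsBounded Ω) (hc : Convex ℝ Ω) (hne : Ω.Nonempty)
    (hΓ : IsRelOpenInBoundary Ω Γ) (hΓ' : IsRelOpenInBoundary Ω Γ') (hΓ'ne : Γ'.Nonempty)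
    (hcover : closure Γ ∪ closure Γ' = frontier Ω) (hnull : surfaceMeasure Ω (closure Γ \ Γ) = 0)
    {k j : Fin d} {c : ℝ} (hplane : ∀ x ∈ Γ', x k = c) (hjk : j ≠ k) {u : (𝔼 d) → ℝ}
    (hu : u ∈ U2 Ω Γ Γ') :
    ∫ x in Ω, weakPartial Ω k (weakPartial Ω j u) x ^ 2 ≤
      ∫ x in Ω, weakPartial Ω k (weakPartial Ω k u) x * weakPartial Ω j (weakPartial Ω j u) x := by
  obtain ⟨n, rfl⟩ : ∃ n, d = n + 1 := ⟨d - 1, by omega⟩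
  -- This is where `d ≥ 2` enters: the shell formula needs at least one direction along the face.
  have : Nonempty (Fin n) := ⟨⟨0, by omega⟩⟩
  obtain ⟨σ, a, R, y₀, hf⟩ := exists_isFaceFrame hΩo hΩ hc hΓ' hΓ'ne hplane
  have hmiss : ∀ x ∈ Ω, x k ≠ c := fun x hx h => by
    have := hf.side x hx
    rw [h, sub_self, mul_zero] at this
    exact this.false
  have h := U2.isMixedField hΩo hΩ hc hne hmiss hjk hcover hplane hΓ hnull hu
  obtain ⟨K, hK⟩ := hf.lipschitz_edgeDist hc
  obtain ⟨P, hP⟩ := h.lim_fst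
  obtain ⟨Q, hQ⟩ := h.lim_snd
  obtain ⟨C₁, hC₁, hp⟩ := hf.exists_integral_edge_le hΩo hΩ hc hP
  obtain ⟨C₂, hC₂, hq⟩ := hf.exists_integral_edge_le hΩo hΩ hc hQ
  have h0 := h.integral_bracket_nonneg hΩo hΩ hc hne hmiss hjk hK (fun x hx => hf.edgeDist_pos hx)
    (fun x hx hxk hxc => hf.edgeDist_eq_zero hΩo hc hx hxk hxc) hC₁ hC₂ hp hq
  obtain ⟨⟨-, mp'⟩, -, mq'⟩ := h.memLp
  have e : ∫ x in Ω, weakPartial Ω j (weakPartial Ω k u) x * weakPartial Ω k (weakPartial Ω j u) x =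
      ∫ x in Ω, weakPartial Ω k (weakPartial Ω j u) x ^ 2 := by
    refine integral_congr_ae ?_
    filter_upwards [h.symm] with x hx
    rw [hx, sq]
  have i1 : Integrable (fun x => weakPartial Ω k (weakPartial Ω k u) x *
      weakPartial Ω j (weakPartial Ω j u) x) (volume.restrict Ω) := (mp' k).integrable_mul (mq' j)
  have i2 : Integrable (fun x => weakPartial Ω j (weakPartial Ω k u) x *
      weakPartial Ω k (weakPartial Ω j u) x) (volume.restrict Ω) := (mp' j).integrable_mul (mq' k)
  rw [integral_sub i1 i2, e] at h0
  linarith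

end

end MixedBVP

end

theorem mainTheorem6 (d : ℕ) (hd : 2 ≤ d)
    (Ω Γ Γ' : Set (EuclideanSpace ℝ (Fin d)))
    (hΩ_open : IsOpen Ω) (hΩ_bounded : Bornology.IsBounded Ω) (hΩ_convex : Convex ℝ Ω)
    (hΩ_nonempty : Ω.Nonempty)
    (hΓ_open : MixedBVP.IsRelOpenInBoundary Ω Γ)
    (hΓ'_open : MixedBVP.IsRelOpenInBoundary Ω Γ')
    (hΓ_nonempty : Γ.Nonempty) (hΓ'_nonempty : Γ'.Nonempty)
    (hdisj : Disjoint Γ Γ')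
    (hcover : closure Γ ∪ closure Γ' = frontier Ω)
    (hnull : MixedBVP.surfaceMeasure Ω (closure Γ \ Γ) = 0)
    (hplane : ∃ c : ℝ, ∀ x ∈ Γ', x (⟨0, by omega⟩ : Fin d) = c)
    (j : Fin d) (u : EuclideanSpace ℝ (Fin d) → ℝ) (hu : u ∈ MixedBVP.U2 Ω Γ Γ') :
    ∫ x in Ω, (MixedBVP.weakPartial Ω ⟨0, by omega⟩ (MixedBVP.weakPartial Ω j u) x) ^ 2 ≤
      ∫ x in Ω,
        MixedBVP.weakPartial Ω ⟨0, by omega⟩ (MixedBVP.weakPartial Ω ⟨0, by omega⟩ u) x *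
          MixedBVP.weakPartial Ω j (MixedBVP.weakPartial Ω j u) x := by
  obtain ⟨c, hc⟩ := hplane
  -- For `j` the first coordinate the two integrands coincide.
  by_cases hjk : j = ⟨0, by omega⟩
  · subst hjk
    simp only [sq]
    exact le_rfl
  · exact MixedBVP.U2.integral_sq_le hd hΩ_open hΩ_bounded hΩ_convex hΩ_nonempty hΓ_open hΓ'_open
      hΓ'_nonempty hcover hnull hc hjk hu
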